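/- Work over $\mathbb C$ in the projective plane. A \emph{flex} of a curve $B$ is a smooth point $P\in B$ whose tangent line $L_P$ satisfies $I(B,L_P;P)\ge 3$; its multiplicity is $I(B,L_P;P)-2$, and it is \emph{ordinary} if $I(B,L_P;P)=3$. A sextic is \emph{of torus type} if it has a defining equation $f_2^3+f_3^2=0$ with $f_j$ homogeneous of degree $j$, and \emph{of non-torus type} otherwise. For an irreducible quartic $B_4$, an unordered pair $\{P,Q\}$ of distinct flexes is called of torus (non-torus) type if the sextic $B_4\cup L_P\cup L_Q$ is. $\Sigma(C)$ denotes the configuration of singularities of $C$. Sextics "of type $B_4+B_1+B_1'$" are unions of an irreducible quartic $B_4$ and two lines $B_1,B_1'$. \textbf{Case (a).} If $C=B_4+B_1+B_1'$ has $\Sigma(C)=[3A_5,3A_1]$, then $\Sigma(B_4)=[A_5]$ and $B_1,B_1'$ are the tangent lines of $B_4$ at two distinct flexes. Every irreducible quartic $B_4$ with $\Sigma(B_4)=[A_5]$ has 6 flexes, counted with multiplicity, and at least two flex pairs of torus type. If all its flexes are ordinary, then it has exactly 6 flexes, exactly three of the 15 flex pairs are of torus type, and the other 12 are of non-torus type.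 \textbf{Case (b).} Let $k\in\{3,4\}$. If $C=B_4+B_1+B_1'$ has $\Sigma(C)=[2A_5,2A_2,kA_1]$, then $\Sigma(B_4)=[2A_2,(k-3)A_1]$ and $B_1,B_1'$ are the tangent lines of $B_4$ at two distinct flexes. Every irreducible quartic with $\Sigma(B_4)=[2A_2]$ has 8 flexes, counted with multiplicity (exactly 8 if all are ordinary), and it has both flex pairs of torus type and flex pairs of non-torus type. Every irreducible quartic with $\Sigma(B_4)=[2A_2,A_1]$ has 2 flexes, counted with multiplicity; if they are ordinary, there are exactly 2, and they form a pair of torus type. If $\Sigma(C)=[2A_5,2A_2,4A_1]$ with $C=B_4+B_1+B_1'$, then $B_4$ has exactly 2 flexes and $C$ is of torus type. \textbf{Case (c).} If $C=B_4+B_1+B_1'$ has $\Sigma(C)=[E_6,2A_5,3A_1]$, then $\Sigma(B_4)=[E_6]$, $B_4$ has exactly 2 flexes, $B_1,B_1'$ are the tangent lines at them, and $C$ is of torus type; so there is no sextic of non-torus type with this configuration and component type. Every irreducible quartic with $\Sigma(B_4)=[E_6]$ has 2 flexes, counted with multiplicity; if they are ordinary, there are exactly 2, and they form a pair of torus type.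 -/

import Mathlib

open MvPolynomial

noncomputable section

namespace PlaneCurve

/-- The complex projective plane. -/
abbrev P2 : Type := Projectivization ℂ (Fin 3 → ℂ)

/-- Ternary polynomials; the homogeneous ones are the equations of plane curves. -/
abbrev Form : Type := MvPolynomial (Fin 3) ℂ

/-- An irreducible plane quartic `F = 0`. -/
def IsIrredQuartic (F : Form) : Prop := F.IsHomogeneous 4 ∧ Irreducible F

/-- `P` lies on the curve `F = 0` (`F` homogeneous). -/
def OnCurve (F : Form) (P : P2) : Prop := eval P.rep F = 0

/-- `P` is a singular point of the curve `F = 0`. -/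
def IsSingularPt (F : Form) (P : P2) : Prop :=
  OnCurve F P ∧ ∀ i, eval P.rep (pderiv i F) = 0

/-- `P` is a smooth point of the curve `F = 0`. -/
def IsSmoothPt (F : Form) (P : P2) : Prop :=
  OnCurve F P ∧ ∃ i, eval P.rep (pderiv i F) ≠ 0

/-- The linear form that defines the tangent line of `F = 0` at a smooth point `P`. -/
def tangentForm (F : Form) (P : P2) : Form :=
  ∑ i, C (eval P.rep (pderiv i F)) * X i

/-- The polynomial `F (p + t v)` in `t`. -/
def restrictLine (F : Form) (p v : Fin 3 → ℂ) : Polynomial ℂ :=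
  aeval (fun i => Polynomial.C (p i) + Polynomial.C (v i) * Polynomial.X) F

/-- The intersection multiplicity at `P` of the curve `F = 0` with the line `l = 0`, for `P` on
the line: the order at `t = 0` of `F (p + t v)`, where `p` represents `P` and `p, v` span the
line. All such `v` give the same order, and the multiples `v` of `p` (if `P` is on the curve)
give `⊤`, so the infimum over all `v` on the line is this order. -/
def lineMult (F l : Form) (P : P2) : ℕ∞ :=
  ⨅ v : {v : Fin 3 → ℂ // eval v l = 0},
    emultiplicity (Polynomial.X : Polynomial ℂ) (restrictLine F P.rep v)

/-- The intersection multiplicity at `P` of the curve with its tangent line at `P`. -/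
def tangentMult (F : Form) (P : P2) : ℕ∞ := lineMult F (tangentForm F P) P

/-- The set of flexes: smooth points where the tangent line has intersection multiplicity
greater than `2` with the curve. -/
def flexes (F : Form) : Set P2 := {P | IsSmoothPt F P ∧ 2 < tangentMult F P}

/-- The multiplicity of a flex `P`: the intersection multiplicity with the tangent, minus `2`. -/
def flexOrder (F : Form) (P : P2) : ℕ := (tangentMult F P).toNat - 2

/-- All flexes are ordinary: their tangents have intersection multiplicity exactly `3`. -/
def OrdinaryFlexes (F : Form) : Prop := ∀ P ∈ flexes F, tangentMult F P = 3

/-- The sextic `G = 0` is of (2,3)-torus type: some defining polynomial of it (a nonzero scalar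
multiple of `G`) is `f₂ ^ 3 + f₃ ^ 2` with `f₂` a conic and `f₃` a cubic form. -/
def IsTorusType (G : Form) : Prop :=
  ∃ c : ℂ, c ≠ 0 ∧ ∃ f₂ f₃ : Form, f₂.IsHomogeneous 2 ∧ f₃.IsHomogeneous 3 ∧
    C c * G = f₂ ^ 3 + f₃ ^ 2

/-- The union of the quartic `F = 0` and its tangent lines at `P` and `Q`. -/
def tangentSextic (F : Form) (P Q : P2) : Form := F * tangentForm F P * tangentForm F Q

/-- The unordered pairs of distinct flexes that are of torus type. -/
def torusPairs (F : Form) : Set (Sym2 P2) :=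
  {s | ∃ P ∈ flexes F, ∃ Q ∈ flexes F,
    P ≠ Q ∧ s = s(P, Q) ∧ IsTorusType (tangentSextic F P Q)}

/-- The unordered pairs of distinct flexes that are of non-torus type. -/
def nonTorusPairs (F : Form) : Set (Sym2 P2) :=
  {s | ∃ P ∈ flexes F, ∃ Q ∈ flexes F,
    P ≠ Q ∧ s = s(P, Q) ∧ ¬ IsTorusType (tangentSextic F P Q)}

/-- Names of the simple curve singularities that occur here. -/
inductive SingType : Type
  | A (n : ℕ)
  | E6

/-- The normal forms: `x ^ 2 + y ^ (n + 1)` for `A_n`, `x ^ 3 + y ^ 4` for `E_6`. -/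
def SingType.normalForm : SingType → MvPowerSeries (Fin 2) ℂ
  | .A n => MvPowerSeries.X 0 ^ 2 + MvPowerSeries.X 1 ^ (n + 1)
  | .E6 => MvPowerSeries.X 0 ^ 3 + MvPowerSeries.X 1 ^ 4

/-- The equation of the curve in the affine coordinates `x, y` of `p + x u + y v`, as a formal
power series at the origin. -/
def localEq (F : Form) (p u v : Fin 3 → ℂ) : MvPowerSeries (Fin 2) ℂ :=
  ((aeval (fun i => C (p i) + C (u i) * X 0 + C (v i) * X 1) F : MvPolynomial (Fin 2) ℂ) :
    MvPowerSeries (Fin 2) ℂ)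

/-- The germ of `F = 0` at `P` has type `T`: in affine coordinates centred at `P` its equation
becomes, up to a unit, the normal form after a formal change of coordinates. -/
def HasSingType (F : Form) (P : P2) (T : SingType) : Prop :=
  ∃ u v : Fin 3 → ℂ, LinearIndependent ℂ ![P.rep, u, v] ∧
    ∃ φ : MvPowerSeries (Fin 2) ℂ ≃ₐ[ℂ] MvPowerSeries (Fin 2) ℂ,
      ∃ w : (MvPowerSeries (Fin 2) ℂ)ˣ, φ (localEq F P.rep u v) = w * T.normalForm

/-- The configuration of singularities of `F = 0` is the multiset `S`. -/
def HasConfig (F : Form) (S : Multiset SingType) : Prop :=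
  ∃ (s : Finset P2) (τ : P2 → SingType),
    (∀ P, P ∈ s ↔ IsSingularPt F P) ∧ (∀ P ∈ s, HasSingType F P (τ P)) ∧ s.val.map τ = S

/-- The lines `l = 0` and `l' = 0` are the tangent lines of `F = 0` at two distinct flexes. -/
def AreFlexTangents (F l l' : Form) : Prop :=
  ∃ P ∈ flexes F, ∃ Q ∈ flexes F, P ≠ Q ∧
    Associated l (tangentForm F P) ∧ Associated l' (tangentForm F Q)

end PlaneCurve

end

open PlaneCurve PlaneCurve.SingType

open MvPolynomial

noncomputable section

namespace PlaneCurve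

/-! ### Linear forms and frames -/

/-! Normal form. In suitable linear coordinates every quartic in question is q² + b·q·z² + e·z⁴ +
s·z³ with q = w² + k·s² + l·s·z. Here k = l = 0 for E₆ (`IsIrredQuartic.exists_nf_E6`), k = 0 and
l·b = -1 for A₅ (`IsIrredQuartic.exists_nf_A5`), and k ≠ 0 and l = 0 for two cusps
(`IsIrredQuartic.exists_nf_cusps`). All points on z = 0 are singular. On z = 1, with u = q as
parameter, the equation says s = S(u) and w² = g(u), where S is quadratic: the affine curve is a
double cover of the u-line, singular exactly over double roots of g.

Flexes. Along its tangent at (u, ω) the quartic restricts to a²N(u)t² + 4aωβ(u)t³ + β(u)²t⁴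
(`NF.Is.restrictLine_tangent`). So a smooth point is a flex iff N(u) = 0, ordinary iff moreover ω ≠
0, and each relevant root of N contributes 2 to the weighted count, either as two conjugate flexes
(u, ±ω) or as one flex of order 2. Since N' = 6β and N = 4g + cβ, a common root of N and β is a
double root of g; so N has simple roots when there are no affine singularities. Its degree is 4, 3,
1 for 2A₂, A₅, E₆. A node is a triple root of N and leaves one further root. The totals 8, 6, 2, 2
follow.

Torus pairs. For each u₀ there are a conic and a cubic that restrict on the affine curve to -(u -
u₀)² and (u - u₀)³. Their cube and square add up to F times a residual conic
(`NF.torusConic_pow_add`), which for a root u₀ of N is, up to a scalar, the product of the tangents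
at the conjugate flexes (`NF.tangents_mul`). Hence conjugate pairs are of torus type. Conversely,
let F·R = f₂³ + f₃². For g squarefree the ring ℂ[u][w]/(w² - g) is integrally closed, so f₂ = -r²
and f₃ = -r³ on the curve (`exists_root_of_cube_add_sq`). Degrees force r to be either a linear
form, and then f₂³ + f₃² = 0 identically, or a multiple of u - u₀, and then R is a multiple of a
residual conic. Residual conics are even in w, and a product of two flex tangents is even in w only
if the flexes share their value of u (`NF.eq_of_even`).

Sextics. Where only one of the two lines passes, an admissible singularity is A₁ or A₅, and the line
meets the quartic there with multiplicity 1 or 3. Four simple intersections together with the node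
where the lines meet would give five A₁, too many; so each line meets the quartic as 3 + 1 and is a
flex tangent, and removing three A₁ and two A₅ leaves the configuration of the quartic
(`hasConfig_of_sextic`). The types Aₙ are handled through invariants only: being a square modulo a
power of the maximal ideal, and lying in a power of it. -/

theorem sum_eq_of_mem_support {n : ℕ} {F : Form} (hF : F.IsHomogeneous n) {m : Fin 3 →₀ ℕ}
    (hm : m ∈ F.support) : m 0 + m 1 + m 2 = n := by
  have := hF.degree_eq_sum_deg_support hm
  rw [← Finsupp.degree_apply, Finsupp.degree_eq_sum, Fin.sum_univ_three] at this
  exact this.symm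

/-- Homogeneity with a scalar from any ℂ-algebra; a power series as scalar is what the
reparametrization of lines requires. -/
theorem aeval_mul_left {A : Type*} [CommRing A] [Algebra ℂ A] {n : ℕ} {F : Form}
    (hF : F.IsHomogeneous n) (r : A) (g : Fin 3 → A) :
    aeval (fun i => r * g i) F = r ^ n * aeval g F := by
  rw [← F.support_sum_monomial_coeff, map_sum, map_sum, Finset.mul_sum]
  refine Finset.sum_congr rfl fun m hm => ?_
  rw [aeval_monomial, aeval_monomial, Finsupp.prod_fintype _ _ (by simp),
    Finsupp.prod_fintype _ _ (by simp), ← sum_eq_of_mem_support hF hm]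
  simp only [Fin.prod_univ_three]
  ring

theorem linear_form_eq {l : Form} (hl : l.IsHomogeneous 1) :
    l = ∑ i, C (coeff (Finsupp.single i 1) l) * X i := by
  have key : ∀ m ∈ l.support, ∃ i : Fin 3, m = Finsupp.single i 1 := by
    intro m hm
    have hd := sum_eq_of_mem_support hl hm
    have : (m 0 = 1 ∧ m 1 = 0 ∧ m 2 = 0) ∨ (m 0 = 0 ∧ m 1 = 1 ∧ m 2 = 0) ∨
        (m 0 = 0 ∧ m 1 = 0 ∧ m 2 = 1) := by omega
    rcases this with h | h | h
    · exact ⟨0, by ext i; fin_cases i <;> simp [h]⟩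
    · exact ⟨1, by ext i; fin_cases i <;> simp [h]⟩
    · exact ⟨2, by ext i; fin_cases i <;> simp [h]⟩
  ext m
  simp only [coeff_sum, coeff_C_mul, coeff_X]
  by_cases hm : m ∈ l.support
  · obtain ⟨i, rfl⟩ := key m hm
    rw [Finset.sum_eq_single i]
    · simp
    · intro j _ hj
      rw [if_neg]
      · simp
      · intro h
        exact hj (Finsupp.single_left_injective one_ne_zero h)
    · simp
  · rw [notMem_support_iff.mp hm, eq_comm]
    apply Finset.sum_eq_zero
    intro i _
    split_ifs with h
    · subst h
      simpa using notMem_support_iff.mp hm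
    · simp

theorem aeval_linear {A : Type*} [CommRing A] [Algebra ℂ A] {l : Form} (hl : l.IsHomogeneous 1)
    (g : Fin 3 → A) :
    aeval g l = ∑ i, algebraMap ℂ A (coeff (Finsupp.single i 1) l) * g i := by
  conv_lhs => rw [linear_form_eq hl]
  simp [map_sum]

theorem eval_linear {l : Form} (hl : l.IsHomogeneous 1) (v : Fin 3 → ℂ) :
    eval v l = ∑ i, coeff (Finsupp.single i 1) l * v i := by
  conv_lhs => rw [linear_form_eq hl]
  simp [map_sum]

theorem eval_linear_add {l : Form} (hl : l.IsHomogeneous 1) (v w : Fin 3 → ℂ) :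
    eval (v + w) l = eval v l + eval w l := by
  simp only [eval_linear hl, Pi.add_apply, Fin.sum_univ_three]; ring

theorem eval_linear_smul {l : Form} (hl : l.IsHomogeneous 1) (a : ℂ) (v : Fin 3 → ℂ) :
    eval (a • v) l = a * eval v l := by
  simp only [eval_linear hl, Pi.smul_apply, smul_eq_mul, Fin.sum_univ_three]; ring

theorem eval_homogeneous_smul {n : ℕ} {f : Form} (hf : f.IsHomogeneous n) (a : ℂ)
    (v : Fin 3 → ℂ) : eval (a • v) f = a ^ n * eval v f := by
  have := aeval_mul_left hf a v
  simpa [MvPolynomial.aeval_eq_eval, Pi.smul_def] using this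

/-- Three linear forms whose only common zero is the origin. -/
structure IsFrame (x y z : Form) : Prop where
  hx : x.IsHomogeneous 1
  hy : y.IsHomogeneous 1
  hz : z.IsHomogeneous 1
  inj : ∀ v : Fin 3 → ℂ, eval v x = 0 → eval v y = 0 → eval v z = 0 → v = 0

namespace IsFrame

variable {x y z : Form}

theorem ext_vec (h : IsFrame x y z) {v w : Fin 3 → ℂ} (h1 : eval v x = eval w x)
    (h2 : eval v y = eval w y) (h3 : eval v z = eval w z) : v = w := by
  have key : v + (-1 : ℂ) • w = 0 := by
    apply h.inj <;> simp only [eval_linear_add, eval_linear_smul, h.hx, h.hy, h.hz, *] <;> ring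
  have : v - w = 0 := by rw [← key]; simp [sub_eq_add_neg]
  exact sub_eq_zero.mp this

theorem exists_vec (h : IsFrame x y z) (a b c : ℂ) :
    ∃ v : Fin 3 → ℂ, eval v x = a ∧ eval v y = b ∧ eval v z = c := by
  let L : (Fin 3 → ℂ) →ₗ[ℂ] (Fin 3 → ℂ) :=
    { toFun := fun v => ![eval v x, eval v y, eval v z]
      map_add' := by
        intro v w
        ext i
        fin_cases i <;> simp [eval_linear_add, h.hx, h.hy, h.hz]
      map_smul' := by
        intro r v
        ext i
        fin_cases i <;> simp [eval_linear_smul, h.hx, h.hy, h.hz] }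
  have hinj : Function.Injective L := by
    intro v w hvw
    have e0 := congrFun hvw 0
    have e1 := congrFun hvw 1
    have e2 := congrFun hvw 2
    exact h.ext_vec (by simpa [L] using e0) (by simpa [L] using e1) (by simpa [L] using e2)
  obtain ⟨v, hv⟩ := (LinearMap.injective_iff_surjective.mp hinj) ![a, b, c]
  exact ⟨v, by simpa [L] using congrFun hv 0, by simpa [L] using congrFun hv 1,
    by simpa [L] using congrFun hv 2⟩

/-- The vector with given coordinates in a frame. -/
def vec (h : IsFrame x y z) (a b c : ℂ) : Fin 3 → ℂ := (h.exists_vec a b c).choose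

@[simp] theorem eval_vec_fst (h : IsFrame x y z) (a b c : ℂ) : eval (h.vec a b c) x = a :=
  (h.exists_vec a b c).choose_spec.1
@[simp] theorem eval_vec_snd (h : IsFrame x y z) (a b c : ℂ) : eval (h.vec a b c) y = b :=
  (h.exists_vec a b c).choose_spec.2.1
@[simp] theorem eval_vec_trd (h : IsFrame x y z) (a b c : ℂ) : eval (h.vec a b c) z = c :=
  (h.exists_vec a b c).choose_spec.2.2

theorem X_eq (h : IsFrame x y z) (i : Fin 3) :
    (X i : Form) = C (h.vec 1 0 0 i) * x + C (h.vec 0 1 0 i) * y + C (h.vec 0 0 1 i) * z := by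
  apply MvPolynomial.funext
  intro v
  have hv : v = (eval v x) • h.vec 1 0 0 + (eval v y) • h.vec 0 1 0 + (eval v z) • h.vec 0 0 1 := by
    apply h.ext_vec <;> simp [eval_linear_add, eval_linear_smul, h.hx, h.hy, h.hz]
  have := congrFun hv i
  simp only [Pi.add_apply, Pi.smul_apply, smul_eq_mul] at this
  simp only [eval_X, map_add, map_mul, eval_C]
  rw [this]; ring

/-- Expansion of a form in the coordinates of a frame. -/
theorem exists_expand (h : IsFrame x y z) {n : ℕ} {F : Form} (hF : F.IsHomogeneous n) :
    ∃ a : ℕ → ℕ → ℂ, F = ∑ k ∈ Finset.range (n + 1), ∑ j ∈ Finset.range (k + 1),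
      C (a (k - j) j) * x ^ (n - k) * y ^ (k - j) * z ^ j := by
  set G : Form := aeval (fun i => C (h.vec 1 0 0 i) * X 0 + C (h.vec 0 1 0 i) * X 1 +
    C (h.vec 0 0 1 i) * X 2) F with hG
  have hGh : G.IsHomogeneous n := by
    have := hF.aeval (fun i => (C (h.vec 1 0 0 i) * X 0 + C (h.vec 0 1 0 i) * X 1 +
      C (h.vec 0 0 1 i) * X 2 : Form)) (n := 1) (fun i => by
        refine IsHomogeneous.add (IsHomogeneous.add ?_ ?_) ?_ <;>
        · rw [← zero_add 1]
          exact (isHomogeneous_C _ _).mul (isHomogeneous_X _ _))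
    rwa [one_mul] at this
  have hFG : F = aeval ![x, y, z] G := by
    rw [hG, ← AlgHom.comp_apply]
    have : (aeval ![x, y, z] : Form →ₐ[ℂ] Form).comp (aeval (fun i => C (h.vec 1 0 0 i) * X 0 +
        C (h.vec 0 1 0 i) * X 1 + C (h.vec 0 0 1 i) * X 2)) = AlgHom.id ℂ Form := by
      apply MvPolynomial.algHom_ext
      intro i
      conv_rhs => rw [AlgHom.id_apply, h.X_eq i]
      simp [MvPolynomial.algebraMap_eq]
    rw [this]; rfl
  rw [hFG, ← G.support_sum_monomial_coeff, map_sum]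
  refine Finset.sum_induction _ (fun f => ∃ a : ℕ → ℕ → ℂ, f = ∑ k ∈ Finset.range (n + 1),
    ∑ j ∈ Finset.range (k + 1), C (a (k - j) j) * x ^ (n - k) * y ^ (k - j) * z ^ j) ?_ ?_ ?_
  · rintro _ _ ⟨a, rfl⟩ ⟨b, rfl⟩
    refine ⟨fun i j => a i j + b i j, ?_⟩
    simp only [C_add, add_mul, Finset.sum_add_distrib]
  · exact ⟨fun _ _ => 0, by simp⟩
  · intro m hm
    have hd := sum_eq_of_mem_support hGh hm
    refine ⟨fun i j => if i = m 1 ∧ j = m 2 then coeff m G else 0, ?_⟩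
    rw [Finset.sum_eq_single (m 1 + m 2), Finset.sum_eq_single (m 2)]
    · have : n - (m 1 + m 2) = m 0 := by omega
      rw [aeval_monomial, Finsupp.prod_fintype _ _ (by simp)]
      simp [Fin.prod_univ_three, MvPolynomial.algebraMap_eq, this]
      ring
    · intro j _ hj
      simp [hj]
    · intro h; exact absurd (Finset.mem_range.mpr (by omega)) h
    · intro k _ hk
      apply Finset.sum_eq_zero
      intro j hj
      rw [Finset.mem_range] at hj
      have : ¬ (k - j = m 1 ∧ j = m 2) := by omega
      simp [this]
    · intro h; exact absurd (Finset.mem_range.mpr (by omega)) h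

end IsFrame

theorem exists_frame_of_linearIndependent {p u v : Fin 3 → ℂ}
    (h : LinearIndependent ℂ ![p, u, v]) : ∃ x y z : Form, IsFrame x y z ∧
      (eval p x = 1 ∧ eval p y = 0 ∧ eval p z = 0) ∧ (eval u x = 0 ∧ eval u y = 1 ∧ eval u z = 0) ∧
      (eval v x = 0 ∧ eval v y = 0 ∧ eval v z = 1) := by
  let B : Module.Basis (Fin 3) ℂ (Fin 3 → ℂ) := basisOfLinearIndependentOfCardEqFinrank h (by simp)
  have hB : ∀ i, B i = ![p, u, v] i := fun i => by
    simp [B, coe_basisOfLinearIndependentOfCardEqFinrank]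
  let f : Fin 3 → Form := fun i => ∑ j, C (B.repr (Pi.single j 1) i) * X j
  have hf : ∀ i w, eval w (f i) = B.repr w i := by
    intro i w
    have hw : w = ∑ j, w j • (Pi.single j 1 : Fin 3 → ℂ) := by
      ext k; simp [Pi.single_apply]
    conv_rhs => rw [hw]
    simp only [map_sum, map_smul, f, map_mul, eval_C, eval_X]
    simp [mul_comm]
  have hh : ∀ i, (f i).IsHomogeneous 1 := by
    intro i
    refine IsHomogeneous.sum _ _ _ fun j _ => ?_
    rw [← zero_add 1]
    exact (isHomogeneous_C _ _).mul (isHomogeneous_X _ _)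
  have e : ∀ i j, eval (![p, u, v] i) (f j) = if i = j then 1 else 0 := by
    intro i j
    rw [hf, ← hB, B.repr_self, Finsupp.single_apply]
  refine ⟨f 0, f 1, f 2, ⟨hh 0, hh 1, hh 2, ?_⟩, ⟨?_, ?_, ?_⟩, ⟨?_, ?_, ?_⟩, ?_, ?_, ?_⟩
  · intro w h0 h1 h2
    rw [hf] at h0 h1 h2
    apply B.repr.map_eq_zero_iff.mp
    ext i; fin_cases i <;> simpa
  · simpa using e 0 0
  · simpa using e 0 1
  · simpa using e 0 2
  · simpa using e 1 0
  · simpa using e 1 1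
  · simpa using e 1 2
  · simpa using e 2 0
  · simpa using e 2 1
  · simpa using e 2 2

/-! ### Restriction to a line -/

theorem restrictLine_mul (F G : Form) (p v : Fin 3 → ℂ) :
    restrictLine (F * G) p v = restrictLine F p v * restrictLine G p v := map_mul _ _ _
theorem restrictLine_add (F G : Form) (p v : Fin 3 → ℂ) :
    restrictLine (F + G) p v = restrictLine F p v + restrictLine G p v := map_add _ _ _
theorem restrictLine_pow (F : Form) (n : ℕ) (p v : Fin 3 → ℂ) :
    restrictLine (F ^ n) p v = restrictLine F p v ^ n := map_pow _ _ _
theorem restrictLine_C (a : ℂ) (p v : Fin 3 → ℂ) :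
    restrictLine (C a) p v = Polynomial.C a := aeval_C _ _

theorem restrictLine_linear {l : Form} (hl : l.IsHomogeneous 1) (p v : Fin 3 → ℂ) :
    restrictLine l p v =
      Polynomial.C (eval p l) + Polynomial.C (eval v l) * Polynomial.X := by
  unfold restrictLine
  rw [aeval_linear hl, eval_linear hl, eval_linear hl]
  simp only [Fin.sum_univ_three, map_add, map_mul, Polynomial.algebraMap_eq]
  ring

theorem eval_restrictLine (F : Form) (p v : Fin 3 → ℂ) (t : ℂ) :
    (restrictLine F p v).eval t = eval (p + t • v) F := by
  unfold restrictLine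
  induction F using MvPolynomial.induction_on with
  | C a => simp
  | add f g hf hg => simp [hf, hg]
  | mul_X f i hf => 
    rw [map_mul, Polynomial.eval_mul, hf, map_mul, aeval_X, eval_X]
    simp only [Polynomial.eval_add, Polynomial.eval_mul, Polynomial.eval_C, Polynomial.eval_X,
      Pi.add_apply, Pi.smul_apply, smul_eq_mul]
    ring

/-- Homogeneity gives F(p + t(ap + bv)) = (1 + at)ⁿ F(p + (bt/(1 + at))v), so passing to another
direction on the same line is the substitution of a power series divisible by t, up to a unit. This
cannot lower the order at t = 0. -/
theorem X_pow_dvd_restrictLine {n m : ℕ} {F : Form} (hF : F.IsHomogeneous n) {p v : Fin 3 → ℂ}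
    (h : (Polynomial.X : Polynomial ℂ) ^ m ∣ restrictLine F p v) (a b : ℂ) :
    (Polynomial.X : Polynomial ℂ) ^ m ∣ restrictLine F p (a • p + b • v) := by
  let W : PowerSeries ℂ := 1 + PowerSeries.C a * PowerSeries.X
  have hW : W * W⁻¹ = 1 := PowerSeries.mul_inv_cancel _ (by simp [W])
  let θ : PowerSeries ℂ := PowerSeries.C b * PowerSeries.X * W⁻¹
  have key : ((restrictLine F p (a • p + b • v) : Polynomial ℂ) : PowerSeries ℂ) =
      W ^ n * Polynomial.aeval θ (restrictLine F p v) := by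
    have h1 : ((restrictLine F p (a • p + b • v) : Polynomial ℂ) : PowerSeries ℂ) =
        aeval (fun i => W * (PowerSeries.C (p i) + PowerSeries.C (v i) * θ)) F := by
      rw [show ((restrictLine F p (a • p + b • v) : Polynomial ℂ) : PowerSeries ℂ) =
        Polynomial.coeToPowerSeries.algHom (R := ℂ) ℂ (restrictLine F p (a • p + b • v)) by
          simp [Polynomial.coeToPowerSeries.algHom_apply]]
      unfold restrictLine
      rw [← AlgHom.comp_apply]
      congr 1
      apply MvPolynomial.algHom_ext
      intro i
      simp only [AlgHom.comp_apply, aeval_X, Polynomial.coeToPowerSeries.algHom_apply]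
      simp [W, θ]
      linear_combination -(PowerSeries.C b * PowerSeries.X * PowerSeries.C (v i)) * hW
    have h2 : Polynomial.aeval θ (restrictLine F p v) =
        aeval (fun i => PowerSeries.C (p i) + PowerSeries.C (v i) * θ) F := by
      unfold restrictLine
      rw [← AlgHom.comp_apply]
      congr 1
      apply MvPolynomial.algHom_ext
      intro i
      simp [PowerSeries.algebraMap_eq]
    rw [h1, h2]
    exact aeval_mul_left hF W _
  obtain ⟨r, hr⟩ := h
  have hd : (PowerSeries.X : PowerSeries ℂ) ^ m ∣
      ((restrictLine F p (a • p + b • v) : Polynomial ℂ) : PowerSeries ℂ) := by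
    rw [key, hr]
    simp only [map_mul, map_pow, Polynomial.aeval_X]
    refine Dvd.dvd.mul_left (Dvd.dvd.mul_right ?_ _) _
    exact pow_dvd_pow_of_dvd ⟨PowerSeries.C b * W⁻¹, by simp only [θ]; ring⟩ m
  rw [Polynomial.X_pow_dvd_iff]
  rw [PowerSeries.X_pow_dvd_iff] at hd
  intro d hdm
  simpa using hd d hdm

/-- The infimum in `lineMult` is attained at any direction that spans the line together with the
point, because every other direction has at least that order. -/
theorem lineMult_eq {n : ℕ} {F l : Form} (hF : F.IsHomogeneous n) {P : P2} {v : Fin 3 → ℂ}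
    (hv : eval v l = 0)
    (hspan : ∀ w, eval w l = 0 → ∃ a b : ℂ, w = a • P.rep + b • v) :
    lineMult F l P = emultiplicity (Polynomial.X : Polynomial ℂ) (restrictLine F P.rep v) := by
  apply le_antisymm
  · exact iInf_le (fun w : {v : Fin 3 → ℂ // eval v l = 0} =>
      emultiplicity (Polynomial.X : Polynomial ℂ) (restrictLine F P.rep w)) ⟨v, hv⟩
  · apply le_iInf
    rintro ⟨w, hw⟩
    obtain ⟨a, b, rfl⟩ := hspan w hw
    exact emultiplicity_le_emultiplicity_iff.mpr fun m hm => X_pow_dvd_restrictLine hF hm a b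

/-! ### Formal power series in two variables -/

/-- The ring of formal germs in two variables. -/
abbrev Germ : Type := MvPowerSeries (Fin 2) ℂ

/-- The maximal ideal of the ring of germs. -/
abbrev germIdeal : Ideal Germ := IsLocalRing.maximalIdeal Germ

/-- The coefficient of `x ^ i * y ^ j`. -/
def cf (i j : ℕ) : Germ →ₗ[ℂ] ℂ :=
  MvPowerSeries.coeff (Finsupp.single 0 i + Finsupp.single 1 j)

theorem cf_eq_coeff (m : Fin 2 →₀ ℕ) (f : Germ) : MvPowerSeries.coeff m f = cf (m 0) (m 1) f := by
  unfold cf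
  congr 2
  ext i; fin_cases i <;> simp

theorem cf_mul (i j : ℕ) (f g : Germ) : cf i j (f * g) =
    ∑ p ∈ Finset.HasAntidiagonal.antidiagonal i, ∑ q ∈ Finset.HasAntidiagonal.antidiagonal j,
      cf p.1 q.1 f * cf p.2 q.2 g := by
  classical
  conv_lhs => unfold cf
  rw [MvPowerSeries.coeff_mul, ← Finset.sum_product']
  refine Finset.sum_bij' (fun p _ => ((p.1 0, p.2 0), (p.1 1, p.2 1)))
    (fun p _ => (Finsupp.single 0 p.1.1 + Finsupp.single 1 p.2.1,
      Finsupp.single 0 p.1.2 + Finsupp.single 1 p.2.2)) ?_ ?_ ?_ ?_ ?_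
  · intro p hp
    rw [Finset.HasAntidiagonal.mem_antidiagonal] at hp
    have h0 := DFunLike.congr_fun hp 0
    have h1 := DFunLike.congr_fun hp 1
    simp at h0 h1
    simp [h0, h1]
  · intro p hp
    simp only [Finset.mem_product, Finset.HasAntidiagonal.mem_antidiagonal] at hp
    rw [Finset.HasAntidiagonal.mem_antidiagonal]
    ext k; fin_cases k <;> simp [hp.1, hp.2]
  · intro p _
    ext k <;> fin_cases k <;> simp
  · intro p _
    simp
  · intro p _
    rw [cf_eq_coeff, cf_eq_coeff]

theorem cf_X0_pow (i j a : ℕ) : cf i j (MvPowerSeries.X 0 ^ a) = if i = a ∧ j = 0 then 1 else 0 := by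
  classical
  unfold cf
  rw [MvPowerSeries.coeff_X_pow]
  congr 1
  rw [eq_iff_iff, Finsupp.ext_iff, Fin.forall_fin_two]
  simp

theorem cf_X1_pow (i j a : ℕ) : cf i j (MvPowerSeries.X 1 ^ a) = if i = 0 ∧ j = a then 1 else 0 := by
  classical
  unfold cf
  rw [MvPowerSeries.coeff_X_pow]
  congr 1
  rw [eq_iff_iff, Finsupp.ext_iff, Fin.forall_fin_two]
  simp

theorem cf_X0 (i j : ℕ) : cf i j (MvPowerSeries.X 0) = if i = 1 ∧ j = 0 then 1 else 0 := by
  simpa using cf_X0_pow i j 1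

theorem cf_X1 (i j : ℕ) : cf i j (MvPowerSeries.X 1) = if i = 0 ∧ j = 1 then 1 else 0 := by
  simpa using cf_X1_pow i j 1

theorem cf_C (i j : ℕ) (a : ℂ) : cf i j (MvPowerSeries.C a) = if i = 0 ∧ j = 0 then a else 0 := by
  classical
  unfold cf
  rw [MvPowerSeries.coeff_C]
  congr 1
  rw [eq_iff_iff, Finsupp.ext_iff, Fin.forall_fin_two]
  simp

theorem cf_C_mul (i j : ℕ) (a : ℂ) (f : Germ) : cf i j (MvPowerSeries.C a * f) = a * cf i j f := by
  unfold cf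
  rw [MvPowerSeries.coeff_C_mul]

theorem cf_zero_zero (f : Germ) : cf 0 0 f = MvPowerSeries.constantCoeff f := by
  simp [cf]

theorem mem_germIdeal_iff {f : Germ} : f ∈ germIdeal ↔ cf 0 0 f = 0 := by
  rw [IsLocalRing.mem_maximalIdeal, mem_nonunits_iff, MvPowerSeries.isUnit_iff_constantCoeff,
    cf_zero_zero, isUnit_iff_ne_zero, not_not]

theorem isUnit_iff_cf {f : Germ} : IsUnit f ↔ cf 0 0 f ≠ 0 := by
  rw [MvPowerSeries.isUnit_iff_constantCoeff, cf_zero_zero, isUnit_iff_ne_zero]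

/-- Order is additive on products, and elements of the maximal ideal have order at least 1. This
inclusion makes coefficients of total degree below k well defined modulo the k-th power. -/
theorem le_order_of_mem_pow {k : ℕ} : ∀ {f : Germ}, f ∈ germIdeal ^ k → (k : ℕ∞) ≤ f.order := by
  induction k with
  | zero => intro f _; simp
  | succ k ih =>
    intro f hf
    rw [pow_succ] at hf
    refine Submodule.mul_induction_on hf ?_ ?_
    · intro a ha b hb
      rw [MvPowerSeries.order_mul]
      push_cast
      refine add_le_add (ih ha) ?_
      apply MvPowerSeries.le_order
      intro d hd
      have : d = 0 := by
        have : d.degree < 1 := by exact_mod_cast hd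
        exact (Finsupp.degree_eq_zero_iff d).mp (by omega)
      subst this
      rw [mem_germIdeal_iff, cf_zero_zero] at hb
      simpa using hb
    · intro a b ha hb
      exact le_trans (le_min ha hb) MvPowerSeries.min_order_le_add

theorem cf_eq_zero_of_mem_pow {k : ℕ} {f : Germ} (hf : f ∈ germIdeal ^ k) {i j : ℕ}
    (h : i + j < k) : cf i j f = 0 := by
  apply MvPowerSeries.coeff_of_lt_order
  refine lt_of_lt_of_le ?_ (le_order_of_mem_pow hf)
  simpa using (by exact_mod_cast h : ((i + j : ℕ) : ℕ∞) < k)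

theorem cf_eq_of_sub_mem_pow {k : ℕ} {f g : Germ} (hf : f - g ∈ germIdeal ^ k) {i j : ℕ}
    (h : i + j < k) : cf i j f = cf i j g := by
  have := cf_eq_zero_of_mem_pow hf h
  rwa [map_sub, sub_eq_zero] at this

theorem map_mem_pow {θ : Germ →+* Germ} (hθ : ∀ f ∈ germIdeal, θ f ∈ germIdeal) {k : ℕ} {f : Germ}
    (hf : f ∈ germIdeal ^ k) : θ f ∈ germIdeal ^ k := by
  have h1 : θ f ∈ (germIdeal ^ k).map θ := Ideal.mem_map_of_mem _ hf
  rw [Ideal.map_pow] at h1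
  exact Ideal.pow_right_mono (Ideal.map_le_iff_le_comap.mpr hθ) k h1

theorem equiv_mem {φ : Germ ≃ₐ[ℂ] Germ} {f : Germ} (hf : f ∈ germIdeal) : φ f ∈ germIdeal := by
  rw [IsLocalRing.mem_maximalIdeal, mem_nonunits_iff] at hf ⊢
  rwa [MulEquiv.isUnit_map φ]

theorem equiv_mem_pow (φ : Germ ≃ₐ[ℂ] Germ) {k : ℕ} {f : Germ} :
    φ f ∈ germIdeal ^ k ↔ f ∈ germIdeal ^ k := by
  constructor
  · intro h
    have := map_mem_pow (θ := (φ.symm : Germ ≃+* Germ).toRingHom)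
      (fun f hf => equiv_mem (φ := φ.symm) hf) h
    simpa using this
  · intro h
    exact map_mem_pow (θ := (φ : Germ ≃+* Germ).toRingHom) (fun f hf => equiv_mem (φ := φ) hf) h

theorem unit_mul_mem_pow {k : ℕ} {w f : Germ} (hw : IsUnit w) :
    w * f ∈ germIdeal ^ k ↔ f ∈ germIdeal ^ k := Ideal.unit_mul_mem_iff_mem _ hw

/-- A unit is a square modulo every power of the maximal ideal. -/
theorem exists_sqrt_unit {w : Germ} (hw : IsUnit w) (k : ℕ) :
    ∃ r : Germ, IsUnit r ∧ w - r ^ 2 ∈ germIdeal ^ (k + 1) := by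
  induction k with
  | zero =>
    obtain ⟨a, ha⟩ := IsAlgClosed.exists_pow_nat_eq (cf 0 0 w) (n := 2) (by norm_num)
    have hw' := isUnit_iff_cf.mp hw
    refine ⟨MvPowerSeries.C a, ?_, ?_⟩
    · rw [isUnit_iff_cf, cf_C]
      simp only [and_self, if_true]
      rintro rfl
      apply hw'; rw [← ha]; simp
    · rw [zero_add, pow_one, mem_germIdeal_iff, map_sub, ← map_pow, cf_C]
      simp [ha]
  | succ k ih =>
    obtain ⟨r, hr, h⟩ := ih
    obtain ⟨r', hr'⟩ := hr.exists_right_inv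
    -- Newton step: with d = (w - r²)/(2r) the new error w - (r + d)² is -d², whose order is at
    -- least double.
    set d := MvPowerSeries.C (2⁻¹ : ℂ) * r' * (w - r ^ 2) with hd
    have h2 : (2 : Germ) * MvPowerSeries.C (2⁻¹ : ℂ) = 1 := by
      rw [show (2 : Germ) = MvPowerSeries.C (2 : ℂ) from (map_ofNat _ 2).symm, ← map_mul]
      norm_num
    have hdm : d ∈ germIdeal ^ (k + 1) := Ideal.mul_mem_left _ _ h
    refine ⟨r + d, ?_, ?_⟩
    · rw [isUnit_iff_cf, map_add,
        mem_germIdeal_iff.mp (Ideal.pow_le_self (by omega) hdm), add_zero]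
      exact isUnit_iff_cf.mp hr
    · have : w - (r + d) ^ 2 = -(d * d) := by
        have e : 2 * r * d = w - r ^ 2 := by
          rw [hd]
          linear_combination (r * r' * (w - r ^ 2)) * h2 + (w - r ^ 2) * hr'
        linear_combination -e
      rw [this]
      refine neg_mem ?_
      have := Ideal.mul_mem_mul hdm hdm
      rw [← pow_add] at this
      exact Ideal.pow_le_pow_right (by omega) this

/-- `f` is a square modulo the `k`-th power of the maximal ideal. -/
def SquareMod (k : ℕ) (f : Germ) : Prop := ∃ h : Germ, f - h ^ 2 ∈ germIdeal ^ k

theorem SquareMod.unit_mul {k : ℕ} {w f : Germ} (hw : IsUnit w) (hf : SquareMod k f) :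
    SquareMod k (w * f) := by
  obtain ⟨h, hh⟩ := hf
  obtain ⟨r, -, hr⟩ := exists_sqrt_unit hw k
  refine ⟨r * h, ?_⟩
  have : w * f - (r * h) ^ 2 = w * (f - h ^ 2) + h ^ 2 * (w - r ^ 2) := by ring
  rw [this]
  exact add_mem (Ideal.mul_mem_left _ _ hh)
    (Ideal.mul_mem_left _ _ (Ideal.pow_le_pow_right (by omega) hr))

theorem squareMod_unit_mul_iff {k : ℕ} {w f : Germ} (hw : IsUnit w) :
    SquareMod k (w * f) ↔ SquareMod k f := by
  refine ⟨fun h => ?_, fun h => h.unit_mul hw⟩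
  obtain ⟨w', hw'⟩ := hw.exists_left_inv
  have := h.unit_mul (w := w') (IsUnit.of_mul_eq_one _ hw')
  rwa [← mul_assoc, hw', one_mul] at this

theorem SquareMod.map {θ : Germ →+* Germ} (hθ : ∀ f ∈ germIdeal, θ f ∈ germIdeal) {k : ℕ} {f : Germ}
    (hf : SquareMod k f) : SquareMod k (θ f) := by
  obtain ⟨h, hh⟩ := hf
  exact ⟨θ h, by simpa using map_mem_pow hθ hh⟩

/-- Together with `squareMod_unit_mul_iff` this makes "square modulo the k-th power" an invariant of
the germ under formal coordinate changes and units; it serves to recognize Aₙ. -/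
theorem squareMod_equiv_iff (φ : Germ ≃ₐ[ℂ] Germ) {k : ℕ} {f : Germ} :
    SquareMod k (φ f) ↔ SquareMod k f := by
  constructor
  · intro h
    have := h.map (θ := (φ.symm : Germ ≃+* Germ).toRingHom)
      (fun f hf => equiv_mem (φ := φ.symm) hf)
    simpa using this
  · intro h
    exact h.map (θ := (φ : Germ ≃+* Germ).toRingHom) (fun f hf => equiv_mem (φ := φ) hf)

/-- `A (g + b) ^ 2` up to a unit: completing the square. -/
theorem squareMod_of_completed {k : ℕ} {x y A : Germ} (hA : IsUnit A)
    (hy : y ^ 2 ∈ germIdeal ^ k) : SquareMod k (x ^ 2 * A + x * y) := by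
  obtain ⟨A', hA'⟩ := hA.exists_left_inv
  have h2 : (2 : Germ) * MvPowerSeries.C (2⁻¹ : ℂ) = 1 := by
    rw [show (2 : Germ) = MvPowerSeries.C (2 : ℂ) from (map_ofNat _ 2).symm, ← map_mul]
    norm_num
  have : SquareMod k (A * (A' * (x ^ 2 * A + x * y))) := by
    refine SquareMod.unit_mul hA ⟨x + MvPowerSeries.C (2⁻¹ : ℂ) * A' * y, ?_⟩
    have e : A' * (x ^ 2 * A + x * y) - (x + MvPowerSeries.C (2⁻¹ : ℂ) * A' * y) ^ 2 =
        -(MvPowerSeries.C (2⁻¹ : ℂ) * A') ^ 2 * y ^ 2 := by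
      linear_combination x ^ 2 * hA' - A' * x * y * h2
    rw [e]
    exact Ideal.mul_mem_left _ _ hy
  rwa [← mul_assoc, mul_comm A, hA', one_mul] at this

theorem cf_zero_mul (j : ℕ) (f g : Germ) : cf 0 j (f * g) =
    ∑ q ∈ Finset.HasAntidiagonal.antidiagonal j, cf 0 q.1 f * cf 0 q.2 g := by
  rw [cf_mul]; simp

theorem cf_one_mul (j : ℕ) (f g : Germ) : cf 1 j (f * g) =
    ∑ q ∈ Finset.HasAntidiagonal.antidiagonal j, (cf 0 q.1 f * cf 1 q.2 g + cf 1 q.1 f * cf 0 q.2 g) := by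
  rw [cf_mul, Finset.Nat.antidiagonal_succ]; simp [Finset.sum_add_distrib]

/-- If h² agreed with x² + yⁿ⁺¹ below degree n + 2, then h would have no constant term and a nonzero
x-coefficient h₁₀. The coefficient of x·yʲ in h² then forces h₀ⱼ = 0 successively for all j ≤ n, and
the coefficient of yⁿ⁺¹ in h² would vanish. -/
theorem not_squareMod_A (n : ℕ) (hn : 1 ≤ n) :
    ¬ SquareMod (n + 2) (SingType.A n).normalForm := by
  rintro ⟨h, hh⟩
  simp only [SingType.normalForm] at hh
  have key : ∀ i j, i + j < n + 2 →
      cf i j (h * h) = (if i = 2 ∧ j = 0 then 1 else 0) + (if i = 0 ∧ j = n + 1 then 1 else 0) := by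
    intro i j hij
    rw [← pow_two, ← cf_eq_of_sub_mem_pow hh hij, map_add, cf_X0_pow, cf_X1_pow]
  have h00 : cf 0 0 h = 0 := by
    have := key 0 0 (by omega)
    rw [cf_zero_mul] at this
    simpa using this
  have h10 : cf 1 0 h ≠ 0 := by
    intro h1
    have := key 2 0 (by omega)
    rw [cf_mul] at this
    simp [Finset.Nat.antidiagonal_succ, h00, h1] at this
  have hz : ∀ j, j ≤ n → cf 0 j h = 0 := by
    intro j
    induction j using Nat.strong_induction_on with
    | _ j ih =>
      intro hj
      have := key 1 j (by omega)
      rw [cf_one_mul] at this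
      simp only [OfNat.one_ne_ofNat, false_and, if_false, one_ne_zero, add_zero] at this
      rw [Finset.sum_add_distrib, Finset.sum_eq_single (j, 0), Finset.sum_eq_single (0, j)] at this
      · have h2 : cf 0 j h * cf 1 0 h = 0 := by linear_combination this / 2
        exact (mul_eq_zero.mp h2).resolve_right h10
      · rintro ⟨a, b⟩ hab hne
        rw [Finset.HasAntidiagonal.mem_antidiagonal] at hab
        simp only at hab
        have : b < j := by
          rcases Nat.lt_or_ge b j with h | h
          · exact h
          · exact absurd (Prod.ext (by simp; omega) (by simp; omega)) hne
        simp [ih b this (by omega)]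
      · intro h; exact absurd (Finset.HasAntidiagonal.mem_antidiagonal.mpr (by simp)) h
      · rintro ⟨a, b⟩ hab hne
        rw [Finset.HasAntidiagonal.mem_antidiagonal] at hab
        simp only at hab
        have : a < j := by
          rcases Nat.lt_or_ge a j with h | h
          · exact h
          · exact absurd (Prod.ext (by simp; omega) (by simp; omega)) hne
        simp [ih a this (by omega)]
      · intro h; exact absurd (Finset.HasAntidiagonal.mem_antidiagonal.mpr (by simp)) h
  have := key 0 (n + 1) (by omega)
  rw [cf_zero_mul, Finset.sum_eq_zero] at this
  · simp at this
  · rintro ⟨a, b⟩ hab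
    rw [Finset.HasAntidiagonal.mem_antidiagonal] at hab
    simp only at hab
    rcases Nat.lt_or_ge n a with h | h
    · have : b = 0 := by omega
      simp [this, h00]
    · simp [hz a h]

theorem squareMod_A (n : ℕ) : SquareMod (n + 1) (SingType.A n).normalForm := by
  refine ⟨MvPowerSeries.X 0, ?_⟩
  simp only [SingType.normalForm, add_sub_cancel_left]
  refine Ideal.pow_mem_pow ?_ _
  rw [mem_germIdeal_iff, cf_X1]; simp

theorem A_not_mem_cube (n : ℕ) : (SingType.A n).normalForm ∉ germIdeal ^ 3 := by
  intro h
  have := cf_eq_zero_of_mem_pow h (i := 2) (j := 0) (by omega)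
  simp [SingType.normalForm, cf_X0_pow, cf_X1_pow] at this

theorem E6_not_mem_pow_four : SingType.E6.normalForm ∉ germIdeal ^ 4 := by
  intro h
  have := cf_eq_zero_of_mem_pow h (i := 3) (j := 0) (by omega)
  simp [SingType.normalForm, cf_X0_pow, cf_X1_pow] at this

/-- The cusp is unibranch. -/
theorem A2_ne_mul {f g : Germ} (hf : f ∈ germIdeal) (hg : g ∈ germIdeal) :
    (SingType.A 2).normalForm ≠ f * g := by
  intro h
  rw [mem_germIdeal_iff] at hf hg
  have key : ∀ i j, cf i j (f * g) =
      (if i = 2 ∧ j = 0 then 1 else 0) + (if i = 0 ∧ j = 3 then 1 else 0) := by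
    intro i j
    rw [← h]
    simp [SingType.normalForm, cf_X0_pow, cf_X1_pow]
  have e1 := key 2 0
  have e2 := key 1 1
  have e3 := key 0 2
  have e4 := key 0 3
  rw [cf_mul] at e1 e2 e3 e4
  simp [Finset.Nat.antidiagonal_succ, hf, hg] at e1 e2 e3 e4
  rcases e3 with e3 | e3
  · have : cf 1 0 f ≠ 0 := by rintro h; simp [h] at e1
    simp [e3, this] at e2
    simp [e2, e3] at e4
  · have : cf 1 0 g ≠ 0 := by rintro h; simp [h] at e1
    simp [e3, this] at e2
    simp [e2, e3] at e4

/-- No smooth germ divides the germ `E₆`. -/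
theorem E6_ne_mul {f g : Germ} (hf : f ∈ germIdeal) (hf2 : cf 1 0 f ≠ 0 ∨ cf 0 1 f ≠ 0) :
    SingType.E6.normalForm ≠ f * g := by
  intro h
  rw [mem_germIdeal_iff] at hf
  have key : ∀ i j, cf i j (f * g) =
      (if i = 3 ∧ j = 0 then 1 else 0) + (if i = 0 ∧ j = 4 then 1 else 0) := by
    intro i j
    rw [← h]
    simp [SingType.normalForm, cf_X0_pow, cf_X1_pow]
  have a1 := key 1 0
  have a2 := key 0 1
  have b1 := key 2 0
  have b2 := key 1 1
  have b3 := key 0 2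
  have c1 := key 3 0
  have c2 := key 2 1
  have c3 := key 1 2
  have c4 := key 0 3
  have d := key 0 4
  rw [cf_mul] at a1 a2 b1 b2 b3 c1 c2 c3 c4 d
  simp [Finset.Nat.antidiagonal_succ, hf] at a1 a2 b1 b2 b3 c1 c2 c3 c4 d
  have g0 : cf 0 0 g = 0 := by
    rcases hf2 with h | h
    · exact a1.resolve_left h
    · exact a2.resolve_left h
  simp [g0] at b1 b2 b3 c1 c2 c3 c4 d
  have g1 : cf 1 0 g = 0 ∧ cf 0 1 g = 0 := by
    rcases hf2 with h | h
    · have := b1.resolve_left h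
      simp [this] at b2
      exact ⟨this, b2.resolve_left h⟩
    · have := b3.resolve_left h
      simp [this] at b2
      exact ⟨b2.resolve_left h, this⟩
  simp [g1] at c1 c2 c3 c4 d
  have f10 : cf 1 0 f ≠ 0 := by rintro h; simp [h] at c1
  rcases c4 with c4 | c4
  · simp [c4, f10] at c3
    simp [c3, c4] at d
  · simp [c4] at c3
    rcases c3 with c3 | c3
    · simp [c3, c4] at d
    · simp [c3] at c2
      rcases c2 with c2 | c2
      · simp [c2, c4] at d
      · simp [c2] at c1

/-! ### Local equations -/

theorem localEq_mul (F G : Form) (p u v : Fin 3 → ℂ) :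
    localEq (F * G) p u v = localEq F p u v * localEq G p u v := by simp [localEq]
theorem localEq_add (F G : Form) (p u v : Fin 3 → ℂ) :
    localEq (F + G) p u v = localEq F p u v + localEq G p u v := by simp [localEq]
theorem localEq_pow (F : Form) (n : ℕ) (p u v : Fin 3 → ℂ) :
    localEq (F ^ n) p u v = localEq F p u v ^ n := by simp [localEq]
theorem localEq_C (a : ℂ) (p u v : Fin 3 → ℂ) :
    localEq (C a) p u v = MvPowerSeries.C a := by simp [localEq, MvPolynomial.algebraMap_eq]

theorem localEq_linear {l : Form} (hl : l.IsHomogeneous 1) (p u v : Fin 3 → ℂ) :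
    localEq l p u v = MvPowerSeries.C (eval p l) + MvPowerSeries.C (eval u l) * MvPowerSeries.X 0 +
      MvPowerSeries.C (eval v l) * MvPowerSeries.X 1 := by
  unfold localEq
  rw [aeval_linear hl, eval_linear hl, eval_linear hl, eval_linear hl]
  simp only [Fin.sum_univ_three, map_add, map_mul, MvPolynomial.algebraMap_eq]
  simp only [MvPolynomial.coe_add, MvPolynomial.coe_mul, MvPolynomial.coe_C, MvPolynomial.coe_X]
  ring

theorem cf_zero_localEq (F : Form) (p u v : Fin 3 → ℂ) : cf 0 0 (localEq F p u v) = eval p F := by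
  induction F using MvPolynomial.induction_on with
  | C a => rw [localEq_C, cf_C, eval_C]; simp
  | add f g hf hg => rw [localEq_add, map_add, hf, hg, map_add]
  | mul_X f i hf =>
    rw [localEq_mul, cf_mul, localEq_linear (isHomogeneous_X _ _), map_mul]
    simp [hf, cf_C, cf_C_mul, cf_X0, cf_X1]

theorem localEq_mem_iff {F : Form} {p u v : Fin 3 → ℂ} :
    localEq F p u v ∈ germIdeal ↔ eval p F = 0 := by
  rw [mem_germIdeal_iff, cf_zero_localEq]

theorem isUnit_localEq_iff {F : Form} {p u v : Fin 3 → ℂ} :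
    IsUnit (localEq F p u v) ↔ eval p F ≠ 0 := by
  rw [isUnit_iff_cf, cf_zero_localEq]

theorem cf_term (i j k l : ℕ) (a : ℂ) :
    cf i j (MvPowerSeries.C a * MvPowerSeries.X 0 ^ k * MvPowerSeries.X 1 ^ l) =
      if i = k ∧ j = l then a else 0 := by
  rw [mul_assoc, cf_C_mul, cf_mul, Finset.sum_eq_single (i, 0), Finset.sum_eq_single (0, j)]
  · rw [cf_X0_pow, cf_X1_pow]
    by_cases h1 : i = k <;> by_cases h2 : j = l <;> simp [h1, h2]
  · rintro ⟨b, c⟩ h hne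
    simp only [Finset.HasAntidiagonal.mem_antidiagonal] at h
    rw [cf_X0_pow, if_neg, zero_mul]
    rintro ⟨_, h0⟩
    simp only at h0
    exact hne (Prod.ext h0 (by simp; omega))
  · simp
  · rintro ⟨b, c⟩ h hne
    simp only [Finset.HasAntidiagonal.mem_antidiagonal] at h
    apply Finset.sum_eq_zero
    intro q _
    rw [cf_X1_pow, if_neg, mul_zero]
    rintro ⟨h0, _⟩
    simp only at h0
    exact hne (Prod.ext (by simp; omega) h0)
  · simp

/-- The frame dual to an affine chart, together with the expansion of a quartic in it. -/
theorem exists_chart {p u v : Fin 3 → ℂ} (h : LinearIndependent ℂ ![p, u, v]) {F : Form}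
    (hF : F.IsHomogeneous 4) : ∃ x y z : Form, IsFrame x y z ∧
      (eval p x = 1 ∧ eval p y = 0 ∧ eval p z = 0) ∧
      (eval u x = 0 ∧ eval u y = 1 ∧ eval u z = 0) ∧
      (eval v x = 0 ∧ eval v y = 0 ∧ eval v z = 1) ∧
      ∃ a : ℕ → ℕ → ℂ, (∀ i j, a i j = cf i j (localEq F p u v)) ∧
        (∀ i j, 4 < i + j → a i j = 0) ∧ F =
      C (a 0 0) * x ^ 4 + x ^ 3 * (C (a 1 0) * y + C (a 0 1) * z) +
      x ^ 2 * (C (a 2 0) * y ^ 2 + C (a 1 1) * y * z + C (a 0 2) * z ^ 2) +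
      x * (C (a 3 0) * y ^ 3 + C (a 2 1) * y ^ 2 * z + C (a 1 2) * y * z ^ 2 + C (a 0 3) * z ^ 3) +
      (C (a 4 0) * y ^ 4 + C (a 3 1) * y ^ 3 * z + C (a 2 2) * y ^ 2 * z ^ 2 +
        C (a 1 3) * y * z ^ 3 + C (a 0 4) * z ^ 4) := by
  obtain ⟨x, y, z, hf, hp, hu, hv⟩ := exists_frame_of_linearIndependent h
  refine ⟨x, y, z, hf, hp, hu, hv, ?_⟩
  obtain ⟨b, hb⟩ := hf.exists_expand hF
  have lx : localEq x p u v = 1 := by rw [localEq_linear hf.hx]; simp [hp, hu, hv]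
  have ly : localEq y p u v = MvPowerSeries.X 0 := by rw [localEq_linear hf.hy]; simp [hp, hu, hv]
  have lz : localEq z p u v = MvPowerSeries.X 1 := by rw [localEq_linear hf.hz]; simp [hp, hu, hv]
  have key : ∀ i j, cf i j (localEq F p u v) = if i + j ≤ 4 then b i j else 0 := by
    intro i j
    have : localEq F p u v = ∑ k ∈ Finset.range 5, ∑ l ∈ Finset.range (k + 1),
        MvPowerSeries.C (b (k - l) l) * MvPowerSeries.X 0 ^ (k - l) * MvPowerSeries.X 1 ^ l := by
      conv_lhs => rw [hb]
      simp only [Finset.sum_range_succ, Finset.sum_range_zero, localEq_add, localEq_mul,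
        localEq_pow, localEq_C, lx, ly, lz, one_pow, mul_one, zero_add]
    rw [this, map_sum]
    simp only [map_sum, cf_term]
    split_ifs with hij
    · rw [Finset.sum_eq_single (i + j), Finset.sum_eq_single j]
      · simp
      · intro l hl hne; rw [if_neg]; omega
      · intro h; exact absurd (Finset.mem_range.mpr (by omega)) h
      · intro k _ hk
        apply Finset.sum_eq_zero
        intro l hl
        rw [Finset.mem_range] at hl
        rw [if_neg]; omega
      · intro h; exact absurd (Finset.mem_range.mpr (by omega)) h
    · apply Finset.sum_eq_zero
      intro k hk
      apply Finset.sum_eq_zero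
      intro l hl
      rw [Finset.mem_range] at hl hk
      rw [if_neg]; omega
  refine ⟨fun i j => cf i j (localEq F p u v), fun _ _ => rfl, ?_, ?_⟩
  · intro i j hij
    simp only [key]; rw [if_neg (by omega)]
  · simp only [key]
    refine hb.trans ?_
    simp only [Finset.sum_range_succ, Finset.sum_range_zero]
    norm_num
    ring

/-! ### Consequences of a prescribed singularity type -/

/-- The three invariants that replace the normal form. Being a square modulo the power n + 1 but not
n + 2 pins down the index, and not lying in the cube says that the multiplicity is at most 2. -/
theorem HasSingType.exists_A {F : Form} {P : P2} {n : ℕ} (hn : 1 ≤ n) (h : HasSingType F P (.A n)) :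
    ∃ u v : Fin 3 → ℂ, LinearIndependent ℂ ![P.rep, u, v] ∧
      SquareMod (n + 1) (localEq F P.rep u v) ∧ ¬ SquareMod (n + 2) (localEq F P.rep u v) ∧
      localEq F P.rep u v ∉ germIdeal ^ 3 := by
  obtain ⟨u, v, hi, φ, w, hφ⟩ := h
  refine ⟨u, v, hi, ?_, ?_, ?_⟩
  · rw [← squareMod_equiv_iff φ, hφ, squareMod_unit_mul_iff w.isUnit]
    exact squareMod_A n
  · rw [← squareMod_equiv_iff φ, hφ, squareMod_unit_mul_iff w.isUnit]
    exact not_squareMod_A n hn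
  · rw [← equiv_mem_pow φ, hφ, unit_mul_mem_pow w.isUnit]
    exact A_not_mem_cube n

theorem HasSingType.exists_E6 {F : Form} {P : P2} (h : HasSingType F P .E6) :
    ∃ u v : Fin 3 → ℂ, LinearIndependent ℂ ![P.rep, u, v] ∧
      (∃ w k : Germ, IsUnit w ∧ k ∈ germIdeal ∧
        localEq F P.rep u v - w * k ^ 3 ∈ germIdeal ^ 4) ∧
      localEq F P.rep u v ∉ germIdeal ^ 4 := by
  obtain ⟨u, v, hi, φ, w, hφ⟩ := h
  refine ⟨u, v, hi, ⟨φ.symm w, φ.symm (MvPowerSeries.X 0), ?_, ?_, ?_⟩, ?_⟩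
  · exact w.isUnit.map φ.symm
  · apply equiv_mem; rw [mem_germIdeal_iff, cf_X0]; simp
  · rw [← equiv_mem_pow φ]
    simp only [map_sub, hφ, map_mul, map_pow, AlgEquiv.apply_symm_apply, SingType.normalForm]
    rw [mul_add, add_sub_cancel_left]
    refine Ideal.mul_mem_left _ _ (Ideal.pow_mem_pow ?_ _)
    rw [mem_germIdeal_iff, cf_X1]; simp
  · rw [← equiv_mem_pow φ, hφ, unit_mul_mem_pow w.isUnit]
    exact E6_not_mem_pow_four

theorem X0_mem : (MvPowerSeries.X 0 : Germ) ∈ germIdeal := by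
  rw [mem_germIdeal_iff, cf_X0]; simp
theorem X1_mem : (MvPowerSeries.X 1 : Germ) ∈ germIdeal := by
  rw [mem_germIdeal_iff, cf_X1]; simp

/-- Converse of `cf_eq_zero_of_mem_pow` in the lowest case: f splits as x·k + y²·r, and k has no
constant term because f has no term in x. -/
theorem mem_sq_of_cf {f : Germ} (h0 : cf 0 0 f = 0) (h1 : cf 1 0 f = 0) (h2 : cf 0 1 f = 0) :
    f ∈ germIdeal ^ 2 := by
  have hX0 : (MvPowerSeries.X 0 : Germ) ∈ germIdeal := X0_mem
  -- the part of `f` with positive exponent in the first variable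
  let g : Germ := fun m => if m 0 = 0 then 0 else MvPowerSeries.coeff m f
  have hg : ∀ m, MvPowerSeries.coeff m g = if m 0 = 0 then 0 else MvPowerSeries.coeff m f :=
    fun m => rfl
  have d0 : (MvPowerSeries.X 0 : Germ) ∣ g := by
    rw [MvPowerSeries.X_dvd_iff]
    intro m hm
    rw [hg, if_pos hm]
  have d1 : (MvPowerSeries.X 1 : Germ) ^ 2 ∣ f - g := by
    rw [MvPowerSeries.X_pow_dvd_iff]
    intro m hm
    rw [map_sub, hg]
    split_ifs with h
    · rw [sub_zero, cf_eq_coeff, h]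
      have : m 1 = 0 ∨ m 1 = 1 := by omega
      rcases this with h | h <;> rw [h] <;> assumption
    · simp
  obtain ⟨k, hk⟩ := d0
  obtain ⟨r, hr⟩ := d1
  have : f = MvPowerSeries.X 0 * k + MvPowerSeries.X 1 ^ 2 * r := by rw [← hk, ← hr]; ring
  have hk0 : cf 0 0 k = 0 := by
    rw [this, map_add, cf_mul] at h1
    rw [pow_two, mul_assoc, cf_mul] at h1
    simpa [Finset.Nat.antidiagonal_succ, cf_X0, cf_X1] using h1
  rw [this]
  refine add_mem ?_ (Ideal.mul_mem_right _ _ (Ideal.pow_mem_pow X1_mem 2))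
  rw [pow_two]
  exact Ideal.mul_mem_mul X0_mem (mem_germIdeal_iff.mpr hk0)

theorem eq_of_rep_eq_smul {P Q : P2} {a : ℂ} (h : P.rep = a • Q.rep) : P = Q := by
  have : Projectivization.mk ℂ P.rep P.rep_nonzero = Projectivization.mk ℂ Q.rep Q.rep_nonzero :=
    (Projectivization.mk_eq_mk_iff' _ _ _ _ _).mpr ⟨a, h.symm⟩
  rwa [P.mk_rep, Q.mk_rep] at this

/-! ### Tangent forms -/

theorem tangentForm_add (F G : Form) (P : P2) :
    tangentForm (F + G) P = tangentForm F P + tangentForm G P := by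
  simp only [tangentForm, map_add, add_mul, Finset.sum_add_distrib]

theorem tangentForm_mul (F G : Form) (P : P2) :
    tangentForm (F * G) P = C (eval P.rep F) * tangentForm G P +
      C (eval P.rep G) * tangentForm F P := by
  simp only [tangentForm, Derivation.leibniz, map_add, smul_eq_mul, map_mul, Finset.mul_sum,
    ← Finset.sum_add_distrib]
  refine Finset.sum_congr rfl fun i _ => by ring

theorem tangentForm_C (a : ℂ) (P : P2) : tangentForm (C a) P = 0 := by
  simp [tangentForm]

theorem tangentForm_linear {l : Form} (hl : l.IsHomogeneous 1) (P : P2) : tangentForm l P = l := by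
  obtain ⟨a, rfl⟩ : ∃ a : Fin 3 → ℂ, l = ∑ i, C (a i) * X i := ⟨_, linear_form_eq hl⟩
  simp [tangentForm, pderiv_X, Fin.sum_univ_three, Pi.single_apply]

theorem tangentForm_isHomogeneous (F : Form) (P : P2) : (tangentForm F P).IsHomogeneous 1 := by
  refine IsHomogeneous.sum _ _ _ fun j _ => ?_
  rw [← zero_add 1]
  exact (isHomogeneous_C _ _).mul (isHomogeneous_X _ _)

theorem eval_tangentForm_single (F : Form) (P : P2) (i : Fin 3) :
    eval (Pi.single i 1) (tangentForm F P) = eval P.rep (pderiv i F) := by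
  simp [tangentForm, Pi.single_apply]

theorem isSmoothPt_iff {F : Form} {P : P2} :
    IsSmoothPt F P ↔ OnCurve F P ∧ tangentForm F P ≠ 0 := by
  unfold IsSmoothPt
  refine and_congr_right fun _ => ?_
  constructor
  · rintro ⟨i, hi⟩ h
    exact hi (by rw [← eval_tangentForm_single, h, map_zero])
  · intro h
    by_contra! h'
    exact h (by simp [tangentForm, h'])

theorem isSingularPt_iff {F : Form} {P : P2} :
    IsSingularPt F P ↔ OnCurve F P ∧ tangentForm F P = 0 := by
  unfold IsSingularPt
  refine and_congr_right fun _ => ?_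
  constructor
  · intro h
    simp [tangentForm, h]
  · intro h i
    rw [← eval_tangentForm_single, h, map_zero]

theorem IsFrame.comb_eq_zero_iff {x y z : Form} (h : IsFrame x y z) (a b c : ℂ) :
    C a * x + C b * y + C c * z = 0 ↔ a = 0 ∧ b = 0 ∧ c = 0 := by
  constructor
  · intro h0
    refine ⟨?_, ?_, ?_⟩
    · simpa using congrArg (eval (h.vec 1 0 0)) h0
    · simpa using congrArg (eval (h.vec 0 1 0)) h0
    · simpa using congrArg (eval (h.vec 0 0 1)) h0
  · rintro ⟨rfl, rfl, rfl⟩; simp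

/-! ### The normal form -/

/-- The coefficients of the quartic
`q ^ 2 + b q z ^ 2 + e z ^ 4 + s z ^ 3`, where `q = w ^ 2 + k s ^ 2 + l s z`. -/
structure NF where
  k : ℂ
  l : ℂ
  b : ℂ
  e : ℂ

namespace NF

/-- The conic `q`. -/
def conic (D : NF) (s w z : Form) : Form := w ^ 2 + C D.k * s ^ 2 + C D.l * s * z

/-- The quartic. -/
def form (D : NF) (s w z : Form) : Form :=
  D.conic s w z ^ 2 + C D.b * D.conic s w z * z ^ 2 + C D.e * z ^ 4 + s * z ^ 3

/-- On the affine curve, `s` as a polynomial in `u = q / z ^ 2`. -/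
def S (D : NF) (u : ℂ) : ℂ := -(u ^ 2 + D.b * u + D.e)
/-- The negative derivative of `S`. -/
def c (D : NF) (u : ℂ) : ℂ := 2 * u + D.b
/-- On the affine curve, `w ^ 2` as a polynomial in `u`. -/
def g (D : NF) (u : ℂ) : ℂ := u - D.k * D.S u ^ 2 - D.l * D.S u
/-- The derivative of `g`. -/
def A (D : NF) (u : ℂ) : ℂ := 1 + D.c u * (2 * D.k * D.S u + D.l)
/-- A sixth of the derivative of `N`. -/
def β (D : NF) (u : ℂ) : ℂ := D.A u ^ 2 + 4 * D.k * D.g u * D.c u ^ 2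
/-- The polynomial whose roots are the values of `u` at the flexes. -/
def N (D : NF) (u : ℂ) : ℂ := 4 * D.g u + D.c u * D.β u

variable {D : NF} {F s w z : Form}

theorem eval_conic (v : Fin 3 → ℂ) : eval v (D.conic s w z) =
    eval v w ^ 2 + D.k * eval v s ^ 2 + D.l * eval v s * eval v z := by
  simp [conic]

/-- `F` is the quartic in normal form in the frame `s, w, z`. -/
structure Is (D : NF) (F s w z : Form) : Prop where
  frame : IsFrame s w z
  eq : F = D.form s w z

namespace Is

variable (h : D.Is F s w z)
include h

theorem eval_eq (v : Fin 3 → ℂ) : eval v F =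
    (eval v (D.conic s w z)) ^ 2 + D.b * eval v (D.conic s w z) * eval v z ^ 2 +
      D.e * eval v z ^ 4 + eval v s * eval v z ^ 3 := by
  rw [h.eq]; simp [form]

theorem tangentForm_eq (P : P2) : tangentForm F P =
    C ((2 * eval P.rep (D.conic s w z) + D.b * eval P.rep z ^ 2) *
        (2 * D.k * eval P.rep s + D.l * eval P.rep z) + eval P.rep z ^ 3) * s +
    C (2 * eval P.rep w * (2 * eval P.rep (D.conic s w z) + D.b * eval P.rep z ^ 2)) * w +
    C ((2 * eval P.rep (D.conic s w z) + D.b * eval P.rep z ^ 2) * (D.l * eval P.rep s) +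
      2 * D.b * eval P.rep (D.conic s w z) * eval P.rep z + 4 * D.e * eval P.rep z ^ 3 +
      3 * eval P.rep s * eval P.rep z ^ 2) * z := by
  rw [h.eq]
  simp only [form, conic, pow_succ, pow_zero, one_mul, tangentForm_add, tangentForm_mul,
    tangentForm_C, tangentForm_linear h.frame.hx, tangentForm_linear h.frame.hy,
    tangentForm_linear h.frame.hz, map_add, map_mul, eval_C]
  simp only [map_ofNat]
  ring


/-- The quartic lies in the square of the ideal (q, z), and on z = 0 its equation reduces to q² = 0.
Hence flexes are always affine points. -/
theorem isSingularPt_of_eval_eq_zero {P : P2} (hP : OnCurve F P) (hz : eval P.rep z = 0) :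
    IsSingularPt F P := by
  have hq : eval P.rep (D.conic s w z) = 0 := by
    have := h.eval_eq P.rep
    rw [show eval P.rep F = 0 from hP, hz] at this
    simpa using this.symm
  rw [isSingularPt_iff]
  refine ⟨hP, ?_⟩
  rw [h.tangentForm_eq, hq, hz]
  simp

/-- The point of the affine curve with given `u` and `w`. -/
def pt (h : D.Is F s w z) (u ω : ℂ) : P2 :=
  Projectivization.mk ℂ (h.frame.vec (D.S u) ω 1) (by
    intro h0
    have := h.frame.eval_vec_trd (D.S u) ω 1
    rw [h0, eval_linear h.frame.hz] at this
    simp at this)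

theorem pt_rep (u ω : ℂ) : ∃ a : ℂ, a ≠ 0 ∧ eval (h.pt u ω).rep s = a * D.S u ∧
    eval (h.pt u ω).rep w = a * ω ∧ eval (h.pt u ω).rep z = a := by
  obtain ⟨a, ha⟩ := Projectivization.exists_smul_eq_mk_rep ℂ (h.frame.vec (D.S u) ω 1) (by
    intro h0
    have := h.frame.eval_vec_trd (D.S u) ω 1
    rw [h0, eval_linear h.frame.hz] at this
    simp at this)
  refine ⟨a, a.ne_zero, ?_, ?_, ?_⟩ <;>
  · rw [pt, ← ha, Units.smul_def, eval_linear_smul]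
    · simp
    · first | exact h.frame.hx | exact h.frame.hy | exact h.frame.hz

/-- The coordinates of a point of the affine curve. -/
theorem exists_coords {P : P2} (hP : OnCurve F P) (hz : eval P.rep z ≠ 0) :
    ∃ u ω : ℂ, ω ^ 2 = D.g u ∧ P = h.pt u ω ∧ eval P.rep s = eval P.rep z * D.S u ∧
      eval P.rep w = eval P.rep z * ω := by
  have h0 := h.eval_eq P.rep
  rw [show eval P.rep F = 0 from hP] at h0
  have hq := eval_conic (D := D) (s := s) (w := w) (z := z) P.rep
  set ζ := eval P.rep z with hζ
  set q := eval P.rep (D.conic s w z)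
  have hs : eval P.rep s = ζ * D.S (q / ζ ^ 2) := by
    unfold S
    field_simp
    linear_combination -h0
  have hw : eval P.rep w = ζ * (eval P.rep w / ζ) := by field_simp
  refine ⟨q / ζ ^ 2, eval P.rep w / ζ, ?_, ?_, hs, hw⟩
  · rw [hs] at hq
    unfold g
    field_simp
    linear_combination -hq
  · obtain ⟨a, ha, h1, h2, h3⟩ := h.pt_rep (q / ζ ^ 2) (eval P.rep w / ζ)
    have : P.rep = (ζ / a) • (h.pt (q / ζ ^ 2) (eval P.rep w / ζ)).rep := by
      apply h.frame.ext_vec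
      · rw [eval_linear_smul h.frame.hx, h1, hs]; field_simp
      · rw [eval_linear_smul h.frame.hy, h2]; field_simp
      · rw [eval_linear_smul h.frame.hz, h3]; field_simp; rfl
    exact eq_of_rep_eq_smul this

theorem pt_inj {u ω u' ω' : ℂ} (hg : ω ^ 2 = D.g u) (hg' : ω' ^ 2 = D.g u')
    (he : h.pt u ω = h.pt u' ω') : u = u' ∧ ω = ω' := by
  obtain ⟨a, ha, h1, h2, h3⟩ := h.pt_rep u ω
  obtain ⟨a', ha', h1', h2', h3'⟩ := h.pt_rep u' ω'
  rw [he] at h1 h2 h3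
  have e3 : a = a' := h3.symm.trans h3'
  subst e3
  have e1 : D.S u = D.S u' := mul_left_cancel₀ ha (h1.symm.trans h1')
  have e2 : ω = ω' := mul_left_cancel₀ ha (h2.symm.trans h2')
  refine ⟨?_, e2⟩
  -- The coordinate u is recovered from s and w as ω² + k·S² + l·S.
  unfold g at hg hg'
  rw [← e1, ← e2] at hg'
  linear_combination hg' - hg

omit h in
theorem conic_eval_of_coords {v : Fin 3 → ℂ} {a u ω : ℂ} (hg : ω ^ 2 = D.g u)
    (h1 : eval v s = a * D.S u) (h2 : eval v w = a * ω) (h3 : eval v z = a) :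
    eval v (D.conic s w z) = a ^ 2 * u := by
  rw [eval_conic, h1, h2, h3]
  unfold g at hg
  linear_combination a ^ 2 * hg

theorem onCurve_pt {u ω : ℂ} (hg : ω ^ 2 = D.g u) : OnCurve F (h.pt u ω) := by
  obtain ⟨a, ha, h1, h2, h3⟩ := h.pt_rep u ω
  unfold OnCurve
  rw [h.eval_eq, conic_eval_of_coords hg h1 h2 h3, h1, h3]
  unfold S
  ring

/-- The tangent at a point of the affine curve. -/
theorem tangentForm_pt {u ω : ℂ} (hg : ω ^ 2 = D.g u) : ∃ a : ℂ, a ≠ 0 ∧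
    eval (h.pt u ω).rep z = a ∧ tangentForm F (h.pt u ω) = C (a ^ 3) *
      (C (D.A u) * (s - C (D.S u) * z) + C (2 * ω * D.c u) * (w - C ω * z)) := by
  obtain ⟨a, ha, h1, h2, h3⟩ := h.pt_rep u ω
  refine ⟨a, ha, h3, ?_⟩
  rw [h.tangentForm_eq, conic_eval_of_coords hg h1 h2 h3, h1, h2, h3]
  have e : (2 * (a ^ 2 * u) + D.b * a ^ 2) * (D.l * (a * D.S u)) + 2 * D.b * (a ^ 2 * u) * a +
      4 * D.e * a ^ 3 + 3 * (a * D.S u) * a ^ 2 =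
      a ^ 3 * (-D.A u * D.S u - 2 * ω ^ 2 * D.c u) := by
    rw [hg]; unfold g A c S; ring
  rw [e]
  simp only [A, c]
  simp only [map_add, map_mul, map_sub, map_pow, map_neg, map_ofNat, map_one]
  ring

/-- Since A = g', this is the Jacobian criterion for w² = g(u). The alternative c(u) = 0 cannot
occur together with A(u) = 0, because A = 1 wherever c = 0. -/
theorem isSingularPt_pt_iff {u ω : ℂ} (hg : ω ^ 2 = D.g u) :
    IsSingularPt F (h.pt u ω) ↔ ω = 0 ∧ D.A u = 0 := by
  obtain ⟨a, ha, -, e⟩ := h.tangentForm_pt hg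
  rw [isSingularPt_iff, e]
  have : C (a ^ 3) * (C (D.A u) * (s - C (D.S u) * z) + C (2 * ω * D.c u) * (w - C ω * z)) =
      C (a ^ 3 * D.A u) * s + C (a ^ 3 * (2 * ω * D.c u)) * w +
        C (-(a ^ 3 * (D.A u * D.S u + 2 * ω * D.c u * ω))) * z := by
    simp only [map_add, map_mul, map_neg]; ring
  rw [this, h.frame.comb_eq_zero_iff]
  constructor
  · rintro ⟨-, h1, h2, -⟩
    have hA : D.A u = 0 := by simpa [ha] using h1
    refine ⟨?_, hA⟩
    by_contra hω
    have hc : D.c u = 0 := by simpa [ha, hω] using h2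
    unfold A at hA
    rw [hc] at hA
    simp at hA
  · rintro ⟨rfl, h1⟩
    refine ⟨h.onCurve_pt hg, ?_⟩
    simp [h1]

theorem isSmoothPt_pt_iff {u ω : ℂ} (hg : ω ^ 2 = D.g u) :
    IsSmoothPt F (h.pt u ω) ↔ ¬ (ω = 0 ∧ D.A u = 0) := by
  rw [← h.isSingularPt_pt_iff hg, isSmoothPt_iff, isSingularPt_iff]
  have := h.onCurve_pt hg
  tauto

end Is

end NF

/-! ### Contact with tangent lines, and the flexes as points over roots of N. -/

theorem emultiplicity_X_of_coeff {f : Polynomial ℂ} {m : ℕ} (h0 : ∀ d < m, f.coeff d = 0)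
    (h1 : f.coeff m ≠ 0) : emultiplicity (Polynomial.X : Polynomial ℂ) f = m := by
  rw [emultiplicity_eq_coe]
  refine ⟨Polynomial.X_pow_dvd_iff.mpr h0, fun h => h1 ?_⟩
  exact Polynomial.X_pow_dvd_iff.mp h m (Nat.lt_succ_self m)

namespace NF

variable {D : NF} {F s w z : Form}

theorem form_isHomogeneous (hs : s.IsHomogeneous 1) (hw : w.IsHomogeneous 1)
    (hz : z.IsHomogeneous 1) : (D.form s w z).IsHomogeneous 4 := by
  have hq : (D.conic s w z).IsHomogeneous 2 := by
    refine ((hw.pow 2).add ?_).add ?_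
    · simpa using (hs.pow 2).C_mul D.k
    · simpa using (hs.C_mul D.l).mul hz
  refine (((hq.pow 2).add ?_).add ?_).add ?_
  · simpa using (hq.C_mul D.b).mul (hz.pow 2)
  · simpa using (hz.pow 4).C_mul D.e
  · simpa using hs.mul (hz.pow 3)

/-- A square root of `g`. -/
def root (D : NF) (u : ℂ) : ℂ :=
  (IsAlgClosed.exists_pow_nat_eq (D.g u) (n := 2) (by norm_num)).choose

theorem root_sq (u : ℂ) : D.root u ^ 2 = D.g u :=
  (IsAlgClosed.exists_pow_nat_eq (D.g u) (n := 2) (by norm_num)).choose_spec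

theorem eq_root_or {u ω : ℂ} (hg : ω ^ 2 = D.g u) : ω = D.root u ∨ ω = -D.root u := by
  rw [← D.root_sq] at hg
  exact sq_eq_sq_iff_eq_or_eq_neg.mp hg

theorem root_eq_zero_iff {u : ℂ} : D.root u = 0 ↔ D.g u = 0 := by
  rw [← D.root_sq]; simp

namespace Is

variable (h : D.Is F s w z)
include h

theorem isHomogeneous : F.IsHomogeneous 4 := by
  rw [h.eq]; exact form_isHomogeneous h.frame.hx h.frame.hy h.frame.hz

/-- The direction (-2ωc, A, 0) is annihilated by the tangent form of `tangentForm_pt`. Along it q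
becomes a²u + 2aωt + βt² while z stays equal to a, and substituting into the normal form cancels the
terms of degree 0 and 1. -/
theorem restrictLine_tangent {u ω : ℂ} (hg : ω ^ 2 = D.g u) {v : Fin 3 → ℂ} {a : ℂ}
    (h1 : eval v s = a * D.S u) (h2 : eval v w = a * ω) (h3 : eval v z = a) :
    restrictLine F v (h.frame.vec (-(2 * ω * D.c u)) (D.A u) 0) =
      Polynomial.C (a ^ 2 * D.N u) * Polynomial.X ^ 2 +
      Polynomial.C (4 * ω * a * D.β u) * Polynomial.X ^ 3 +
      Polynomial.C (D.β u ^ 2) * Polynomial.X ^ 4 := by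
  conv_lhs => arg 1; rw [h.eq]
  simp only [form, conic, restrictLine_add, restrictLine_mul, restrictLine_pow, restrictLine_C,
    restrictLine_linear h.frame.hx, restrictLine_linear h.frame.hy, restrictLine_linear h.frame.hz,
    h1, h2, h3, IsFrame.eval_vec_fst, IsFrame.eval_vec_snd, IsFrame.eval_vec_trd, map_zero,
    zero_mul, add_zero]
  apply Polynomial.funext
  intro t
  simp only [Polynomial.eval_add, Polynomial.eval_mul, Polynomial.eval_pow, Polynomial.eval_C,
    Polynomial.eval_X]
  have hq : (a * ω + D.A u * t) ^ 2 + D.k * (a * D.S u + -(2 * ω * D.c u) * t) ^ 2 +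
      D.l * (a * D.S u + -(2 * ω * D.c u) * t) * a = a ^ 2 * u + 2 * ω * a * t + D.β u * t ^ 2 := by
    have e : D.β u = D.A u ^ 2 + 4 * D.k * ω ^ 2 * D.c u ^ 2 := by rw [hg]; rfl
    have e' : ω ^ 2 = u - D.k * D.S u ^ 2 - D.l * D.S u := hg
    rw [e]
    unfold A
    linear_combination a ^ 2 * e'
  rw [hq]
  have hN : D.N u = 4 * ω ^ 2 + D.c u * D.β u := by rw [hg]; rfl
  rw [hN]
  generalize D.β u = B
  unfold S c
  ring

/-- If N and β vanished together, then N = 4g + cβ would give g = 0 and then β = A² would give A =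
0, a singular point. So β ≠ 0 at a flex: the cubic term decides unless ω = 0, and then the quartic
term β² survives. -/
theorem tangentMult_pt {u ω : ℂ} (hg : ω ^ 2 = D.g u) (hsm : ¬ (ω = 0 ∧ D.A u = 0)) :
    tangentMult F (h.pt u ω) = if D.N u = 0 then (if ω = 0 then 4 else 3) else 2 := by
  obtain ⟨a, ha, h1, h2, h3⟩ := h.pt_rep u ω
  obtain ⟨a', ha', h3', ht⟩ := h.tangentForm_pt hg
  rw [h3] at h3'
  subst h3'
  have hev : ∀ v, eval v (tangentForm F (h.pt u ω)) = a ^ 3 *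
      (D.A u * (eval v s - D.S u * eval v z) + 2 * ω * D.c u * (eval v w - ω * eval v z)) := by
    intro v; rw [ht]; simp
  have hne : ω * D.c u ≠ 0 ∨ D.A u ≠ 0 := by
    by_contra! hc
    apply hsm
    refine ⟨?_, hc.2⟩
    rcases mul_eq_zero.mp hc.1 with h0 | h0
    · exact h0
    · have := hc.2
      unfold A at this
      rw [h0] at this
      simp at this
  have hl : tangentMult F (h.pt u ω) = emultiplicity (Polynomial.X : Polynomial ℂ)
      (restrictLine F (h.pt u ω).rep (h.frame.vec (-(2 * ω * D.c u)) (D.A u) 0)) := by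
    apply lineMult_eq h.isHomogeneous
    · rw [hev]; simp; right; ring
    · intro v hv
      rw [hev] at hv
      have hv' := (mul_eq_zero.mp hv).resolve_left (pow_ne_zero 3 ha)
      obtain ⟨b, hb1, hb2⟩ : ∃ b : ℂ, eval v s - D.S u * eval v z = b * (-(2 * ω * D.c u)) ∧
          eval v w - ω * eval v z = b * D.A u := by
        rcases hne with h0 | h0
        · refine ⟨-(eval v s - D.S u * eval v z) / (2 * (ω * D.c u)), ?_, ?_⟩ <;>
          have h2 : (2 : ℂ) * (ω * D.c u) ≠ 0 := mul_ne_zero two_ne_zero h0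
          · rw [div_mul_eq_mul_div, eq_div_iff h2]; ring
          rw [div_mul_eq_mul_div, eq_div_iff h2]
          linear_combination hv'
        · refine ⟨(eval v w - ω * eval v z) / D.A u, ?_, by field_simp⟩
          rw [div_mul_eq_mul_div, eq_div_iff h0]
          linear_combination hv'
      refine ⟨eval v z / a, b, ?_⟩
      apply h.frame.ext_vec
      · rw [eval_linear_add h.frame.hx, eval_linear_smul h.frame.hx, eval_linear_smul h.frame.hx,
          h1, IsFrame.eval_vec_fst, ← hb1]
        field_simp; ring
      · rw [eval_linear_add h.frame.hy, eval_linear_smul h.frame.hy, eval_linear_smul h.frame.hy,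
          h2, IsFrame.eval_vec_snd, ← hb2]
        field_simp; ring
      · rw [eval_linear_add h.frame.hz, eval_linear_smul h.frame.hz, eval_linear_smul h.frame.hz,
          h3, IsFrame.eval_vec_trd]
        field_simp; ring
  rw [hl, h.restrictLine_tangent hg h1 h2 h3]
  have hβ : D.N u = 0 → D.β u ≠ 0 := by
    intro hN hβ
    unfold N at hN
    rw [hβ, ← hg] at hN
    have hω : ω = 0 := by simpa using hN
    apply hsm
    refine ⟨hω, ?_⟩
    unfold β at hβ
    rw [← hg, hω] at hβ
    simpa using hβ
  split_ifs with hN hω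
  · refine emultiplicity_X_of_coeff (m := 4) ?_ ?_
    · intro d hd
      interval_cases d <;> simp only [Polynomial.coeff_add, Polynomial.coeff_C_mul_X_pow] <;> simp [hN, hω]
    · simp only [Polynomial.coeff_add, Polynomial.coeff_C_mul_X_pow]
      simp [hβ hN]
  · refine emultiplicity_X_of_coeff (m := 3) ?_ ?_
    · intro d hd
      interval_cases d <;> simp only [Polynomial.coeff_add, Polynomial.coeff_C_mul_X_pow] <;> simp [hN]
    · simp only [Polynomial.coeff_add, Polynomial.coeff_C_mul_X_pow]
      simp [hβ hN, hω, ha]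
  · refine emultiplicity_X_of_coeff (m := 2) ?_ ?_
    · intro d hd
      interval_cases d <;> simp only [Polynomial.coeff_add, Polynomial.coeff_C_mul_X_pow] <;> simp
    · simp only [Polynomial.coeff_add, Polynomial.coeff_C_mul_X_pow]
      simp [hN, ha]

theorem mem_flexes_iff {P : P2} : P ∈ flexes F ↔ ∃ u ω : ℂ, ω ^ 2 = D.g u ∧ D.N u = 0 ∧
    ¬ (ω = 0 ∧ D.A u = 0) ∧ P = h.pt u ω := by
  constructor
  · rintro ⟨hsm, hm⟩
    have hz : eval P.rep z ≠ 0 := by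
      intro hz
      have h1 := h.isSingularPt_of_eval_eq_zero hsm.1 hz
      rw [isSingularPt_iff] at h1
      rw [isSmoothPt_iff] at hsm
      exact hsm.2 h1.2
    obtain ⟨u, ω, hg, rfl, -, -⟩ := h.exists_coords hsm.1 hz
    rw [h.isSmoothPt_pt_iff hg] at hsm
    refine ⟨u, ω, hg, ?_, hsm, rfl⟩
    by_contra hN
    rw [h.tangentMult_pt hg hsm, if_neg hN] at hm
    exact lt_irrefl _ hm
  · rintro ⟨u, ω, hg, hN, hsm, rfl⟩
    refine ⟨(h.isSmoothPt_pt_iff hg).mpr hsm, ?_⟩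
    rw [h.tangentMult_pt hg hsm, if_pos hN]
    split_ifs <;> norm_num

omit h in
-- For g = 0 the polynomial N reduces to c·A². So a flex with ω = 0 can occur only over the single
-- value u = -b/2.
theorem c_eq_zero_of_flex {u : ℂ} (hN : D.N u = 0) (hg : D.g u = 0) (hA : D.A u ≠ 0) :
    D.c u = 0 := by
  unfold N β at hN
  rw [hg] at hN
  simpa [hA] using hN

omit h in
theorem g_eq_zero_of_c {u : ℂ} (hN : D.N u = 0) (hc : D.c u = 0) : D.g u = 0 := by
  unfold N at hN
  rw [hc] at hN
  simpa using hN

/-- The `u`-coordinates of the flexes. -/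
def IsFlexSet (D : NF) (Z : Finset ℂ) : Prop :=
  ∀ u, u ∈ Z ↔ D.N u = 0 ∧ ¬ (D.g u = 0 ∧ D.A u = 0)

variable {Z : Finset ℂ}

theorem coe_flexes (hZ : IsFlexSet D Z) : flexes F =
    (fun x : ℂ × ℂ => h.pt x.1 x.2) '' ((Z.biUnion fun u =>
      ({(u, D.root u), (u, -D.root u)} : Finset (ℂ × ℂ)) : Finset (ℂ × ℂ)) : Set (ℂ × ℂ)) := by
  ext P
  rw [h.mem_flexes_iff]
  simp only [Set.mem_image, Finset.coe_biUnion, Set.mem_iUnion, exists_prop]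
  constructor
  · rintro ⟨u, ω, hg, hN, hsm, rfl⟩
    refine ⟨(u, ω), ⟨u, ?_, ?_⟩, rfl⟩
    · rw [Finset.mem_coe, hZ, ← hg]
      simpa using ⟨hN, fun h0 => by simpa using fun hA => hsm ⟨h0, hA⟩⟩
    · rcases D.eq_root_or hg with rfl | rfl <;> simp
  · rintro ⟨⟨u, ω⟩, ⟨u', hu', hx⟩, rfl⟩
    rw [Finset.mem_coe, hZ] at hu'
    have : u = u' ∧ (ω = D.root u' ∨ ω = -D.root u') := by
      simp at hx; tauto
    obtain ⟨rfl, hω⟩ := this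
    have hg : ω ^ 2 = D.g u := by
      rcases hω with rfl | rfl
      · exact D.root_sq u
      · rw [neg_sq, D.root_sq]
    refine ⟨u, ω, hg, hu'.1, ?_, rfl⟩
    rintro ⟨h0, hA⟩
    exact hu'.2 ⟨by rw [← hg, h0]; simp, hA⟩

theorem finite_flexes (hZ : IsFlexSet D Z) : (flexes F).Finite := by
  rw [h.coe_flexes hZ]; exact Set.Finite.image _ (Finset.finite_toSet _)

theorem pt_injOn : Set.InjOn (fun x : ℂ × ℂ => h.pt x.1 x.2)
    (Z.biUnion fun u => ({(u, D.root u), (u, -D.root u)} : Finset (ℂ × ℂ)) : Finset (ℂ × ℂ)) := by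
  have key : ∀ x ∈ (Z.biUnion fun u => ({(u, D.root u), (u, -D.root u)} : Finset (ℂ × ℂ))),
      x.2 ^ 2 = D.g x.1 := by
    intro x hx
    simp only [Finset.mem_biUnion, Finset.mem_insert, Finset.mem_singleton] at hx
    obtain ⟨u, -, rfl | rfl⟩ := hx
    · exact D.root_sq u
    · simpa using D.root_sq u
  intro x hx y hy hxy
  obtain ⟨h1, h2⟩ := h.pt_inj (key x hx) (key y hy) hxy
  exact Prod.ext h1 h2

omit h in
theorem pairwiseDisjoint_fibres : (Z : Set ℂ).PairwiseDisjoint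
    fun u => ({(u, D.root u), (u, -D.root u)} : Finset (ℂ × ℂ)) := by
  intro u _ u' _ hne
  rw [Function.onFun, Finset.disjoint_left]
  intro x hx hx'
  simp only [Finset.mem_insert, Finset.mem_singleton] at hx hx'
  apply hne
  have h1 : x.1 = u := by rcases hx with rfl | rfl <;> rfl
  have h2 : x.1 = u' := by rcases hx' with rfl | rfl <;> rfl
  rw [← h1, h2]

/-- Each u contributes 2: either two conjugate flexes of order 1, or, when ω = 0, one flex with
contact 4 and hence order 2. -/
theorem sum_flexOrder (hZ : IsFlexSet D Z) :
    ∑ᶠ P ∈ flexes F, flexOrder F P = 2 * Z.card := by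
  rw [h.coe_flexes hZ, finsum_mem_image h.pt_injOn, finsum_mem_coe_finset,
    Finset.sum_biUnion pairwiseDisjoint_fibres]
  rw [Finset.sum_const_nat (m := 2), mul_comm]
  intro u hu
  rw [hZ] at hu
  have hg := D.root_sq u
  have hg' : (-D.root u) ^ 2 = D.g u := by rw [neg_sq, hg]
  have key : ∀ ω, ω ^ 2 = D.g u → flexOrder F (h.pt u ω) = if ω = 0 then 2 else 1 := by
    intro ω hω
    unfold flexOrder
    rw [h.tangentMult_pt hω (fun h0 => hu.2 ⟨by rw [← hω, h0.1]; simp, h0.2⟩), if_pos hu.1]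
    split_ifs <;> rfl
  by_cases h0 : D.root u = 0
  · simp only [h0, neg_zero, Finset.pair_eq_singleton, Finset.sum_singleton]
    rw [key 0 (by rw [← h0, hg])]; simp
  · rw [Finset.sum_pair]
    · simp only
      rw [key _ hg, key _ hg', if_neg h0, if_neg (neg_ne_zero.mpr h0)]
    · intro he
      have := congrArg Prod.snd he
      simp only at this
      exact h0 (by linear_combination this / 2)

theorem root_ne_zero_of_ordinary (ho : OrdinaryFlexes F) (hZ : IsFlexSet D Z) {u : ℂ} (hu : u ∈ Z) :
    D.root u ≠ 0 := by
  intro h0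
  rw [hZ] at hu
  have hsm : ¬ (D.root u = 0 ∧ D.A u = 0) := fun hc => hu.2 ⟨root_eq_zero_iff.mp h0, hc.2⟩
  have := ho (h.pt u (D.root u)) (h.mem_flexes_iff.mpr ⟨u, _, D.root_sq u, hu.1, hsm, rfl⟩)
  rw [h.tangentMult_pt (D.root_sq u) hsm, if_pos hu.1, if_pos h0] at this
  norm_num at this

theorem ncard_flexes (hZ : IsFlexSet D Z) (hr : ∀ u ∈ Z, D.root u ≠ 0) :
    (flexes F).ncard = 2 * Z.card := by
  rw [h.coe_flexes hZ, Set.ncard_image_of_injOn h.pt_injOn, Set.ncard_coe_finset,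
    Finset.card_biUnion pairwiseDisjoint_fibres, Finset.sum_const_nat (m := 2), mul_comm]
  intro u hu
  apply Finset.card_pair
  intro he
  have := congrArg Prod.snd he
  simp only at this
  exact hr u hu (by linear_combination this / 2)

end Is
end NF

/-! ### Torus decompositions and conjugate flexes. -/

namespace NF

variable {D : NF} {F s w z : Form}

/-- The residual conic of the torus decomposition attached to the value `u`. -/
def residual (D : NF) (s w z : Form) (u : ℂ) : Form :=
  (s - C (D.S u) * z) ^ 2 + C (D.c u ^ 2) * (s - C (D.S u) * z) * z +
    C (D.c u ^ 3) * (D.conic s w z - C u * z ^ 2)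

/-- The conic of the torus decomposition attached to the value `u`. -/
def torusConic (D : NF) (s w z : Form) (u : ℂ) : Form :=
  (s - C (D.S u) * z) * z + C (D.c u) * (D.conic s w z - C u * z ^ 2)

/-- The cubic of the torus decomposition attached to the value `u`. -/
def torusCubic (D : NF) (s w z : Form) (u : ℂ) : Form :=
  C (D.c u ^ 2) * (D.conic s w z - C u * z ^ 2) * z + C (D.c u) * (s - C (D.S u) * z) * z ^ 2 -
    (D.conic s w z - C u * z ^ 2) * (s - C (D.S u) * z)

/-- Put σ = s - S(u)z and Q = q - uz². Recentred at u, the quartic is Q² + cQz² + σz³. On the curve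
with z = 1 one has σ = -Q² - cQ, so the conic σ + cQ restricts to -Q² and the cubic c²Q + cσ - Qσ to
Q³. The sum of cube and square is therefore divisible by the quartic, and `residual` is the
quotient. -/
theorem torusConic_pow_add (D : NF) (s w z : Form) (u : ℂ) :
    D.torusConic s w z u ^ 3 + D.torusCubic s w z u ^ 2 =
      D.form s w z * D.residual s w z u := by
  unfold torusConic torusCubic form residual
  generalize D.conic s w z = q
  simp only [S, c, map_add, map_mul, map_pow, map_neg, map_ofNat]
  ring

theorem conic_isHomogeneous (hs : s.IsHomogeneous 1) (hw : w.IsHomogeneous 1)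
    (hz : z.IsHomogeneous 1) : (D.conic s w z).IsHomogeneous 2 := by
  refine ((hw.pow 2).add ?_).add ?_
  · simpa using (hs.pow 2).C_mul D.k
  · simpa using (hs.C_mul D.l).mul hz

theorem torusConic_isHomogeneous (hs : s.IsHomogeneous 1) (hw : w.IsHomogeneous 1)
    (hz : z.IsHomogeneous 1) (u : ℂ) : (D.torusConic s w z u).IsHomogeneous 2 := by
  have hq := conic_isHomogeneous (D := D) hs hw hz
  refine IsHomogeneous.add ?_ ?_
  · exact (hs.sub (hz.C_mul _)).mul hz
  · refine (hq.sub ?_).C_mul _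
    simpa using (hz.pow 2).C_mul u

theorem torusCubic_isHomogeneous (hs : s.IsHomogeneous 1) (hw : w.IsHomogeneous 1)
    (hz : z.IsHomogeneous 1) (u : ℂ) : (D.torusCubic s w z u).IsHomogeneous 3 := by
  have hq : (D.conic s w z - C u * z ^ 2).IsHomogeneous 2 := by
    refine (conic_isHomogeneous (D := D) hs hw hz).sub ?_
    simpa using (hz.pow 2).C_mul u
  have hS : (s - C (D.S u) * z).IsHomogeneous 1 := hs.sub (hz.C_mul _)
  refine IsHomogeneous.sub (IsHomogeneous.add ?_ ?_) ?_
  · exact (hq.C_mul _).mul hz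
  · simpa using (hS.C_mul (D.c u)).mul (hz.pow 2)
  · exact hq.mul hS

/-- The tangents at two conjugate flexes make up a residual conic. -/
theorem tangents_mul (D : NF) (s w z : Form) {u ω : ℂ} (hg : ω ^ 2 = D.g u) (hN : D.N u = 0) :
    C (D.c u) *
      ((C (D.A u) * (s - C (D.S u) * z) + C (2 * ω * D.c u) * (w - C ω * z)) *
       (C (D.A u) * (s - C (D.S u) * z) + C (2 * (-ω) * D.c u) * (w - C (-ω) * z))) =
      C (-4 * ω ^ 2) * D.residual s w z u := by
  have hN' : 4 * ω ^ 2 + D.c u * (D.A u ^ 2 + 4 * D.k * ω ^ 2 * D.c u ^ 2) = 0 := by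
    rw [hg]; exact hN
  have hg' : ω ^ 2 = u - D.k * D.S u ^ 2 - D.l * D.S u := hg
  apply MvPolynomial.funext
  intro v
  simp only [residual, conic, map_mul, map_add, map_sub, map_pow, eval_C]
  generalize eval v s = s
  generalize eval v w = w
  generalize eval v z = z
  have hA : D.A u = 1 + D.c u * (2 * D.k * D.S u + D.l) := rfl
  generalize D.A u = A at *
  generalize D.S u = S at *
  generalize D.c u = c at *
  linear_combination (s - S * z) ^ 2 * hN' + 4 * ω ^ 2 * c ^ 3 * z ^ 2 * hg' -
    4 * ω ^ 2 * c ^ 2 * (s - S * z) * z * hA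

namespace Is
variable (h : D.Is F s w z)
include h

theorem isTorusType_conj {u ω : ℂ} (hg : ω ^ 2 = D.g u) (hN : D.N u = 0) (hω : ω ≠ 0) :
    IsTorusType (tangentSextic F (h.pt u ω) (h.pt u (-ω))) := by
  have hc : D.c u ≠ 0 := by
    intro hc
    have := g_eq_zero_of_c hN hc
    rw [this] at hg
    exact hω (by simpa using hg)
  obtain ⟨a, ha, -, e⟩ := h.tangentForm_pt hg
  obtain ⟨a', ha', -, e'⟩ := h.tangentForm_pt (u := u) (ω := -ω) (by rw [neg_sq, hg])
  -- The factor c/(-4ω²) is the one from `tangents_mul`; a³ and a'³ are the scalings of the two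
  -- tangent forms caused by the chosen representatives.
  refine ⟨D.c u / (-4 * ω ^ 2 * a ^ 3 * a' ^ 3), ?_, D.torusConic s w z u, D.torusCubic s w z u,
    torusConic_isHomogeneous h.frame.hx h.frame.hy h.frame.hz u,
    torusCubic_isHomogeneous h.frame.hx h.frame.hy h.frame.hz u, ?_⟩
  · refine div_ne_zero hc ?_
    simp [hω, ha, ha']
  · rw [torusConic_pow_add, ← h.eq, tangentSextic, e, e']
    have key := tangents_mul D s w z hg hN
    have e1 : C (D.c u / (-4 * ω ^ 2 * a ^ 3 * a' ^ 3)) * (C (a ^ 3) * C (a' ^ 3)) * C (-4 * ω ^ 2)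
        = (C (D.c u) : Form) := by
      rw [← C_mul, ← C_mul, ← C_mul]
      congr 1
      field_simp
    have h4 : (C (-4 * ω ^ 2) : Form) ≠ 0 := by simp [hω]
    apply mul_left_cancel₀ h4
    linear_combination F * key + F * ((C (D.A u) * (s - C (D.S u) * z) + C (2 * ω * D.c u) * (w - C ω * z)) *
       (C (D.A u) * (s - C (D.S u) * z) + C (2 * (-ω) * D.c u) * (w - C (-ω) * z))) * e1

variable {Z : Finset ℂ}

theorem pt_mem_flexes (hZ : IsFlexSet D Z) {u ω : ℂ} (hu : u ∈ Z) (hg : ω ^ 2 = D.g u) :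
    h.pt u ω ∈ flexes F := by
  rw [hZ] at hu
  refine h.mem_flexes_iff.mpr ⟨u, ω, hg, hu.1, ?_, rfl⟩
  rintro ⟨h0, hA⟩
  exact hu.2 ⟨by rw [← hg, h0]; simp, hA⟩

theorem exists_of_mem_flexes (hZ : IsFlexSet D Z) {P : P2} (hP : P ∈ flexes F) :
    ∃ u ∈ Z, ∃ ω, ω ^ 2 = D.g u ∧ P = h.pt u ω := by
  obtain ⟨u, ω, hg, hN, hsm, rfl⟩ := h.mem_flexes_iff.mp hP
  refine ⟨u, ?_, ω, hg, rfl⟩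
  rw [hZ]
  refine ⟨hN, fun h0 => hsm ⟨?_, h0.2⟩⟩
  rw [← hg] at h0
  simpa using h0.1

omit h in
theorem neg_root_sq (u : ℂ) : (-D.root u) ^ 2 = D.g u := by rw [neg_sq, D.root_sq]

/-- The pair of conjugate flexes over `u`. -/
def conjPair (h : D.Is F s w z) (u : ℂ) : Sym2 P2 := s(h.pt u (D.root u), h.pt u (-D.root u))

theorem conjPair_mem (hZ : IsFlexSet D Z) {u : ℂ} (hu : u ∈ Z) (hr : D.root u ≠ 0) :
    h.conjPair u ∈ torusPairs F := by
  refine ⟨_, h.pt_mem_flexes hZ hu (D.root_sq u), _, h.pt_mem_flexes hZ hu (neg_root_sq u), ?_, rfl,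
    h.isTorusType_conj (D.root_sq u) ((hZ u).mp hu).1 hr⟩
  intro he
  have := (h.pt_inj (D.root_sq u) (neg_root_sq u) he).2
  exact hr (by linear_combination this / 2)

theorem conjPair_injective : Function.Injective h.conjPair := by
  intro u u' he
  rw [conjPair, conjPair, Sym2.eq_iff] at he
  rcases he with ⟨h1, -⟩ | ⟨h1, -⟩
  · exact (h.pt_inj (D.root_sq u) (D.root_sq u') h1).1
  · exact (h.pt_inj (D.root_sq u) (neg_root_sq u') h1).1

omit h in
theorem torusPairs_subset (F : Form) : torusPairs F ∪ nonTorusPairs F =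
    {t | ∃ P ∈ flexes F, ∃ Q ∈ flexes F, P ≠ Q ∧ t = s(P, Q)} := by
  ext t
  constructor
  · rintro (⟨P, hP, Q, hQ, hne, rfl, -⟩ | ⟨P, hP, Q, hQ, hne, rfl, -⟩) <;>
      exact ⟨P, hP, Q, hQ, hne, rfl⟩
  · rintro ⟨P, hP, Q, hQ, hne, rfl⟩
    by_cases ht : IsTorusType (tangentSextic F P Q)
    · exact Or.inl ⟨P, hP, Q, hQ, hne, rfl, ht⟩
    · exact Or.inr ⟨P, hP, Q, hQ, hne, rfl, ht⟩

omit h in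
theorem tangentSextic_comm (F : Form) (P Q : P2) : tangentSextic F P Q = tangentSextic F Q P := by
  unfold tangentSextic; ring

omit h in
theorem disjoint_torusPairs (F : Form) : Disjoint (torusPairs F) (nonTorusPairs F) := by
  rw [Set.disjoint_left]
  rintro t ⟨P, -, Q, -, -, rfl, ht⟩ ⟨P', -, Q', -, -, he, hn⟩
  rcases Sym2.eq_iff.mp he with ⟨rfl, rfl⟩ | ⟨rfl, rfl⟩
  · exact hn ht
  · rw [tangentSextic_comm] at ht; exact hn ht

omit h in
theorem pairs_eq {F : Form} (hf : (flexes F).Finite) : ∃ T : Finset (Sym2 P2),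
    torusPairs F ∪ nonTorusPairs F = T ∧ T.card = (flexes F).ncard.choose 2 := by
  classical
  refine ⟨hf.toFinset.offDiag.image Sym2.mk.uncurry, ?_, ?_⟩
  · rw [torusPairs_subset]
    ext t
    simp only [Set.mem_setOf_eq, Finset.coe_image, Set.mem_image, Finset.mem_coe,
      Finset.mem_offDiag, Set.Finite.mem_toFinset, Prod.exists]
    constructor
    · rintro ⟨P, hP, Q, hQ, hne, rfl⟩; exact ⟨P, Q, ⟨hP, hQ, hne⟩, rfl⟩
    · rintro ⟨P, Q, ⟨hP, hQ, hne⟩, rfl⟩; exact ⟨P, hP, Q, hQ, hne, rfl⟩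
  · rw [Set.ncard_eq_toFinset_card _ hf]
    exact Sym2.card_image_offDiag _

omit h in
theorem finite_torusPairs {F : Form} (hf : (flexes F).Finite) : (torusPairs F).Finite := by
  obtain ⟨T, hT, -⟩ := pairs_eq hf
  exact T.finite_toSet.subset (hT ▸ Set.subset_union_left)

/-- By `c_eq_zero_of_flex` only u = -b/2 can carry a single flex instead of a conjugate pair.
Discarding that value from at least three leaves two genuine pairs, with no assumption that the
flexes are ordinary. -/
theorem two_le_ncard_torusPairs (hZ : IsFlexSet D Z) (hc : 3 ≤ Z.card) :
    2 ≤ (torusPairs F).ncard := by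
  classical
  have hsub : ((Z.erase (-D.b / 2)).image h.conjPair : Set (Sym2 P2)) ⊆ torusPairs F := by
    intro t ht
    simp only [Finset.coe_image, Set.mem_image, Finset.mem_coe, Finset.mem_erase] at ht
    obtain ⟨u, ⟨hne, hu⟩, rfl⟩ := ht
    refine h.conjPair_mem hZ hu fun h0 => hne ?_
    have hu' := (hZ u).mp hu
    have hg0 := root_eq_zero_iff.mp h0
    have := c_eq_zero_of_flex hu'.1 hg0 (fun hA => hu'.2 ⟨hg0, hA⟩)
    unfold c at this
    linear_combination this / 2
  have h1 := Set.ncard_le_ncard hsub (finite_torusPairs (h.finite_flexes hZ))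
  rw [Set.ncard_coe_finset, Finset.card_image_of_injective _ h.conjPair_injective] at h1
  have := Finset.pred_card_le_card_erase (s := Z) (a := -D.b / 2)
  omega

/-- Once torus type forces equal values of u, the torus pairs are exactly the conjugate pairs, one
for each u; the non-torus pairs are the complement among all pairs of the 2·|Z| flexes. -/
theorem ncard_torusPairs (hZ : IsFlexSet D Z) (hr : ∀ u ∈ Z, D.root u ≠ 0)
    (hcrit : ∀ u ∈ Z, ∀ u' ∈ Z, ∀ ω ω', ω ^ 2 = D.g u → ω' ^ 2 = D.g u' →
      h.pt u ω ≠ h.pt u' ω' → IsTorusType (tangentSextic F (h.pt u ω) (h.pt u' ω')) → u = u') :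
    (torusPairs F).ncard = Z.card ∧
      (nonTorusPairs F).ncard = (2 * Z.card).choose 2 - Z.card := by
  have e : torusPairs F = h.conjPair '' Z := by
    ext t
    constructor
    · rintro ⟨P, hP, Q, hQ, hne, rfl, ht⟩
      obtain ⟨u, hu, ω, hg, rfl⟩ := h.exists_of_mem_flexes hZ hP
      obtain ⟨u', hu', ω', hg', rfl⟩ := h.exists_of_mem_flexes hZ hQ
      obtain rfl := hcrit u hu u' hu' ω ω' hg hg' hne ht
      refine ⟨u, hu, ?_⟩
      rw [conjPair, Sym2.eq_iff]
      rcases D.eq_root_or hg with rfl | rfl <;> rcases D.eq_root_or hg' with rfl | rfl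
      · exact absurd rfl hne
      · exact Or.inl ⟨rfl, rfl⟩
      · exact Or.inr ⟨rfl, rfl⟩
      · exact absurd rfl hne
    · rintro ⟨u, hu, rfl⟩
      exact h.conjPair_mem hZ hu (hr u hu)
  have h1 : (torusPairs F).ncard = Z.card := by
    rw [e, Set.ncard_image_of_injective _ h.conjPair_injective, Set.ncard_coe_finset]
  refine ⟨h1, ?_⟩
  obtain ⟨T, hT, hTc⟩ := pairs_eq (h.finite_flexes hZ)
  rw [h.ncard_flexes hZ hr] at hTc
  have hfin : (torusPairs F ∪ nonTorusPairs F).Finite := hT ▸ T.finite_toSet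
  have := Set.ncard_union_eq (disjoint_torusPairs F) (hfin.subset Set.subset_union_left)
    (hfin.subset Set.subset_union_right)
  rw [hT, Set.ncard_coe_finset, hTc, h1] at this
  omega

end Is
end NF

/-! ### Counting the roots of the flex polynomial N. -/

theorem card_roots_toFinset_of_simple {f : Polynomial ℂ} {n : ℕ} (hd : f.natDegree = n)
    (hf : f ≠ 0) (hs : ∀ u, f.eval u = 0 → f.derivative.eval u ≠ 0) :
    f.roots.toFinset.card = n := by
  have h1 : f.roots.card = n := by
    rw [← hd]; exact (Polynomial.splits_iff_card_roots.mp (IsAlgClosed.splits f))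
  rw [Multiset.toFinset_card_of_nodup, h1]
  rw [Multiset.nodup_iff_count_le_one]
  intro u
  rw [Polynomial.count_roots]
  by_contra! hlt
  have := (Polynomial.one_lt_rootMultiplicity_iff_isRoot hf).mp hlt
  exact hs u this.1 this.2

namespace NF
open Polynomial (natDegree)

variable {D : NF}

theorem exists_isFlexSet_of_poly {n : ℕ} {f : Polynomial ℂ} (hd : f.natDegree = n) (hf : f ≠ 0)
    (hN : ∀ u, D.N u = f.eval u) (hs : ∀ u, f.eval u = 0 → f.derivative.eval u ≠ 0)
    (hns : ∀ u, ¬ (D.g u = 0 ∧ D.A u = 0)) : ∃ Z : Finset ℂ, Is.IsFlexSet D Z ∧ Z.card = n := by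
  refine ⟨f.roots.toFinset, ?_, card_roots_toFinset_of_simple hd hf hs⟩
  intro u
  rw [Multiset.mem_toFinset, Polynomial.mem_roots hf, Polynomial.IsRoot, hN]
  exact ⟨fun h => ⟨h, hns u⟩, fun h => h.1⟩

/-- As β is a sixth of N', this is the statement that N has only simple roots when g has no double
root. -/
theorem N_ne_of_beta (hns : ∀ u, ¬ (D.g u = 0 ∧ D.A u = 0)) {u : ℂ} (hN : D.N u = 0) :
    D.β u ≠ 0 := by
  intro hβ
  have hg : D.g u = 0 := by
    unfold N at hN; rw [hβ] at hN; simpa using hN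
  refine hns u ⟨hg, ?_⟩
  unfold β at hβ
  rw [hg] at hβ
  simpa using hβ

/-- The flex polynomial when `l = 0`. -/
theorem N_eq_of_l (hl : D.l = 0) (u : ℂ) : D.N u = 12 * D.k * u ^ 4 + 8 * D.k * D.b * u ^ 3 -
    24 * D.k * D.e * u ^ 2 + (6 - 24 * D.k * D.b * D.e) * u +
    (D.b - 4 * D.k * (D.b ^ 2 * D.e + D.e ^ 2)) := by
  unfold N β A g c S; rw [hl]; ring

theorem beta_eq_of_l (hl : D.l = 0) (u : ℂ) :
    D.β u = 1 + 4 * D.k * (2 * u + D.b) * (u ^ 2 - D.e) := by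
  unfold β A g c S; rw [hl]; ring

theorem exists_isFlexSet_four (hk : D.k ≠ 0) (hl : D.l = 0)
    (hns : ∀ u, ¬ (D.g u = 0 ∧ D.A u = 0)) : ∃ Z : Finset ℂ, Is.IsFlexSet D Z ∧ Z.card = 4 := by
  let f : Polynomial ℂ := Polynomial.C (12 * D.k) * Polynomial.X ^ 4 +
    Polynomial.C (8 * D.k * D.b) * Polynomial.X ^ 3 +
    Polynomial.C (-24 * D.k * D.e) * Polynomial.X ^ 2 +
    Polynomial.C (6 - 24 * D.k * D.b * D.e) * Polynomial.X +
    Polynomial.C (D.b - 4 * D.k * (D.b ^ 2 * D.e + D.e ^ 2))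
  have hd : f.natDegree = 4 := by
    have : (12 * D.k : ℂ) ≠ 0 := by simp [hk]
    simp only [f]
    compute_degree!
  have hN : ∀ u, D.N u = f.eval u := by
    intro u; rw [N_eq_of_l hl]; simp [f]; ring
  refine exists_isFlexSet_of_poly hd (by rintro h; rw [h] at hd; simp at hd) hN ?_ hns
  intro u hu h0
  rw [← hN] at hu
  apply N_ne_of_beta hns hu
  have : f.derivative.eval u = 6 * D.β u := by
    rw [beta_eq_of_l hl]
    simp only [f, Polynomial.derivative_add, Polynomial.derivative_C_mul,
      Polynomial.derivative_C, Polynomial.derivative_X_pow, Polynomial.derivative_X]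
    simp; ring
  rw [this] at h0
  simpa using h0

/-- Here g = l(u² + e) and N = 8l²u³ + 4le. A multiple root of N must be u = 0 with e = 0, and then
g = lu² has a double root, which is excluded. -/
theorem exists_isFlexSet_three (hk : D.k = 0) (hlb : D.l * D.b = -1)
    (hns : ∀ u, ¬ (D.g u = 0 ∧ D.A u = 0)) : ∃ Z : Finset ℂ, Is.IsFlexSet D Z ∧ Z.card = 3 := by
  have hl : D.l ≠ 0 := by rintro h; rw [h] at hlb; simp at hlb
  let f : Polynomial ℂ := Polynomial.C (8 * D.l ^ 2) * Polynomial.X ^ 3 +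
    Polynomial.C (4 * D.l * D.e)
  have hd : f.natDegree = 3 := by
    have : (8 * D.l ^ 2 : ℂ) ≠ 0 := by simp [hl]
    simp only [f]
    compute_degree!
  have hN : ∀ u, D.N u = f.eval u := by
    intro u
    unfold N β A g c S
    rw [hk]; simp [f]
    linear_combination (8 * u * D.l * u + 6 * u + 4 * D.l * u * D.b + D.b * (1 + D.l * D.b) + 2 * u * (1 + D.l * D.b) - 2 * u + 4 * u ^ 2 * D.l) * hlb
  refine exists_isFlexSet_of_poly hd (by rintro h; rw [h] at hd; simp at hd) hN ?_ hns
  intro u hu h0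
  have hu0 : u = 0 := by
    simp only [f, Polynomial.derivative_add, Polynomial.derivative_C_mul,
      Polynomial.derivative_C, Polynomial.derivative_X_pow, Polynomial.derivative_X] at h0
    norm_num [hl] at h0
    exact h0
  have he : D.e = 0 := by
    rw [hu0] at hu; simpa [f, hl] using hu
  apply hns u
  rw [hu0]
  unfold g A c S
  rw [hk, he]
  constructor
  · simp
  · linear_combination hlb

theorem exists_isFlexSet_one (hk : D.k = 0) (hl : D.l = 0) :
    ∃ Z : Finset ℂ, Is.IsFlexSet D Z ∧ Z.card = 1 := by
  refine ⟨{-D.b / 6}, ?_, by simp⟩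
  intro u
  have hA : D.A u = 1 := by unfold A; rw [hk, hl]; ring
  have hN : D.N u = 6 * u + D.b := by
    unfold N β; rw [hA]; unfold g c; rw [hk, hl]; ring
  rw [hA, hN, Finset.mem_singleton]
  constructor
  · rintro rfl; exact ⟨by ring, by simp⟩
  · rintro ⟨h, -⟩; linear_combination h / 6

/-- With exactly one node, there is only one value of `u` at the flexes. -/
theorem exists_isFlexSet_node (hk : D.k ≠ 0) (hl : D.l = 0) {u₁ : ℂ} (hg : D.g u₁ = 0)
    (hA : D.A u₁ = 0) (hns : ∀ u, D.g u = 0 → D.A u = 0 → u = u₁)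
    (hnd : D.c u₁ ^ 2 ≠ 2 * D.S u₁) : ∃ Z : Finset ℂ, Is.IsFlexSet D Z ∧ Z.card = 1 := by
  have hc1 : D.c u₁ ≠ 0 := by rintro h; unfold A at hA; rw [h] at hA; simp at hA
  have hA' : 1 + 2 * D.k * D.c u₁ * D.S u₁ = 0 := by
    unfold A at hA; rw [hl] at hA; linear_combination hA
  have hg' : u₁ = D.k * D.S u₁ ^ 2 := by
    unfold g at hg; rw [hl] at hg; linear_combination hg
  have hc : 2 * u₁ + D.b = D.c u₁ := rfl
  have hS : -(u₁ ^ 2 + D.b * u₁ + D.e) = D.S u₁ := rfl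
  -- The node is a triple root of N: it absorbs three of the four values of u, that is, six of the
  -- eight flexes.
  have key : ∀ u, D.N u = (u - u₁) ^ 3 * (12 * D.k * (u - u₁) + 8 * D.k * (D.c u₁ + 4 * u₁)) := by
    intro u
    rw [N_eq_of_l hl]
    generalize D.c u₁ = c₁ at *
    generalize D.S u₁ = S₁ at *
    have hb : D.b = c₁ - 2 * u₁ := by linear_combination hc
    have he : D.e = -S₁ - u₁ ^ 2 - (c₁ - 2 * u₁) * u₁ := by rw [← hb]; linear_combination -hS
    rw [hb, he]
    have e0 : S₁ + 2 * u₁ * c₁ = 0 := by linear_combination 2 * c₁ * hg' + S₁ * hA'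
    have e1 : 1 + 4 * D.k * c₁ * (S₁ + u₁ * c₁) = 0 := by
      linear_combination 4 * D.k * c₁ ^ 2 * hg' + (1 + 2 * D.k * c₁ * S₁) * hA'
    linear_combination 4 * hg' + (c₁ + 6 * (u - u₁)) * e1 + 24 * D.k * (u - u₁) ^ 2 * e0
  -- The fourth root differs from u₁ exactly when c₁ + 4u₁ ≠ 0. With u₁ = kS₁² and 2kc₁S₁ = -1 one
  -- gets c₁(c₁ + 4u₁) = c₁² - 2S₁, so nondegeneracy of the node suffices.
  have hB : D.c u₁ + 4 * u₁ ≠ 0 := by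
    intro h0
    apply hnd
    generalize D.c u₁ = c₁ at *
    generalize D.S u₁ = S₁ at *
    linear_combination c₁ * h0 - 4 * c₁ * hg' - 2 * S₁ * hA'
  refine ⟨{u₁ - 2 / 3 * (D.c u₁ + 4 * u₁)}, ?_, by simp⟩
  intro u
  rw [Finset.mem_singleton, key]
  constructor
  · rintro rfl
    refine ⟨by ring, fun h0 => hB ?_⟩
    have := hns _ h0.1 h0.2
    linear_combination -3 / 2 * this
  · rintro ⟨h1, h2⟩
    have hne : u - u₁ ≠ 0 := by
      intro h0
      rw [sub_eq_zero] at h0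
      subst h0
      exact h2 ⟨hg, hA⟩
    have := (mul_eq_zero.mp h1).resolve_left (pow_ne_zero 3 hne)
    have h12 : (12 : ℂ) * D.k ≠ 0 := by simp [hk]
    apply mul_left_cancel₀ h12
    linear_combination this

end NF

/-! ### Integral closedness of a hyperelliptic coordinate ring -/

section Quadratic
open Polynomial

/-- After division by gcd(n, q) the square of the remaining part of n is coprime to that of q, hence
divides g and is trivial. -/
theorem dvd_of_sq_dvd_sq_mul_squarefree {n q g : ℂ[X]} (hg : Squarefree g)
    (hn : n ≠ 0) (h : n ^ 2 ∣ q ^ 2 * g) : n ∣ q := by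
  classical
  have hd : EuclideanDomain.gcd n q ≠ 0 := fun h0 => hn (EuclideanDomain.gcd_eq_zero_iff.mp h0).1
  obtain ⟨n', hn'⟩ := EuclideanDomain.gcd_dvd_left n q
  obtain ⟨q', hq'⟩ := EuclideanDomain.gcd_dvd_right n q
  have hcop : IsCoprime n' q' := by
    refine ⟨EuclideanDomain.gcdA n q, EuclideanDomain.gcdB n q, ?_⟩
    apply mul_left_cancel₀ hd
    linear_combination -EuclideanDomain.gcdA n q * hn' - EuclideanDomain.gcdB n q * hq' -
      EuclideanDomain.gcd_eq_gcd_ab n q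
  have h2 : n' ^ 2 ∣ q' ^ 2 * g := by
    apply (mul_dvd_mul_iff_left (pow_ne_zero 2 hd)).mp
    rwa [← mul_assoc, ← mul_pow, ← mul_pow, ← hn', ← hq']
  have h3 : n' ^ 2 ∣ g := (hcop.pow (m := 2) (n := 2)).dvd_of_dvd_mul_left h2
  have hu : IsUnit n' := hg n' (by rwa [← pow_two])
  have h4 := mul_dvd_mul_left (EuclideanDomain.gcd n q) (hu.dvd (a := q'))
  rwa [← hn', ← hq'] at h4

variable {g : ℂ[X]}

theorem quadratic_cancel {n : ℂ[X]} (hn : n ≠ 0) {x y : QuadraticAlgebra ℂ[X] g 0}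
    (h : algebraMap ℂ[X] (QuadraticAlgebra ℂ[X] g 0) n * x = algebraMap ℂ[X] _ n * y) : x = y := by
  have h1 := congrArg QuadraticAlgebra.re h
  have h2 := congrArg QuadraticAlgebra.im h
  simp at h1 h2
  ext1
  · exact h1.resolve_right hn
  · exact h2.resolve_right hn

/-- The root is y/x, which satisfies (y/x)² = -x and so is integral over the ring; the statement is
that it lies in the ring ℂ[u][w]/(w² - g). Writing it as M/n with M = y·x̄ and n the norm of x, it
must be shown that n divides both components of M. -/
theorem exists_root_of_cube_add_sq (hg : Squarefree g) (hd : 1 ≤ g.natDegree)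
    {x y : QuadraticAlgebra ℂ[X] g 0} (hx : x ≠ 0) (h : x ^ 3 + y ^ 2 = 0) :
    ∃ r : QuadraticAlgebra ℂ[X] g 0, r ^ 2 = -x ∧ r ^ 3 = -y := by
  set n := x.norm with hn
  have hn' : algebraMap ℂ[X] (QuadraticAlgebra ℂ[X] g 0) n = x * star x :=
    QuadraticAlgebra.algebraMap_norm_eq_mul_star x
  have hne : n = x.re ^ 2 - g * x.im ^ 2 := by
    rw [hn, QuadraticAlgebra.norm_def]; ring
  -- A nonzero x of norm 0 would make g a square, which is impossible for a squarefree polynomial of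
  -- positive degree.
  have hn0 : n ≠ 0 := by
    intro h0
    rw [h0] at hne
    have hne' : x.re ^ 2 = x.im ^ 2 * g := by linear_combination -hne
    by_cases hi : x.im = 0
    · rw [hi] at hne'
      apply hx
      ext1
      · simpa using hne'
      · simpa using hi
    · have : x.im ∣ x.re := (IsIntegrallyClosed.pow_dvd_pow_iff two_ne_zero).mp ⟨g, hne'⟩
      obtain ⟨k, hk⟩ := this
      rw [hk, mul_pow] at hne'
      have hk2 : k ^ 2 = g := mul_left_cancel₀ (pow_ne_zero 2 hi) hne'
      have hu := hg k ⟨1, by rw [mul_one, ← hk2, pow_two]⟩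
      have : IsUnit g := by rw [← hk2]; exact hu.pow 2
      have := natDegree_eq_zero_of_isUnit this
      omega
  set M := y * star x with hM
  have hM2 : M ^ 2 = algebraMap ℂ[X] _ n ^ 2 * (-x) := by
    rw [hn', hM]; linear_combination (star x) ^ 2 * h
  have hM3 : M ^ 3 = algebraMap ℂ[X] _ n ^ 3 * (-y) := by
    rw [hn', hM]; linear_combination (star x) ^ 3 * y * h
  have hr : M.re ^ 2 + g * M.im ^ 2 = n ^ 2 * (-x.re) := by
    have := congrArg QuadraticAlgebra.re hM2
    simp [pow_two] at this
    linear_combination this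
  -- The real part of M² and the norm of M are the sum and the difference of M.re² and g·M.im². Both
  -- are divisible by n², hence so are M.re² and g·M.im²; squarefreeness of g then gives n ∣ M.im.
  have hnorm : (M.re ^ 2 - g * M.im ^ 2) ^ 2 = n ^ 5 := by
    have e1 : M.norm = M.re ^ 2 - g * M.im ^ 2 := by
      rw [QuadraticAlgebra.norm_def]; ring
    have := congrArg QuadraticAlgebra.norm hM2
    rw [map_mul, map_pow, map_pow, QuadraticAlgebra.norm_algebraMap, QuadraticAlgebra.norm_neg,
      ← hn] at this
    rw [← e1, this]; ring
  have hdv : n ^ 2 ∣ M.re ^ 2 - g * M.im ^ 2 := by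
    apply (IsIntegrallyClosed.pow_dvd_pow_iff two_ne_zero).mp
    exact ⟨n, by rw [hnorm]; ring⟩
  have h2 : (2 : ℂ[X]) * Polynomial.C (2⁻¹ : ℂ) = 1 := by
    rw [show (2 : ℂ[X]) = Polynomial.C 2 from (map_ofNat _ 2).symm, ← Polynomial.C_mul]; norm_num
  have hre : n ∣ M.re := by
    apply (IsIntegrallyClosed.pow_dvd_pow_iff two_ne_zero).mp
    have : M.re ^ 2 = Polynomial.C (2⁻¹ : ℂ) * ((M.re ^ 2 + g * M.im ^ 2) + (M.re ^ 2 - g * M.im ^ 2)) := by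
      linear_combination -M.re ^ 2 * h2
    rw [this]
    exact Dvd.dvd.mul_left (dvd_add ⟨_, hr⟩ hdv) _
  have him : n ∣ M.im := by
    apply dvd_of_sq_dvd_sq_mul_squarefree hg hn0
    have : M.im ^ 2 * g =
        Polynomial.C (2⁻¹ : ℂ) * ((M.re ^ 2 + g * M.im ^ 2) - (M.re ^ 2 - g * M.im ^ 2)) := by
      linear_combination -M.im ^ 2 * g * h2
    rw [this]
    exact Dvd.dvd.mul_left (dvd_sub ⟨_, hr⟩ hdv) _
  obtain ⟨p, hp⟩ := hre
  obtain ⟨q, hq⟩ := him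
  have hMr : M = algebraMap ℂ[X] _ n * ⟨p, q⟩ := by
    ext1
    · simp [hp]
    · simp [hq]
  refine ⟨⟨p, q⟩, ?_, ?_⟩
  · apply quadratic_cancel (pow_ne_zero 2 hn0)
    rw [hMr, mul_pow] at hM2
    rw [map_pow, hM2]
  · apply quadratic_cancel (pow_ne_zero 3 hn0)
    rw [hMr, mul_pow] at hM3
    rw [map_pow, hM3]

end Quadratic

/-! ### Restriction of conics and cubics to the affine curve. -/

namespace IsFrame
variable {x y z : Form}

/-- The algebra homomorphism with prescribed values on a frame. -/
def lift (h : IsFrame x y z) {R : Type*} [CommRing R] [Algebra ℂ R] (a b c : R) : Form →ₐ[ℂ] R :=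
  aeval fun i => algebraMap ℂ R (h.vec 1 0 0 i) * a + algebraMap ℂ R (h.vec 0 1 0 i) * b +
    algebraMap ℂ R (h.vec 0 0 1 i) * c

theorem lift_linear (h : IsFrame x y z) {R : Type*} [CommRing R] [Algebra ℂ R] (a b c : R)
    {l : Form} (hl : l.IsHomogeneous 1) : h.lift a b c l =
      algebraMap ℂ R (eval (h.vec 1 0 0) l) * a + algebraMap ℂ R (eval (h.vec 0 1 0) l) * b +
        algebraMap ℂ R (eval (h.vec 0 0 1) l) * c := by
  rw [lift, aeval_linear hl]
  simp only [eval_linear hl, Fin.sum_univ_three, map_add, map_mul]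
  ring

section
variable (h : IsFrame x y z) {R : Type*} [CommRing R] [Algebra ℂ R] (a b c : R)
@[simp] theorem lift_fst : h.lift a b c x = a := by rw [lift_linear _ _ _ _ h.hx]; simp
@[simp] theorem lift_snd : h.lift a b c y = b := by rw [lift_linear _ _ _ _ h.hy]; simp
@[simp] theorem lift_trd : h.lift a b c z = c := by rw [lift_linear _ _ _ _ h.hz]; simp
@[simp] theorem lift_C (t : ℂ) : h.lift a b c (C t) = algebraMap ℂ R t := by simp [lift]
end

theorem rotate (h : IsFrame x y z) : IsFrame z x y :=
  ⟨h.hz, h.hx, h.hy, fun v h1 h2 h3 => h.inj v h2 h3 h1⟩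

end IsFrame

namespace NF
open Polynomial (natDegree)

/-- `S` as a polynomial. -/
def SP (D : NF) : Polynomial ℂ :=
  -(Polynomial.X ^ 2 + Polynomial.C D.b * Polynomial.X + Polynomial.C D.e)
/-- `g` as a polynomial. -/
def gP (D : NF) : Polynomial ℂ :=
  Polynomial.X - Polynomial.C D.k * D.SP ^ 2 - Polynomial.C D.l * D.SP

variable {D : NF} {F s w z : Form}

@[simp] theorem eval_SP (u : ℂ) : D.SP.eval u = D.S u := by simp [SP, S]
@[simp] theorem eval_gP (u : ℂ) : D.gP.eval u = D.g u := by simp [gP, g]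

theorem derivative_gP_eval (u : ℂ) : D.gP.derivative.eval u = D.A u := by
  simp [gP, A, SP, S, c, Polynomial.derivative_pow]; ring

theorem squarefree_gP (hns : ∀ u, ¬ (D.g u = 0 ∧ D.A u = 0)) : Squarefree D.gP := by
  apply Polynomial.Separable.squarefree
  rw [Polynomial.Separable]
  by_contra hc
  obtain ⟨u, h1, h2⟩ : ∃ u, D.gP.IsRoot u ∧ D.gP.derivative.IsRoot u := by
    by_contra! hno
    refine hc (isCoprime_of_irreducible_dvd ?_ ?_)
    · rintro ⟨h0, -⟩
      exact hno 0 (by simp [h0]) (by simp [h0])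
    · rintro q hq hq1 hq2
      obtain ⟨u, hu⟩ := IsAlgClosed.exists_root q (Polynomial.degree_pos_of_irreducible hq).ne'
      exact hno u (hu.dvd hq1) (hu.dvd hq2)
  exact hns u ⟨by rw [← eval_gP]; exact h1, by rw [← derivative_gP_eval]; exact h2⟩

/-- The degree is 4 in the cuspidal case and 2 in the A₅ case. The bound 2 is what the degree count
in `root_cases` needs; it fails for E₆, where g = u. -/
theorem natDegree_gP (h : D.k ≠ 0 ∧ D.l = 0 ∨ D.k = 0 ∧ D.l ≠ 0) : 2 ≤ D.gP.natDegree := by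
  have e : D.gP = Polynomial.C (-D.k) * Polynomial.X ^ 4 +
      Polynomial.C (-2 * D.k * D.b) * Polynomial.X ^ 3 +
      Polynomial.C (-D.k * (D.b ^ 2 + 2 * D.e) + D.l) * Polynomial.X ^ 2 +
      Polynomial.C (1 - 2 * D.k * D.b * D.e + D.l * D.b) * Polynomial.X +
      Polynomial.C (-D.k * D.e ^ 2 + D.l * D.e) := by
    unfold gP SP
    simp only [map_add, map_mul, map_neg, map_sub, map_pow, map_one, map_ofNat]
    ring
  rcases h with ⟨hk, -⟩ | ⟨hk, hl⟩
  · have : D.gP.natDegree = 4 := by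
      rw [e]; compute_degree!
    omega
  · have : D.gP.natDegree = 2 := by
      rw [e, hk]
      simp only [neg_zero, map_zero, zero_mul, mul_zero, zero_add]
      compute_degree!
    omega

/-- The polynomials 1, u, S, uS, S², S³ have the distinct degrees 0, 1, 2, 3, 4, 6. They are the
restrictions of z³, qz, sz², qs, s²z, s³. -/
theorem span_eq_zero {a₀ a₁ a₂ a₃ a₄ a₆ : ℂ}
    (h : Polynomial.C a₀ + Polynomial.C a₁ * Polynomial.X + Polynomial.C a₂ * D.SP +
      Polynomial.C a₃ * (Polynomial.X * D.SP) + Polynomial.C a₄ * D.SP ^ 2 +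
      Polynomial.C a₆ * D.SP ^ 3 = 0) :
    a₀ = 0 ∧ a₁ = 0 ∧ a₂ = 0 ∧ a₃ = 0 ∧ a₄ = 0 ∧ a₆ = 0 := by
  have e6 : a₆ = 0 := by
    by_contra h6
    have : (Polynomial.C a₀ + Polynomial.C a₁ * Polynomial.X + Polynomial.C a₂ * D.SP +
      Polynomial.C a₃ * (Polynomial.X * D.SP) + Polynomial.C a₄ * D.SP ^ 2 +
      Polynomial.C a₆ * D.SP ^ 3).natDegree = 6 := by
      unfold SP; compute_degree!
    rw [h] at this; simp at this
  subst e6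
  have e4 : a₄ = 0 := by
    by_contra h6
    have : (Polynomial.C a₀ + Polynomial.C a₁ * Polynomial.X + Polynomial.C a₂ * D.SP +
      Polynomial.C a₃ * (Polynomial.X * D.SP) + Polynomial.C a₄ * D.SP ^ 2).natDegree = 4 := by
      unfold SP; compute_degree!
    rw [map_zero, zero_mul, add_zero] at h
    rw [h] at this; simp at this
  subst e4
  simp only [map_zero, zero_mul, add_zero] at h
  have e : Polynomial.C (-a₃) * Polynomial.X ^ 3 + Polynomial.C (-a₂ - a₃ * D.b) * Polynomial.X ^ 2
      + Polynomial.C (a₁ - a₂ * D.b - a₃ * D.e) * Polynomial.X + Polynomial.C (a₀ - a₂ * D.e) = 0 := by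
    rw [← h]
    unfold SP
    simp only [map_mul, map_neg, map_sub]
    ring
  have c3 := congrArg (Polynomial.coeff · 3) e
  have c2 := congrArg (Polynomial.coeff · 2) e
  have c1 := congrArg (Polynomial.coeff · 1) e
  have c0 := congrArg (Polynomial.coeff · 0) e
  simp [Polynomial.coeff_X, Polynomial.coeff_C, -map_sub, -map_mul, -map_neg] at c3 c2 c1 c0
  subst c3
  simp at c2
  subst c2
  simp at c1 c0
  exact ⟨c0, c1, rfl, rfl, rfl, rfl⟩

/-- Powers of w beyond the first are eliminated through w² = q - ks² - lsz, so that the restriction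
can be read off directly in the form P(u) + Q(u)w. The cubic version is the same. -/
theorem exists_expand_conic (h : IsFrame s w z) {f : Form} (hf : f.IsHomogeneous 2) :
    ∃ a₀ a₁ a₂ a₄ c₀ c₂ : ℂ, f = C a₀ * z ^ 2 + C a₁ * D.conic s w z + C a₂ * (s * z) +
      C a₄ * s ^ 2 + w * (C c₀ * z + C c₂ * s) := by
  obtain ⟨a, ha⟩ := h.rotate.exists_expand hf
  refine ⟨a 0 0, a 0 2, a 1 0 - a 0 2 * D.l, a 2 0 - a 0 2 * D.k, a 0 1, a 1 1, ?_⟩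
  rw [ha]
  simp only [Finset.sum_range_succ, Finset.range_zero, Finset.sum_empty, conic, map_sub, map_mul]
  norm_num
  ring

theorem exists_expand_cubic (h : IsFrame s w z) {f : Form} (hf : f.IsHomogeneous 3) :
    ∃ a₀ a₁ a₂ a₃ a₄ a₆ c₀ c₁ c₂ c₄ : ℂ, f = C a₀ * z ^ 3 + C a₁ * (D.conic s w z * z) +
      C a₂ * (s * z ^ 2) + C a₃ * (D.conic s w z * s) + C a₄ * (s ^ 2 * z) + C a₆ * s ^ 3 +
      w * (C c₀ * z ^ 2 + C c₁ * D.conic s w z + C c₂ * (s * z) + C c₄ * s ^ 2) := by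
  obtain ⟨a, ha⟩ := h.rotate.exists_expand hf
  refine ⟨a 0 0, a 0 2, a 1 0 - a 0 2 * D.l, a 1 2, a 2 0 - a 0 2 * D.k - a 1 2 * D.l,
    a 3 0 - a 1 2 * D.k, a 0 1, a 0 3, a 1 1 - a 0 3 * D.l, a 2 1 - a 0 3 * D.k, ?_⟩
  rw [ha]
  simp only [Finset.sum_range_succ, Finset.range_zero, Finset.sum_empty, conic, map_sub, map_mul]
  norm_num
  ring

/-- The affine coordinate ring of the curve with `g` squarefree: `w ^ 2 = g` over `ℂ[u]`. -/
abbrev Ring (D : NF) : Type := QuadraticAlgebra (Polynomial ℂ) D.gP 0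

/-- Restriction of forms to the affine curve. -/
def res (D : NF) (h : IsFrame s w z) : Form →ₐ[ℂ] D.Ring := h.lift ⟨D.SP, 0⟩ ⟨0, 1⟩ 1

theorem Ring.algebraMap_eq (t : ℂ) : algebraMap ℂ D.Ring t = ⟨Polynomial.C t, 0⟩ := by
  rfl

theorem res_conic (h : IsFrame s w z) : D.res h (D.conic s w z) = ⟨Polynomial.X, 0⟩ := by
  simp only [res, conic, map_add, map_mul, map_pow, IsFrame.lift_fst, IsFrame.lift_snd,
    IsFrame.lift_trd, IsFrame.lift_C, Ring.algebraMap_eq, pow_two, mul_one, QuadraticAlgebra.mk_mul_mk]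
  ext1
  · repeat rw [QuadraticAlgebra.re_add]
    simp [gP]
    ring
  · repeat rw [QuadraticAlgebra.im_add]
    simp


theorem res_expand_conic (h : IsFrame s w z) (a₀ a₁ a₂ a₄ c₀ c₂ : ℂ) :
    D.res h (C a₀ * z ^ 2 + C a₁ * D.conic s w z + C a₂ * (s * z) +
      C a₄ * s ^ 2 + w * (C c₀ * z + C c₂ * s)) =
    ⟨Polynomial.C a₀ + Polynomial.C a₁ * Polynomial.X + Polynomial.C a₂ * D.SP +
      Polynomial.C a₄ * D.SP ^ 2, Polynomial.C c₀ + Polynomial.C c₂ * D.SP⟩ := by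
  simp only [map_add, map_mul, map_pow, res_conic]
  simp only [res, IsFrame.lift_fst, IsFrame.lift_snd,
    IsFrame.lift_trd, IsFrame.lift_C, Ring.algebraMap_eq, pow_two, mul_one,
    QuadraticAlgebra.mk_mul_mk]
  ext1
  · repeat rw [QuadraticAlgebra.re_add]
    rw [QuadraticAlgebra.re_mul]
    repeat rw [QuadraticAlgebra.im_add]
    simp
  · repeat rw [QuadraticAlgebra.im_add]
    rw [QuadraticAlgebra.im_mul]
    repeat rw [QuadraticAlgebra.im_add]
    repeat rw [QuadraticAlgebra.re_add]
    simp

theorem res_expand_cubic (h : IsFrame s w z) (a₀ a₁ a₂ a₃ a₄ a₆ c₀ c₁ c₂ c₄ : ℂ) :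
    D.res h (C a₀ * z ^ 3 + C a₁ * (D.conic s w z * z) +
      C a₂ * (s * z ^ 2) + C a₃ * (D.conic s w z * s) + C a₄ * (s ^ 2 * z) + C a₆ * s ^ 3 +
      w * (C c₀ * z ^ 2 + C c₁ * D.conic s w z + C c₂ * (s * z) + C c₄ * s ^ 2)) =
    ⟨Polynomial.C a₀ + Polynomial.C a₁ * Polynomial.X + Polynomial.C a₂ * D.SP +
      Polynomial.C a₃ * (Polynomial.X * D.SP) + Polynomial.C a₄ * D.SP ^ 2 +
      Polynomial.C a₆ * D.SP ^ 3, Polynomial.C c₀ + Polynomial.C c₁ * Polynomial.X +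
      Polynomial.C c₂ * D.SP + Polynomial.C c₄ * D.SP ^ 2⟩ := by
  simp only [map_add, map_mul, map_pow, res_conic]
  simp only [res, IsFrame.lift_fst, IsFrame.lift_snd,
    IsFrame.lift_trd, IsFrame.lift_C, Ring.algebraMap_eq, pow_succ, pow_zero, one_mul, mul_one,
    QuadraticAlgebra.mk_mul_mk]
  ext1
  · repeat rw [QuadraticAlgebra.re_add]
    rw [QuadraticAlgebra.re_mul]
    repeat rw [QuadraticAlgebra.im_add]
    simp
  · repeat rw [QuadraticAlgebra.im_add]
    rw [QuadraticAlgebra.im_mul]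
    repeat rw [QuadraticAlgebra.im_add]
    repeat rw [QuadraticAlgebra.re_add]
    simp

/-- Restriction is injective on forms of degree below that of the quartic, so identities on the
curve between conics or cubics lift to identities of forms. -/
theorem res_eq_zero_cubic (h : IsFrame s w z) {f : Form} (hf : f.IsHomogeneous 3)
    (h0 : D.res h f = 0) : f = 0 := by
  obtain ⟨a₀, a₁, a₂, a₃, a₄, a₆, c₀, c₁, c₂, c₄, rfl⟩ := exists_expand_cubic (D := D) h hf
  rw [res_expand_cubic] at h0
  have h1 := congrArg QuadraticAlgebra.re h0
  have h2 := congrArg QuadraticAlgebra.im h0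
  obtain ⟨rfl, rfl, rfl, rfl, rfl, rfl⟩ := span_eq_zero h1
  have h2' : Polynomial.C c₀ + Polynomial.C c₁ * Polynomial.X + Polynomial.C c₂ * D.SP +
      Polynomial.C 0 * (Polynomial.X * D.SP) + Polynomial.C c₄ * D.SP ^ 2 +
      Polynomial.C 0 * D.SP ^ 3 = 0 := by
    simpa using h2
  obtain ⟨rfl, rfl, rfl, -, rfl, -⟩ := span_eq_zero h2'
  simp

theorem res_eq_zero_conic (h : IsFrame s w z) {f : Form} (hf : f.IsHomogeneous 2)
    (h0 : D.res h f = 0) : f = 0 := by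
  have h1 : D.res h (f * z) = 0 := by rw [map_mul, h0, zero_mul]
  have h2 := res_eq_zero_cubic h (hf.mul h.hz) h1
  refine (mul_eq_zero.mp h2).resolve_right ?_
  rintro rfl
  have := h.eval_vec_trd 0 0 1
  rw [map_zero] at this
  exact zero_ne_one this

theorem res_form (h : IsFrame s w z) : D.res h (D.form s w z) = 0 := by
  simp only [form, map_add, map_mul, map_pow, res_conic]
  simp only [res, IsFrame.lift_fst, IsFrame.lift_snd,
    IsFrame.lift_trd, IsFrame.lift_C, Ring.algebraMap_eq, pow_two, one_pow, mul_one,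
    QuadraticAlgebra.mk_mul_mk]
  ext1
  · repeat rw [QuadraticAlgebra.re_add]
    simp [SP]
    ring
  · repeat rw [QuadraticAlgebra.im_add]
    simp

/-- The sections of the curve by conics and cubics that satisfy `f₂ ^ 3 + f₃ ^ 2 = 0` on it. -/
theorem root_cases (hdeg : 2 ≤ D.gP.natDegree) {P Q : Polynomial ℂ} {a₀ a₁ a₂ a₄ c₀ c₂ : ℂ}
    {d₀ d₁ d₂ d₄ : ℂ}
    (h1 : P ^ 2 + D.gP * Q ^ 2 = -(Polynomial.C a₀ + Polynomial.C a₁ * Polynomial.X +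
      Polynomial.C a₂ * D.SP + Polynomial.C a₄ * D.SP ^ 2))
    (h2 : 2 * P * Q = -(Polynomial.C c₀ + Polynomial.C c₂ * D.SP))
    (h3 : Q * (3 * P ^ 2 + D.gP * Q ^ 2) = -(Polynomial.C d₀ + Polynomial.C d₁ * Polynomial.X +
      Polynomial.C d₂ * D.SP + Polynomial.C d₄ * D.SP ^ 2)) :
    (∃ α β q : ℂ, P = Polynomial.C α + Polynomial.C β * D.SP ∧ Q = Polynomial.C q) ∨
    (∃ p₁ u : ℂ, p₁ ≠ 0 ∧ P = Polynomial.C p₁ * (Polynomial.X - Polynomial.C u) ∧ Q = 0) := by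
  have b2 : (2 * P * Q).natDegree ≤ 2 := by
    rw [h2]; unfold SP; compute_degree
  have b3 : (Q * (3 * P ^ 2 + D.gP * Q ^ 2)).natDegree ≤ 4 := by
    rw [h3]; unfold SP; compute_degree
  have g0 : D.gP ≠ 0 := by rintro h; rw [h] at hdeg; simp at hdeg
  -- If Q had positive degree, deg(PQ) ≤ 2 would give deg P ≤ 1, so gQ² would dominate 3P², and
  -- Q(3P² + gQ²) would have degree deg g + 3 deg Q ≥ 5, above the bound 4.
  have hQd : Q.natDegree = 0 := by
    by_contra hQ
    have hQ0 : Q ≠ 0 := by rintro rfl; simp at hQ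
    have hP : P.natDegree ≤ 1 := by
      by_cases hP0 : P = 0
      · simp [hP0]
      · rw [Polynomial.natDegree_mul (mul_ne_zero two_ne_zero hP0) hQ0,
          show (2 : Polynomial ℂ) = Polynomial.C 2 from (map_ofNat _ 2).symm,
          Polynomial.natDegree_C_mul two_ne_zero] at b2
        omega
    have hg : (D.gP * Q ^ 2).natDegree = D.gP.natDegree + 2 * Q.natDegree := by
      rw [Polynomial.natDegree_mul g0 (pow_ne_zero 2 hQ0), Polynomial.natDegree_pow]
    have hP2 : (3 * P ^ 2).natDegree ≤ 2 := by
      rw [show (3 : Polynomial ℂ) = Polynomial.C 3 from (map_ofNat _ 3).symm,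
          Polynomial.natDegree_C_mul three_ne_zero, Polynomial.natDegree_pow]
      omega
    have hs : (3 * P ^ 2 + D.gP * Q ^ 2).natDegree = D.gP.natDegree + 2 * Q.natDegree := by
      rw [Polynomial.natDegree_add_eq_right_of_natDegree_lt (by omega), hg]
    have hs0 : 3 * P ^ 2 + D.gP * Q ^ 2 ≠ 0 := by
      intro h; rw [h] at hs; simp at hs; omega
    rw [Polynomial.natDegree_mul hQ0 hs0, hs] at b3
    omega
  obtain ⟨q, rfl⟩ : ∃ q, Q = Polynomial.C q := ⟨_, Polynomial.eq_C_of_natDegree_eq_zero hQd⟩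
  by_cases hq : q = 0
  · subst hq
    rw [map_zero] at *
    have b1 : P.natDegree ≤ 2 := by
      have : (P ^ 2 + D.gP * 0 ^ 2).natDegree ≤ 4 := by
        rw [h1]; unfold SP; compute_degree
      simp at this
      omega
    obtain ⟨p0, p1, p2, rfl⟩ : ∃ p0 p1 p2 : ℂ, P = Polynomial.C p2 * Polynomial.X ^ 2 +
        Polynomial.C p1 * Polynomial.X + Polynomial.C p0 := by
      refine ⟨P.coeff 0, P.coeff 1, P.coeff 2, ?_⟩
      conv_lhs => rw [Polynomial.as_sum_range_C_mul_X_pow' P (n := 3) (by omega)]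
      simp [Finset.sum_range_succ]; ring
    have e : Polynomial.C (p2 ^ 2 + a₄) * Polynomial.X ^ 4 +
        Polynomial.C (2 * p1 * p2 + 2 * D.b * a₄) * Polynomial.X ^ 3 +
        Polynomial.C (p1 ^ 2 + 2 * p0 * p2 - a₂ + a₄ * (D.b ^ 2 + 2 * D.e)) * Polynomial.X ^ 2 +
        Polynomial.C (2 * p0 * p1 + a₁ - a₂ * D.b + 2 * a₄ * D.b * D.e) * Polynomial.X +
        Polynomial.C (p0 ^ 2 + a₀ - a₂ * D.e + a₄ * D.e ^ 2) = 0 := by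
      unfold SP at h1
      simp only [map_add, map_mul, map_sub, map_pow, map_ofNat]
      linear_combination h1
    have c4 := congrArg (Polynomial.coeff · 4) e
    have c3 := congrArg (Polynomial.coeff · 3) e
    simp [Polynomial.coeff_X, Polynomial.coeff_C, -map_sub, -map_mul, -map_neg, -map_add] at c3 c4
    -- With Q = 0, P² lies in the span of 1, u, S, S². Comparing the coefficients of u⁴ and u³
    -- leaves only P affine in u (p2 = 0) or affine in S (p1 = b·p2).
    have : p2 * (p1 - D.b * p2) = 0 := by linear_combination c3 / 2 - D.b * c4
    rcases mul_eq_zero.mp this with h | h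
    · subst h
      by_cases hp1 : p1 = 0
      · subst hp1
        exact Or.inl ⟨p0, 0, 0, by simp, by simp⟩
      · refine Or.inr ⟨p1, -p0 / p1, hp1, ?_, rfl⟩
        rw [mul_sub, ← map_mul, mul_div_cancel₀ _ hp1]
        simp
    · refine Or.inl ⟨p0 - p2 * D.e, -p2, 0, ?_, by simp⟩
      have h' : p1 = D.b * p2 := by linear_combination h
      subst h'
      unfold SP
      simp only [map_mul, map_sub, map_neg]
      ring
  -- For a nonzero constant Q = q, the hypothesis `h2` on 2PQ already expresses P through 1 and S.
  · refine Or.inl ⟨-c₀ / (2 * q), -c₂ / (2 * q), q, ?_, rfl⟩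
    have hq2 : (Polynomial.C (2 * q) : Polynomial ℂ) ≠ 0 := by simp [hq]
    apply mul_left_cancel₀ hq2
    rw [mul_add, ← mul_assoc, ← map_mul, ← map_mul, mul_div_cancel₀ _ (by simp [hq]),
      mul_div_cancel₀ _ (by simp [hq])]
    simp only [map_mul, map_neg, map_ofNat]
    linear_combination h2

end NF

/-! ### Torus sextics that contain the quartic. -/

namespace NF
open Polynomial (natDegree)
variable {D : NF} {F s w z : Form}

theorem res_linear (h : IsFrame s w z) (α β q : ℂ) :
    D.res h (C α * z + C β * s + C q * w) =
      ⟨Polynomial.C α + Polynomial.C β * D.SP, Polynomial.C q⟩ := by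
  simp only [res, map_add, map_mul, IsFrame.lift_fst, IsFrame.lift_snd,
    IsFrame.lift_trd, IsFrame.lift_C, Ring.algebraMap_eq, mul_one, QuadraticAlgebra.mk_mul_mk]
  ext1
  · repeat rw [QuadraticAlgebra.re_add]
    simp
  · repeat rw [QuadraticAlgebra.im_add]
    simp

theorem Ring.mk_sq (P : Polynomial ℂ) : (⟨P, 0⟩ : D.Ring) ^ 2 = ⟨P ^ 2, 0⟩ := by
  rw [pow_two, QuadraticAlgebra.mk_mul_mk]; simp [pow_two]

theorem Ring.mk_cube (P : Polynomial ℂ) : (⟨P, 0⟩ : D.Ring) ^ 3 = ⟨P ^ 3, 0⟩ := by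
  rw [pow_succ, Ring.mk_sq, QuadraticAlgebra.mk_mul_mk]; simp [pow_succ]

theorem Ring.eq_zero_of_sq (hg : D.gP ≠ 0) {x : D.Ring} (h : x ^ 2 = 0) : x = 0 := by
  have h1 := congrArg QuadraticAlgebra.re h
  have h2 := congrArg QuadraticAlgebra.im h
  rw [pow_two, QuadraticAlgebra.re_mul, QuadraticAlgebra.re_zero] at h1
  rw [pow_two, QuadraticAlgebra.im_mul, QuadraticAlgebra.im_zero] at h2
  have h3 : 2 * (x.re * x.im) = 0 := by linear_combination h2
  rcases mul_eq_zero.mp ((mul_eq_zero.mp h3).resolve_left two_ne_zero) with h0 | h0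
  · rw [h0] at h1
    ext1
    · exact h0
    · simpa [hg] using h1
  · rw [h0] at h1
    ext1
    · simpa using h1
    · exact h0

theorem res_torusConic (h : IsFrame s w z) (u : ℂ) :
    D.res h (D.torusConic s w z u) = -⟨Polynomial.X - Polynomial.C u, 0⟩ ^ 2 := by
  have : D.torusConic s w z u = C (-D.S u - D.c u * u) * z ^ 2 + C (D.c u) * D.conic s w z +
      C 1 * (s * z) + C 0 * s ^ 2 + w * (C 0 * z + C 0 * s) := by
    simp only [torusConic, map_sub, map_neg, map_mul, map_one, map_zero]; ring
  rw [this, res_expand_conic, Ring.mk_sq]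
  ext1
  · rw [QuadraticAlgebra.re_neg]
    simp only [SP, S, c, map_add, map_mul, map_neg, map_sub, map_pow, map_ofNat, map_one, map_zero]
    ring
  · rw [QuadraticAlgebra.im_neg]
    simp

theorem res_torusCubic (h : IsFrame s w z) (u : ℂ) :
    D.res h (D.torusCubic s w z u) = ⟨Polynomial.X - Polynomial.C u, 0⟩ ^ 3 := by
  have : D.torusCubic s w z u = C (-D.c u ^ 2 * u - D.c u * D.S u - u * D.S u) * z ^ 3 +
      C (D.c u ^ 2 + D.S u) * (D.conic s w z * z) + C (D.c u + u) * (s * z ^ 2) +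
      C (-1) * (D.conic s w z * s) + C 0 * (s ^ 2 * z) + C 0 * s ^ 3 +
      w * (C 0 * z ^ 2 + C 0 * D.conic s w z + C 0 * (s * z) + C 0 * s ^ 2) := by
    simp only [torusCubic, map_sub, map_neg, map_mul, map_one, map_zero, map_add, map_pow]; ring
  rw [this, res_expand_cubic, Ring.mk_cube]
  ext1
  · simp only [SP, S, c, map_add, map_mul, map_neg, map_sub, map_pow, map_ofNat, map_one, map_zero]
    ring
  · simp

/-- A sextic that consists of the quartic and a nonzero conic and is of torus type comes from one
of the decompositions above. -/
theorem exists_residual (h : D.Is F s w z) (hdeg : 2 ≤ D.gP.natDegree)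
    (hns : ∀ u, ¬ (D.g u = 0 ∧ D.A u = 0)) {f₂ f₃ R : Form} (hf₂ : f₂.IsHomogeneous 2)
    (hf₃ : f₃.IsHomogeneous 3) (hF : F ≠ 0) (hR : R ≠ 0) (he : F * R = f₂ ^ 3 + f₃ ^ 2) :
    ∃ p u : ℂ, R = C p * D.residual s w z u := by
  have hframe := h.frame
  have hres : D.res hframe f₂ ^ 3 + D.res hframe f₃ ^ 2 = 0 := by
    rw [← map_pow, ← map_pow, ← map_add, ← he, map_mul, h.eq, res_form, zero_mul]
  have hFR : F * R ≠ 0 := mul_ne_zero hF hR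
  have hx : D.res hframe f₂ ≠ 0 := by
    intro h0
    rw [h0] at hres
    have h2 := res_eq_zero_conic hframe hf₂ h0
    have h3 := res_eq_zero_cubic hframe hf₃
      (Ring.eq_zero_of_sq (by rintro h; rw [h] at hdeg; simp at hdeg) (by simpa using hres))
    apply hFR
    rw [he, h2, h3]
    ring
  obtain ⟨r, hr2, hr3⟩ := exists_root_of_cube_add_sq (squarefree_gP hns) (by omega) hx hres
  obtain ⟨a₀, a₁, a₂, a₄, c₀, c₂, e2⟩ := exists_expand_conic (D := D) hframe hf₂
  obtain ⟨b₀, b₁, b₂, b₃, b₄, b₆, d₀, d₁, d₂, d₄, e3⟩ := exists_expand_cubic (D := D) hframe hf₃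
  have E2 := hr2
  have E3 := hr3
  rw [e2, res_expand_conic] at E2
  rw [e3, res_expand_cubic] at E3
  have i1 : r.re ^ 2 + D.gP * r.im ^ 2 = -(Polynomial.C a₀ + Polynomial.C a₁ * Polynomial.X +
      Polynomial.C a₂ * D.SP + Polynomial.C a₄ * D.SP ^ 2) := by
    have := congrArg QuadraticAlgebra.re E2
    rw [pow_two, QuadraticAlgebra.re_mul, QuadraticAlgebra.re_neg] at this
    rw [← this]; ring
  have i2 : 2 * r.re * r.im = -(Polynomial.C c₀ + Polynomial.C c₂ * D.SP) := by
    have := congrArg QuadraticAlgebra.im E2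
    rw [pow_two, QuadraticAlgebra.im_mul, QuadraticAlgebra.im_neg] at this
    rw [← this]; ring
  have i3 : r.im * (3 * r.re ^ 2 + D.gP * r.im ^ 2) = -(Polynomial.C d₀ +
      Polynomial.C d₁ * Polynomial.X + Polynomial.C d₂ * D.SP + Polynomial.C d₄ * D.SP ^ 2) := by
    have := congrArg QuadraticAlgebra.im E3
    rw [pow_succ, pow_two, QuadraticAlgebra.im_mul, QuadraticAlgebra.im_mul,
      QuadraticAlgebra.re_mul, QuadraticAlgebra.im_neg] at this
    rw [← this]; ring
  rcases root_cases hdeg i1 i2 i3 with ⟨α, β, q, hP, hQ⟩ | ⟨p, u, hp, hP, hQ⟩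
  · exfalso
    set H : Form := C α * z + C β * s + C q * w with hH
    have hHh : H.IsHomogeneous 1 :=
      ((hframe.hz.C_mul α).add (hframe.hx.C_mul β)).add (hframe.hy.C_mul q)
    have hr : D.res hframe H = r := by
      rw [hH, res_linear]
      ext1
      · exact hP.symm
      · exact hQ.symm
    -- If r is the restriction of a linear form H, then f₂ = -H² and f₃ = -H³ as forms by
    -- injectivity, and f₂³ + f₃² = 0 contradicts F·R ≠ 0.
    have k2 : f₂ + H ^ 2 = 0 := by
      refine res_eq_zero_conic (D := D) hframe (hf₂.add (by simpa using hHh.pow 2)) ?_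
      rw [map_add, map_pow, hr, hr2, add_neg_cancel]
    have k3 : f₃ + H ^ 3 = 0 := by
      refine res_eq_zero_cubic (D := D) hframe (hf₃.add (by simpa using hHh.pow 3)) ?_
      rw [map_add, map_pow, hr, hr3, add_neg_cancel]
    apply hFR
    rw [he, eq_neg_of_add_eq_zero_left k2, eq_neg_of_add_eq_zero_left k3]
    ring
  · have hr : r = algebraMap ℂ D.Ring p * ⟨Polynomial.X - Polynomial.C u, 0⟩ := by
      rw [Ring.algebraMap_eq, QuadraticAlgebra.mk_mul_mk]
      ext1
      · rw [hP]; simp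
      · rw [hQ]; simp
    have k2 : f₂ - C (p ^ 2) * D.torusConic s w z u = 0 := by
      refine res_eq_zero_conic (D := D) hframe (hf₂.sub
        ((torusConic_isHomogeneous hframe.hx hframe.hy hframe.hz u).C_mul _)) ?_
      rw [map_sub, map_mul, res_torusConic, ← neg_eq_iff_eq_neg.mpr hr2, hr]
      simp only [res, IsFrame.lift_C, map_pow]
      ring
    have k3 : f₃ + C (p ^ 3) * D.torusCubic s w z u = 0 := by
      refine res_eq_zero_cubic (D := D) hframe (hf₃.add
        ((torusCubic_isHomogeneous hframe.hx hframe.hy hframe.hz u).C_mul _)) ?_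
      rw [map_add, map_mul, res_torusCubic, ← neg_eq_iff_eq_neg.mpr hr3, hr]
      simp only [res, IsFrame.lift_C, map_pow]
      ring
    refine ⟨p ^ 6, u, ?_⟩
    apply mul_left_cancel₀ hF
    rw [he, sub_eq_zero.mp k2, eq_neg_of_add_eq_zero_left k3]
    have := torusConic_pow_add D s w z u
    rw [← h.eq] at this
    simp only [map_pow]
    linear_combination (C p) ^ 6 * this


/-- If the tangents at two flexes make up a conic that is even in `w`, the flexes have the same
value of `u`. -/
theorem eq_of_even {u u' ω ω' : ℂ} (hg : ω ^ 2 = D.g u) (hg' : ω' ^ 2 = D.g u')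
    (hN : D.N u = 0) (hN' : D.N u' = 0) (hsm : ¬ (D.g u = 0 ∧ D.A u = 0))
    (hsm' : ¬ (D.g u' = 0 ∧ D.A u' = 0))
    (h1 : D.A u * (2 * ω' * D.c u') + D.A u' * (2 * ω * D.c u) = 0)
    (h2 : (2 * ω * D.c u) * (-(D.A u' * D.S u') - 2 * ω' ^ 2 * D.c u') +
      (2 * ω' * D.c u') * (-(D.A u * D.S u) - 2 * ω ^ 2 * D.c u) = 0) : u = u' := by
  have key : ∀ {v η : ℂ}, η ^ 2 = D.g v → D.N v = 0 → ¬ (D.g v = 0 ∧ D.A v = 0) →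
      2 * η * D.c v = 0 → D.c v = 0 := by
    intro v η hη hv hs h0
    by_contra hc
    have hη0 : η = 0 := by simpa [hc] using h0
    rw [hη0] at hη
    have hgv : D.g v = 0 := by rw [← hη]; ring
    refine hs ⟨hgv, ?_⟩
    unfold N β at hv
    rw [hgv] at hv
    simpa [hc] using hv
  have hc1 : ∀ {v : ℂ}, D.c v = 0 → D.A v = 1 := by
    intro v hv; unfold A; rw [hv]; ring
  have hcu : D.c u = D.c u' → u = u' := by
    intro h; unfold c at h; linear_combination h / 2
  -- If one tangent has no w-term, then c = 0 and A = 1 there, and `h1` removes the w-term of the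
  -- other tangent as well; both values are then u = -b/2.
  by_cases hB : 2 * ω * D.c u = 0
  · have hc := key hg hN hsm hB
    rw [hB, hc1 hc] at h1
    have hc' := key hg' hN' hsm' (by linear_combination h1)
    exact hcu (hc.trans hc'.symm)
  by_cases hB' : 2 * ω' * D.c u' = 0
  · have hc := key hg' hN' hsm' hB'
    rw [hB', hc1 hc] at h1
    exact absurd (by linear_combination h1) hB
  have hω : ω ≠ 0 := by rintro rfl; simp at hB
  have hω' : ω' ≠ 0 := by rintro rfl; simp at hB'
  have hc : D.c u ≠ 0 := by intro h; simp [h] at hB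
  have hc' : D.c u' ≠ 0 := by intro h; simp [h] at hB'
  have hS : D.S u = -D.c u ^ 2 / 4 + (D.b ^ 2 / 4 - D.e) := by unfold S c; ring
  have hS' : D.S u' = -D.c u' ^ 2 / 4 + (D.b ^ 2 / 4 - D.e) := by unfold S c; ring
  have hA : D.A u = 1 + D.c u * (2 * D.k * D.S u + D.l) := rfl
  have hA' : D.A u' = 1 + D.c u' * (2 * D.k * D.S u' + D.l) := rfl
  have n1 : 4 * ω ^ 2 + D.c u * (D.A u ^ 2 + 4 * D.k * ω ^ 2 * D.c u ^ 2) = 0 := by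
    rw [hg]; exact hN
  have n2 : 4 * ω' ^ 2 + D.c u' * (D.A u' ^ 2 + 4 * D.k * ω' ^ 2 * D.c u' ^ 2) = 0 := by
    rw [hg']; exact hN'
  apply hcu
  generalize D.A u = A at *
  generalize D.A u' = A' at *
  generalize D.S u = S at *
  generalize D.S u' = S' at *
  generalize D.c u = c at *
  generalize D.c u' = c' at *
  -- Normalize each tangent to have w-coefficient 1. Evenness says that the remaining coefficients
  -- of the two are opposite. The flex equation makes the squared s-coefficient equal to -k - 1/c³
  -- and the product of the s- and z-coefficients equal to -3/(4c) + K/c³ - l/2. The first gives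
  -- equal cubes of c, and then the second gives equal c.
  have q1 : (A / (2 * ω * c)) = -(A' / (2 * ω' * c')) := by
    field_simp; linear_combination h1 / 2
  have q2 : ((-(A * S) - 2 * ω ^ 2 * c) / (2 * ω * c)) =
      -((-(A' * S') - 2 * ω' ^ 2 * c') / (2 * ω' * c')) := by
    field_simp; linear_combination h2 / 2
  have r1 : (A / (2 * ω * c)) ^ 2 = -D.k - 1 / c ^ 3 := by
    field_simp; linear_combination n1
  have r1' : (A' / (2 * ω' * c')) ^ 2 = -D.k - 1 / c' ^ 3 := by
    field_simp; linear_combination n2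
  have e1 : 1 / c ^ 3 = 1 / c' ^ 3 := by
    rw [q1, neg_sq, r1'] at r1
    linear_combination r1
  set K := D.b ^ 2 / 4 - D.e
  have r2 : (A / (2 * ω * c)) * ((-(A * S) - 2 * ω ^ 2 * c) / (2 * ω * c)) =
      -3 / (4 * c) + K * (1 / c ^ 3) - D.l / 2 := by
    have : (A / (2 * ω * c)) * ((-(A * S) - 2 * ω ^ 2 * c) / (2 * ω * c)) =
      -(A / (2 * ω * c)) ^ 2 * S - A / (2 * c) := by field_simp
    rw [this, r1, hA, hS]
    field_simp
    ring
  have r2' : (A' / (2 * ω' * c')) * ((-(A' * S') - 2 * ω' ^ 2 * c') / (2 * ω' * c')) =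
      -3 / (4 * c') + K * (1 / c' ^ 3) - D.l / 2 := by
    have : (A' / (2 * ω' * c')) * ((-(A' * S') - 2 * ω' ^ 2 * c') / (2 * ω' * c')) =
      -(A' / (2 * ω' * c')) ^ 2 * S' - A' / (2 * c') := by field_simp
    rw [this, r1', hA', hS']
    field_simp
    ring
  rw [q1, q2, neg_mul_neg, r2', e1] at r2
  have e2 : -3 / (4 * c') = -3 / (4 * c) := by linear_combination r2
  field_simp at e2
  linear_combination -e2

/-- Only the pairs of conjugate flexes can be of torus type. -/
theorem Is.eq_of_isTorusType (h : D.Is F s w z)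
    (hkl : D.k ≠ 0 ∧ D.l = 0 ∨ D.k = 0 ∧ D.l ≠ 0)
    (hns : ∀ u, ¬ (D.g u = 0 ∧ D.A u = 0)) (hF : F ≠ 0) {Z : Finset ℂ} (hZ : IsFlexSet D Z) :
    ∀ u ∈ Z, ∀ u' ∈ Z, ∀ ω ω' : ℂ, ω ^ 2 = D.g u → ω' ^ 2 = D.g u' → h.pt u ω ≠ h.pt u' ω' →
      IsTorusType (tangentSextic F (h.pt u ω) (h.pt u' ω')) → u = u' := by
  rintro u hu u' hu' ω ω' hg hg' - ⟨t, ht, f₂, f₃, hf₂, hf₃, he⟩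
  rw [hZ] at hu hu'
  obtain ⟨a, ha, -, ea⟩ := h.tangentForm_pt hg
  obtain ⟨a', ha', -, ea'⟩ := h.tangentForm_pt hg'
  have sm := (isSmoothPt_iff.mp ((h.isSmoothPt_pt_iff hg).mpr (by
    rintro ⟨rfl, hA⟩; exact hns u ⟨by rw [← hg]; ring, hA⟩))).2
  have sm' := (isSmoothPt_iff.mp ((h.isSmoothPt_pt_iff hg').mpr (by
    rintro ⟨rfl, hA⟩; exact hns u' ⟨by rw [← hg']; ring, hA⟩))).2
  obtain ⟨p, u₀, hp⟩ := exists_residual h (natDegree_gP hkl) hns hf₂ hf₃ hF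
    (R := C t * (tangentForm F (h.pt u ω) * tangentForm F (h.pt u' ω')))
    (mul_ne_zero (by simpa using ht) (mul_ne_zero sm sm')) (by rw [← he, tangentSextic]; ring)
  -- The residual conic involves w only through q, hence only through w²; so the product of the
  -- tangents is invariant under w ↦ -w. The vectors (1,1,0) and (0,1,1) below extract the
  -- coefficients of sw and wz.
  have hev : ∀ x y ζ : ℂ,
      (D.A u * (x - D.S u * ζ) + 2 * ω * D.c u * (y - ω * ζ)) *
      (D.A u' * (x - D.S u' * ζ) + 2 * ω' * D.c u' * (y - ω' * ζ)) =
      (D.A u * (x - D.S u * ζ) + 2 * ω * D.c u * (-y - ω * ζ)) *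
      (D.A u' * (x - D.S u' * ζ) + 2 * ω' * D.c u' * (-y - ω' * ζ)) := by
    intro x y ζ
    have k1 := congrArg (eval (h.frame.vec x y ζ)) hp
    have k2 := congrArg (eval (h.frame.vec x (-y) ζ)) hp
    rw [ea, ea'] at k1 k2
    simp only [residual, conic, map_mul, map_add, map_sub, map_pow, eval_C,
      IsFrame.eval_vec_fst, IsFrame.eval_vec_snd, IsFrame.eval_vec_trd] at k1 k2
    have hta : t * a ^ 3 * a' ^ 3 ≠ 0 := by simp [ht, ha, ha']
    apply mul_left_cancel₀ hta
    linear_combination k1 - k2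
  have h1 := hev 1 1 0
  have h2 := hev 0 1 1
  exact eq_of_even hg hg' hu.1 hu'.1 hu.2 hu'.2 (by linear_combination h1 / 2)
    (by linear_combination h2 / 2)

end NF

/-! ### Linear changes of charts -/

/-- If θ f had constant term a ≠ 0, then f - a would be a unit mapped to a nonunit. So every algebra
endomorphism is local. -/
theorem algHom_mem (θ : Germ →ₐ[ℂ] Germ) {f : Germ} (hf : f ∈ germIdeal) : θ f ∈ germIdeal := by
  by_contra h
  have hu : cf 0 0 (θ f) ≠ 0 := by rwa [mem_germIdeal_iff] at h
  have h1 : IsUnit (f - algebraMap ℂ Germ (cf 0 0 (θ f))) := by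
    rw [isUnit_iff_cf, map_sub, mem_germIdeal_iff.mp hf, MvPowerSeries.algebraMap_apply, cf_C]
    simpa using hu
  have h2 := h1.map θ
  rw [map_sub, AlgHom.commutes, isUnit_iff_cf, map_sub, MvPowerSeries.algebraMap_apply, cf_C] at h2
  simp at h2

/-- The substitution of linear forms in power series in two variables. -/
def linSubst (a b c d : ℂ) : Germ →ₐ[ℂ] Germ :=
  MvPowerSeries.substAlgHom (MvPowerSeries.hasSubst_of_constantCoeff_zero
    (a := ![MvPowerSeries.C a * MvPowerSeries.X 0 + MvPowerSeries.C c * MvPowerSeries.X 1,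
      MvPowerSeries.C b * MvPowerSeries.X 0 + MvPowerSeries.C d * MvPowerSeries.X 1])
    (by intro i; fin_cases i <;> simp))

theorem linSubst_X0 (a b c d : ℂ) : linSubst a b c d (MvPowerSeries.X 0) =
    MvPowerSeries.C a * MvPowerSeries.X 0 + MvPowerSeries.C c * MvPowerSeries.X 1 := by
  rw [linSubst, MvPowerSeries.substAlgHom_X]; rfl

theorem linSubst_X1 (a b c d : ℂ) : linSubst a b c d (MvPowerSeries.X 1) =
    MvPowerSeries.C b * MvPowerSeries.X 0 + MvPowerSeries.C d * MvPowerSeries.X 1 := by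
  rw [linSubst, MvPowerSeries.substAlgHom_X]; rfl

theorem linSubst_C (a b c d t : ℂ) :
    linSubst a b c d (MvPowerSeries.C t) = MvPowerSeries.C t :=
  AlgHom.commutes _ t

theorem localEq_linSubst (F : Form) (p u v : Fin 3 → ℂ) (a b c d : ℂ) :
    linSubst a b c d (localEq F p u v) = localEq F p (a • u + b • v) (c • u + d • v) := by
  induction F using MvPolynomial.induction_on with
  | C t => rw [localEq_C, localEq_C, linSubst_C]
  | add f g hf hg => rw [localEq_add, map_add, hf, hg, localEq_add]
  | mul_X f i hf =>
    rw [localEq_mul, map_mul, hf, localEq_mul, localEq_linear (isHomogeneous_X _ _),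
      localEq_linear (isHomogeneous_X _ _)]
    simp only [map_add, map_mul, linSubst_X0, linSubst_X1, linSubst_C, eval_X, Pi.add_apply,
      Pi.smul_apply, smul_eq_mul]
    ring

theorem linSubst_cf {f : Germ} (a b c d : ℂ) :
    cf 0 0 (linSubst a b c d f) = cf 0 0 f ∧
    cf 1 0 (linSubst a b c d f) = a * cf 1 0 f + b * cf 0 1 f ∧
    cf 0 1 (linSubst a b c d f) = c * cf 1 0 f + d * cf 0 1 f := by
  set l : Germ := MvPowerSeries.C (cf 0 0 f) + MvPowerSeries.C (cf 1 0 f) * MvPowerSeries.X 0 +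
    MvPowerSeries.C (cf 0 1 f) * MvPowerSeries.X 1 with hl
  have h1 : f - l ∈ germIdeal ^ 2 := by
    apply mem_sq_of_cf <;> simp [hl, cf_C, cf_C_mul, cf_X0, cf_X1]
  have h2 : linSubst a b c d f - linSubst a b c d l ∈ germIdeal ^ 2 := by
    rw [← map_sub]
    exact map_mem_pow (θ := (linSubst a b c d).toRingHom) (fun f hf => algHom_mem _ hf) h1
  have h3 : linSubst a b c d l = MvPowerSeries.C (cf 0 0 f) +
      MvPowerSeries.C (cf 1 0 f) * (MvPowerSeries.C a * MvPowerSeries.X 0 + MvPowerSeries.C c * MvPowerSeries.X 1) +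
      MvPowerSeries.C (cf 0 1 f) * (MvPowerSeries.C b * MvPowerSeries.X 0 + MvPowerSeries.C d * MvPowerSeries.X 1) := by
    rw [hl]; simp only [map_add, map_mul, linSubst_X0, linSubst_X1, linSubst_C]
  rw [h3] at h2
  refine ⟨?_, ?_, ?_⟩
  · rw [cf_eq_of_sub_mem_pow h2 (by norm_num)]
    simp [cf_C, cf_C_mul, cf_X0, cf_X1]
  · rw [cf_eq_of_sub_mem_pow h2 (by norm_num)]
    simp [cf_C, cf_C_mul, cf_X0, cf_X1]; ring
  · rw [cf_eq_of_sub_mem_pow h2 (by norm_num)]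
    simp [cf_C, cf_C_mul, cf_X0, cf_X1]; ring

theorem linearIndependent_change {p u v : Fin 3 → ℂ} (h : LinearIndependent ℂ ![p, u, v])
    {a b c d : ℂ} (hdet : a * d - b * c = 1) :
    LinearIndependent ℂ ![p, a • u + b • v, c • u + d • v] := by
  rw [Fintype.linearIndependent_iff] at h ⊢
  intro g hg
  have := h ![g 0, g 1 * a + g 2 * c, g 1 * b + g 2 * d] (by
    rw [← hg]
    simp only [Fin.sum_univ_three, Matrix.cons_val]
    module)
  have h0 := this 0
  have h1 := this 1
  have h2 := this 2
  simp only [Matrix.cons_val] at h0 h1 h2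
  intro i
  fin_cases i
  · exact h0
  · change g 1 = 0
    linear_combination d * h1 - c * h2 - g 1 * hdet
  · change g 2 = 0
    linear_combination a * h2 - b * h1 - g 2 * hdet

theorem exists_linSubst_adapted {k : Germ} (h : cf 1 0 k ≠ 0 ∨ cf 0 1 k ≠ 0) :
    ∃ a b c d : ℂ, a * d - b * c = 1 ∧ cf 1 0 (linSubst a b c d k) = 0 ∧
      cf 0 1 (linSubst a b c d k) = 1 := by
  obtain ⟨c, d, hcd⟩ : ∃ c d : ℂ, c * cf 1 0 k + d * cf 0 1 k = 1 := by
    rcases h with h | h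
    · exact ⟨(cf 1 0 k)⁻¹, 0, by field_simp; ring⟩
    · exact ⟨0, (cf 0 1 k)⁻¹, by field_simp; ring⟩
  refine ⟨cf 0 1 k, -cf 1 0 k, c, d, by linear_combination hcd, ?_, ?_⟩
  · rw [(linSubst_cf _ _ _ _).2.1]; ring
  · rw [(linSubst_cf _ _ _ _).2.2, hcd]

theorem sq_mem_pow_of_cf_eq_zero {h : Germ} (h0 : h ∈ germIdeal) (h1 : cf 1 0 h = 0)
    (h2 : cf 0 1 h = 0) {k n : ℕ} (hn : n ≤ 2 * k) : h ^ k ∈ germIdeal ^ n := by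
  have := Ideal.pow_mem_pow (mem_sq_of_cf (mem_germIdeal_iff.mp h0) h1 h2) k
  rw [← pow_mul] at this
  exact Ideal.pow_le_pow_right hn this

/-- A chart at a point of type `A n` in which the double tangent is a coordinate axis. -/
theorem HasSingType.exists_chart_A {F : Form} {P : P2} {n : ℕ} (hn : 2 ≤ n)
    (hP : OnCurve F P) (h : HasSingType F P (.A n)) :
    ∃ u v : Fin 3 → ℂ, LinearIndependent ℂ ![P.rep, u, v] ∧
      (∃ k : Germ, cf 0 0 k = 0 ∧ cf 1 0 k = 0 ∧ cf 0 1 k = 1 ∧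
        localEq F P.rep u v - k ^ 2 ∈ germIdeal ^ (n + 1)) ∧
      ¬ SquareMod (n + 2) (localEq F P.rep u v) := by
  obtain ⟨u, v, hi, ⟨k, hk⟩, hns, hc⟩ := h.exists_A (by omega)
  have hk0 : cf 0 0 k = 0 := by
    have := cf_eq_of_sub_mem_pow hk (i := 0) (j := 0) (by omega)
    rw [cf_zero_localEq, show eval P.rep F = 0 from hP, pow_two, cf_mul] at this
    simpa using this.symm
  have hk1 : cf 1 0 k ≠ 0 ∨ cf 0 1 k ≠ 0 := by
    by_contra! h0
    apply hc
    have h3 := sq_mem_pow_of_cf_eq_zero (mem_germIdeal_iff.mpr hk0) h0.1 h0.2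
      (k := 2) (n := 3) (by norm_num)
    have := add_mem (Ideal.pow_le_pow_right (by omega : 3 ≤ n + 1) hk) h3
    rwa [sub_add_cancel] at this
  obtain ⟨a, b, c, d, hdet, e1, e2⟩ := exists_linSubst_adapted hk1
  have hm : ∀ a b c d : ℂ, ∀ f ∈ germIdeal, (linSubst a b c d).toRingHom f ∈ germIdeal :=
    fun a b c d f hf => algHom_mem _ hf
  refine ⟨a • u + b • v, c • u + d • v, linearIndependent_change hi hdet,
    ⟨linSubst a b c d k, ?_, e1, e2, ?_⟩, ?_⟩
  · rw [(linSubst_cf _ _ _ _).1, hk0]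
  · rw [← localEq_linSubst, ← map_pow, ← map_sub]
    exact map_mem_pow (hm a b c d) hk
  -- The property descends to the original chart through the inverse substitution, whose matrix is
  -- (d, -b; -c, a) because the determinant is 1.
  · intro hs
    apply hns
    have := hs.map (hm d (-b) (-c) a)
    have e : localEq F P.rep u v = localEq F P.rep
        (d • (a • u + b • v) + (-b) • (c • u + d • v))
        ((-c) • (a • u + b • v) + a • (c • u + d • v)) := by
      congr 1
      · rw [show d • (a • u + b • v) + (-b) • (c • u + d • v) = (a * d - b * c) • u by module,
          hdet, one_smul]
      · rw [show (-c) • (a • u + b • v) + a • (c • u + d • v) = (a * d - b * c) • v by module,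
          hdet, one_smul]
    rw [e, ← localEq_linSubst]
    exact this

/-- A chart at a point of type `E6` in which the triple tangent is a coordinate axis. -/
theorem HasSingType.exists_chart_E6 {F : Form} {P : P2} (h : HasSingType F P .E6) :
    ∃ u v : Fin 3 → ℂ, LinearIndependent ℂ ![P.rep, u, v] ∧
      ∃ w k : Germ, IsUnit w ∧ cf 0 0 k = 0 ∧ cf 1 0 k = 0 ∧ cf 0 1 k = 1 ∧
        localEq F P.rep u v - w * k ^ 3 ∈ germIdeal ^ 4 := by
  obtain ⟨u, v, hi, ⟨w, k, hw, hk0, hk⟩, hc⟩ := h.exists_E6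
  have hk1 : cf 1 0 k ≠ 0 ∨ cf 0 1 k ≠ 0 := by
    by_contra! h0
    apply hc
    have h3 := Ideal.mul_mem_left _ w
      (sq_mem_pow_of_cf_eq_zero hk0 h0.1 h0.2 (k := 3) (n := 4) (by norm_num))
    have := add_mem hk h3
    rwa [sub_add_cancel] at this
  obtain ⟨a, b, c, d, hdet, e1, e2⟩ := exists_linSubst_adapted hk1
  have hm : ∀ a b c d : ℂ, ∀ f ∈ germIdeal, (linSubst a b c d).toRingHom f ∈ germIdeal :=
    fun a b c d f hf => algHom_mem _ hf
  refine ⟨a • u + b • v, c • u + d • v, linearIndependent_change hi hdet,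
    linSubst a b c d w, linSubst a b c d k, hw.map _, ?_, e1, e2, ?_⟩
  · rw [(linSubst_cf _ _ _ _).1, mem_germIdeal_iff.mp hk0]
  · rw [← localEq_linSubst, ← map_pow, ← map_mul, ← map_sub]
    exact map_mem_pow (hm a b c d) hk

/-! ### Irreducible quartics contain no line -/

theorem IsIrredQuartic.not_dvd {F : Form} (hF : IsIrredQuartic F) {l : Form}
    (hl : l.IsHomogeneous 1) : ¬ l ∣ F := by
  rintro ⟨G, hG⟩
  have hl0 : ¬ IsUnit l := by
    intro h
    have := h.map (eval (0 : Fin 3 → ℂ))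
    rw [eval_linear hl] at this
    simp at this
  rcases hF.2.isUnit_or_isUnit hG with h | h
  · exact hl0 h
  · obtain ⟨c, hc⟩ := MvPolynomial.isUnit_iff_eq_C_of_isReduced.mp h
    have h1 : F.IsHomogeneous 1 := by
      rw [hG, hc.2, mul_comm]; exact hl.C_mul _
    have := hF.1.inj_right h1 hF.2.ne_zero
    omega

/-! ### Reduction to normal form: `E6` -/

/-- Modulo higher order, k is the coordinate y₁ (the second variable) and w is its constant term, so
the leading form of w·kⁿ is a multiple of y₁ⁿ. -/
theorem cf_of_sub_mem {f : Germ} {w k : Germ} (hk0 : cf 0 0 k = 0) (hk1 : cf 1 0 k = 0)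
    (hk2 : cf 0 1 k = 1) (n : ℕ) (h : f - w * k ^ n ∈ germIdeal ^ (n + 1)) :
    f - MvPowerSeries.C (cf 0 0 w) * MvPowerSeries.X 0 ^ 0 * MvPowerSeries.X 1 ^ n ∈
      germIdeal ^ (n + 1) := by
  have hk : k - MvPowerSeries.X 1 ∈ germIdeal ^ 2 := by
    apply mem_sq_of_cf <;> simp [hk0, hk1, hk2, cf_X1]
  have hkm : k ∈ germIdeal := mem_germIdeal_iff.mpr hk0
  have hw : w - MvPowerSeries.C (cf 0 0 w) ∈ germIdeal := by
    rw [mem_germIdeal_iff, map_sub, cf_C]; simp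
  have hp : k ^ n - MvPowerSeries.X 1 ^ n ∈ germIdeal ^ (n + 1) := by
    clear h
    induction n with
    | zero => simp
    | succ n ih =>
      have : k ^ (n + 1) - MvPowerSeries.X 1 ^ (n + 1) =
          (k ^ n - MvPowerSeries.X 1 ^ n) * k + MvPowerSeries.X 1 ^ n * (k - MvPowerSeries.X 1) := by
        ring
      rw [this]
      refine add_mem ?_ ?_
      · rw [pow_succ germIdeal]; exact Ideal.mul_mem_mul ih hkm
      · rw [show n + 1 + 1 = n + 2 by ring, pow_add]
        exact Ideal.mul_mem_mul (Ideal.pow_mem_pow X1_mem n) hk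
  have hX : (w - MvPowerSeries.C (cf 0 0 w)) * MvPowerSeries.X 1 ^ n ∈ germIdeal ^ (n + 1) := by
    rw [pow_succ']; exact Ideal.mul_mem_mul hw (Ideal.pow_mem_pow X1_mem n)
  have := add_mem (add_mem h (Ideal.mul_mem_left _ w hp)) hX
  convert this using 1
  ring

/-- With triple tangent z the quartic is c·x·z³ plus a binary quartic in y, z. Its y⁴-coefficient is
nonzero, since otherwise z would divide F. Completing the fourth power defines w, the y²z²-term
gives b, and what remains is a multiple of z³ absorbed into s. -/
theorem IsIrredQuartic.exists_nf_E6 {F : Form} (hF : IsIrredQuartic F) {P : P2}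
    (h : HasSingType F P .E6) : ∃ (D : NF) (s w z : Form), D.Is F s w z ∧ D.k = 0 ∧ D.l = 0 := by
  obtain ⟨u, v, hi, ω, k, hω, hk0, hk1, hk2, hk⟩ := h.exists_chart_E6
  have hk' := cf_of_sub_mem hk0 hk1 hk2 3 hk
  rw [isUnit_iff_cf] at hω
  set c := cf 0 0 ω
  obtain ⟨x, y, z, hf, -, -, -, a, ha, -, e⟩ := exists_chart hi hF.1
  have hc : ∀ i j, i + j < 4 → a i j = if i = 0 ∧ j = 3 then c else 0 := by
    intro i j hij
    rw [ha, cf_eq_of_sub_mem_pow hk' hij, cf_term]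
  rw [hc 0 0 (by norm_num), hc 1 0 (by norm_num), hc 0 1 (by norm_num), hc 2 0 (by norm_num),
    hc 1 1 (by norm_num), hc 0 2 (by norm_num), hc 3 0 (by norm_num), hc 2 1 (by norm_num),
    hc 1 2 (by norm_num), hc 0 3 (by norm_num)] at e
  norm_num at e
  have h4 : a 4 0 ≠ 0 := by
    intro h4
    refine hF.not_dvd hf.hz ⟨C c * x * z ^ 2 + C (a 3 1) * y ^ 3 + C (a 2 2) * y ^ 2 * z +
      C (a 1 3) * y * z ^ 2 + C (a 0 4) * z ^ 3, ?_⟩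
    rw [e, h4]; simp; ring
  obtain ⟨r, hr⟩ := IsAlgClosed.exists_pow_nat_eq (a 4 0) (n := 4) (by norm_num)
  have hr0 : r ≠ 0 := by rintro rfl; simp at hr; exact h4 hr.symm
  set t := a 3 1 / (4 * r ^ 3)
  have ht : 4 * r ^ 3 * t = a 3 1 := by simp only [t]; field_simp
  set b := (a 2 2 - 6 * r ^ 2 * t ^ 2) / r ^ 2
  have hb : b * r ^ 2 = a 2 2 - 6 * r ^ 2 * t ^ 2 := by simp only [b]; field_simp
  set m := a 1 3 - 4 * r * t ^ 3 - 2 * b * r * t with hm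
  set m' := a 0 4 - t ^ 4 - b * t ^ 2 with hm'
  refine ⟨⟨0, 0, b, 0⟩, C c * x + C m * y + C m' * z, C r * y + C t * z, z, ⟨⟨?_, ?_, hf.hz, ?_⟩, ?_⟩,
    rfl, rfl⟩
  · exact ((hf.hx.C_mul _).add (hf.hy.C_mul _)).add (hf.hz.C_mul _)
  · exact (hf.hy.C_mul _).add (hf.hz.C_mul _)
  · intro v h1 h2 h3
    simp only [map_add, map_mul, eval_C] at h1 h2
    have h2' : eval v y = 0 := by rw [h3] at h2; simpa [hr0] using h2
    have h1' : eval v x = 0 := by rw [h3, h2'] at h1; simpa [hω] using h1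
    exact hf.inj v h1' h2' h3
  · rw [e]
    simp only [NF.form, NF.conic, map_zero]
    rw [show a 1 3 = m + 4 * r * t ^ 3 + 2 * b * r * t by rw [hm]; ring,
      show a 0 4 = m' + t ^ 4 + b * t ^ 2 by rw [hm']; ring,
      show a 2 2 = b * r ^ 2 + 6 * r ^ 2 * t ^ 2 by rw [hb]; ring, ← ht, ← hr]
    simp only [map_add, map_mul, map_pow, map_ofNat]
    ring

/-! ### Reduction to normal form: `A5` -/

/-- Let Q be the squared factor; then Q = zε + αy² with ε a unit. Multiplying by ε³ and replacing zε
by Q - αy² gives Q²·(unit) + 3α²y⁴K·Q - α³y⁶K, where the last term lies in the seventh power and the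
rest is handled by completing the square. This rules out the degenerate case in the A₅ normal form.
-/
theorem squareMod_of_mul_cube {α β γ k₂ k₃ : ℂ} :
    SquareMod 7 ((MvPowerSeries.X 1 + MvPowerSeries.C α * MvPowerSeries.X 0 ^ 2 +
      MvPowerSeries.C β * MvPowerSeries.X 0 * MvPowerSeries.X 1 +
      MvPowerSeries.C γ * MvPowerSeries.X 1 ^ 2) ^ 2 + MvPowerSeries.X 1 ^ 3 *
      (MvPowerSeries.C k₂ * MvPowerSeries.X 0 + MvPowerSeries.C k₃ * MvPowerSeries.X 1) : Germ) := by
  set y : Germ := MvPowerSeries.X 0 with hy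
  set z : Germ := MvPowerSeries.X 1 with hz
  have hym : y ∈ germIdeal := X0_mem
  have hzm : z ∈ germIdeal := X1_mem
  set Q : Germ := z + MvPowerSeries.C α * y ^ 2 + MvPowerSeries.C β * y * z +
    MvPowerSeries.C γ * z ^ 2 with hQ
  set ε : Germ := 1 + MvPowerSeries.C β * y + MvPowerSeries.C γ * z with hε
  set K : Germ := MvPowerSeries.C k₂ * y + MvPowerSeries.C k₃ * z with hK
  have hεu : IsUnit ε := by
    rw [isUnit_iff_cf, hε]
    have : cf 0 0 (1 : Germ) = 1 := by simpa using cf_C 0 0 1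
    simp [hy, hz, cf_C_mul, cf_X0, cf_X1, this]
  have hKm : K ∈ germIdeal := add_mem (Ideal.mul_mem_left _ _ hym) (Ideal.mul_mem_left _ _ hzm)
  have hzQ : z * ε = Q - MvPowerSeries.C α * y ^ 2 := by rw [hQ, hε]; ring
  have hQm : Q ∈ germIdeal := by
    have : Q = z * ε + (MvPowerSeries.C α * y) * y := by rw [hzQ]; ring
    rw [this]
    exact add_mem (Ideal.mul_mem_right _ _ hzm) (Ideal.mul_mem_left _ _ hym)
  rw [← squareMod_unit_mul_iff (hεu.pow 3)]
  have key : ε ^ 3 * (Q ^ 2 + z ^ 3 * K) =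
      (Q ^ 2 * (ε ^ 3 + (Q - 3 * MvPowerSeries.C α * y ^ 2) * K) +
        Q * (3 * MvPowerSeries.C α ^ 2 * y ^ 4 * K)) - MvPowerSeries.C α ^ 3 * (y ^ 6 * K) := by
    linear_combination K * ((z * ε) ^ 2 + z * ε * (Q - MvPowerSeries.C α * y ^ 2) +
      (Q - MvPowerSeries.C α * y ^ 2) ^ 2) * hzQ
  have hu : IsUnit (ε ^ 3 + (Q - 3 * MvPowerSeries.C α * y ^ 2) * K) := by
    have h1 : (Q - 3 * MvPowerSeries.C α * y ^ 2) * K ∈ germIdeal := Ideal.mul_mem_left _ _ hKm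
    rw [isUnit_iff_cf, map_add, mem_germIdeal_iff.mp h1, add_zero, ← isUnit_iff_cf]
    exact hεu.pow 3
  have hsq : (3 * MvPowerSeries.C α ^ 2 * y ^ 4 * K) ^ 2 ∈ germIdeal ^ 7 := by
    have : (3 * MvPowerSeries.C α ^ 2 * y ^ 4 * K) ^ 2 =
      (9 * MvPowerSeries.C α ^ 4 * y * K ^ 2) * y ^ 7 := by ring
    rw [this]
    exact Ideal.mul_mem_left _ _ (Ideal.pow_mem_pow hym 7)
  obtain ⟨r, hr⟩ := squareMod_of_completed (x := Q) hu hsq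
  refine ⟨r, ?_⟩
  rw [key]
  have h7 : MvPowerSeries.C α ^ 3 * (y ^ 6 * K) ∈ germIdeal ^ 7 := by
    refine Ideal.mul_mem_left _ _ ?_
    rw [pow_succ]
    exact Ideal.mul_mem_mul (Ideal.pow_mem_pow hym 6) hKm
  have := sub_mem hr h7
  convert this using 1
  ring

/-- Up to order 5 the germ is a square k². This shapes the quartic as (xz + αy² + βyz + γz²)² +
z²(m₁y² + m₂yz + m₃z²). Here α ≠ 0 since z does not divide F, and m₁ ≠ 0 since the germ is not a
square modulo the seventh power. -/
theorem IsIrredQuartic.exists_nf_A5 {F : Form} (hF : IsIrredQuartic F) {P : P2}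
    (hP : OnCurve F P) (h : HasSingType F P (.A 5)) :
    ∃ (D : NF) (s w z : Form), D.Is F s w z ∧ D.k = 0 ∧ D.l * D.b = -1 ∧ eval P.rep z = 0 ∧
      eval P.rep w = 0 := by
  obtain ⟨u, v, hi, ⟨k, k0, k1, k2, hk⟩, hns⟩ := h.exists_chart_A (by norm_num) hP
  obtain ⟨x, y, z, hf, hp, hu, hv, a, ha, ha5, e⟩ := exists_chart hi hF.1
  have hc : ∀ i j, i + j < 6 → a i j = cf i j (k ^ 2) := by
    intro i j hij
    rw [ha, cf_eq_of_sub_mem_pow hk hij]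
  have c00 : a 0 0 = 0 := by
    rw [hc _ _ (by norm_num), pow_two, cf_mul]; simp [Finset.Nat.antidiagonal_succ, k0, k1, k2]
  have c10 : a 1 0 = 0 := by
    rw [hc _ _ (by norm_num), pow_two, cf_mul]; simp [Finset.Nat.antidiagonal_succ, k0, k1, k2]
  have c01 : a 0 1 = 0 := by
    rw [hc _ _ (by norm_num), pow_two, cf_mul]; simp [Finset.Nat.antidiagonal_succ, k0, k1, k2]
  have c20 : a 2 0 = 0 := by
    rw [hc _ _ (by norm_num), pow_two, cf_mul]; simp [Finset.Nat.antidiagonal_succ, k0, k1, k2]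
  have c11 : a 1 1 = 0 := by
    rw [hc _ _ (by norm_num), pow_two, cf_mul]; simp [Finset.Nat.antidiagonal_succ, k0, k1, k2]
  have c02 : a 0 2 = 1 := by
    rw [hc _ _ (by norm_num), pow_two, cf_mul]; simp [Finset.Nat.antidiagonal_succ, k0, k1, k2]
  have c30 : a 3 0 = 0 := by
    rw [hc _ _ (by norm_num), pow_two, cf_mul]; simp [Finset.Nat.antidiagonal_succ, k0, k1, k2]
  have c21 : a 2 1 = 2 * cf 2 0 k := by
    rw [hc _ _ (by norm_num), pow_two, cf_mul]; simp [Finset.Nat.antidiagonal_succ, k0, k1, k2]; ring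
  have c12 : a 1 2 = 2 * cf 1 1 k := by
    rw [hc _ _ (by norm_num), pow_two, cf_mul]; simp [Finset.Nat.antidiagonal_succ, k0, k1, k2]; ring
  have c03 : a 0 3 = 2 * cf 0 2 k := by
    rw [hc _ _ (by norm_num), pow_two, cf_mul]; simp [Finset.Nat.antidiagonal_succ, k0, k1, k2]; ring
  have c40 : a 4 0 = cf 2 0 k ^ 2 := by
    rw [hc _ _ (by norm_num), pow_two, cf_mul]; simp [Finset.Nat.antidiagonal_succ, k0, k1, k2]; ring
  have c31 : a 3 1 = 2 * cf 2 0 k * cf 1 1 k + 2 * cf 3 0 k := by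
    rw [hc _ _ (by norm_num), pow_two, cf_mul]; simp [Finset.Nat.antidiagonal_succ, k0, k1, k2]; ring
  have c22 : a 2 2 = cf 1 1 k ^ 2 + 2 * cf 2 0 k * cf 0 2 k + 2 * cf 2 1 k := by
    rw [hc _ _ (by norm_num), pow_two, cf_mul]; simp [Finset.Nat.antidiagonal_succ, k0, k1, k2]; ring
  have c13 : a 1 3 = 2 * cf 1 1 k * cf 0 2 k + 2 * cf 1 2 k := by
    rw [hc _ _ (by norm_num), pow_two, cf_mul]; simp [Finset.Nat.antidiagonal_succ, k0, k1, k2]; ring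
  have c04 : a 0 4 = cf 0 2 k ^ 2 + 2 * cf 0 3 k := by
    rw [hc _ _ (by norm_num), pow_two, cf_mul]; simp [Finset.Nat.antidiagonal_succ, k0, k1, k2]; ring
  -- The congruence with k² reaches degree 5, where a quartic has no terms; this kills the
  -- y³-coefficient of k.
  have c50 : 0 = 2 * cf 2 0 k * cf 3 0 k := by
    rw [← ha5 5 0 (by norm_num), hc _ _ (by norm_num), pow_two, cf_mul]
    simp [Finset.Nat.antidiagonal_succ, k0, k1, k2]; ring
  set α := cf 2 0 k
  set β := cf 1 1 k
  set γ := cf 0 2 k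
  set m₁ := 2 * cf 2 1 k
  set m₂ := 2 * cf 1 2 k
  set m₃ := 2 * cf 0 3 k
  have hα : α ≠ 0 := by
    intro h0
    refine hF.not_dvd hf.hz ⟨C (a 0 2) * x ^ 2 * z + x * (C (a 2 1) * y ^ 2 + C (a 1 2) * y * z +
      C (a 0 3) * z ^ 2) + C (a 3 1) * y ^ 3 + C (a 2 2) * y ^ 2 * z +
      C (a 1 3) * y * z ^ 2 + C (a 0 4) * z ^ 3, ?_⟩
    rw [h0] at c40
    rw [e, c00, c10, c01, c20, c11, c30, c40]; simp; ring
  have h30 : cf 3 0 k = 0 := by simpa [hα] using c50.symm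
  have e' : F = (x * z + C α * y ^ 2 + C β * y * z + C γ * z ^ 2) ^ 2 +
      z ^ 2 * (C m₁ * y ^ 2 + C m₂ * y * z + C m₃ * z ^ 2) := by
    rw [e, c00, c10, c01, c20, c11, c02, c30, c21, c12, c03, c40, c31, c22, c13, c04, h30]
    simp only [map_add, map_mul, map_pow, map_ofNat, map_zero, map_one]
    ring
  have lx : localEq x P.rep u v = 1 := by rw [localEq_linear hf.hx]; simp [hp, hu, hv]
  have ly : localEq y P.rep u v = MvPowerSeries.X 0 := by
    rw [localEq_linear hf.hy]; simp [hp, hu, hv]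
  have lz : localEq z P.rep u v = MvPowerSeries.X 1 := by
    rw [localEq_linear hf.hz]; simp [hp, hu, hv]
  have hm₁ : m₁ ≠ 0 := by
    intro h0
    apply hns
    have := squareMod_of_mul_cube (α := α) (β := β) (γ := γ) (k₂ := m₂) (k₃ := m₃)
    rw [e', h0]
    simp only [localEq_add, localEq_mul, localEq_pow, localEq_C, lx, ly, lz]
    convert this using 1
    simp only [map_zero]
    ring
  obtain ⟨r, hr⟩ := IsAlgClosed.exists_pow_nat_eq α (n := 2) (by norm_num)
  have hr0 : r ≠ 0 := by rintro rfl; simp at hr; exact hα hr.symm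
  set t := m₂ / (2 * m₁)
  have ht : 2 * m₁ * t = m₂ := by simp only [t]; field_simp
  set b := m₁ / α
  have hb0 : b ≠ 0 := div_ne_zero hm₁ hα
  have hb : b * α = m₁ := by simp only [b]; field_simp
  -- Completing the square in y turns m₁y² + m₂yz into a multiple of w² plus a term in z². With l =
  -- -1/b and s = -b(x + ny + n'z), the term l·s·z supplies the missing xz + nyz + n'z² of q, while
  -- s·z³ cancels it from b·q·z².
  set n := β - 2 * α * t with hn
  set n' := γ - α * t ^ 2 with hn'
  set e₀ := m₃ - m₁ * t ^ 2 with he₀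
  refine ⟨⟨0, -1 / b, b, e₀⟩, C (-b) * (x + C n * y + C n' * z), C r * (y + C t * z), z,
    ⟨⟨?_, ?_, hf.hz, ?_⟩, ?_⟩, rfl, ?_, hp.2.2, ?_⟩
  · exact ((hf.hx.add (hf.hy.C_mul _)).add (hf.hz.C_mul _)).C_mul _
  · exact (hf.hy.add (hf.hz.C_mul _)).C_mul _
  · intro v h1 h2 h3
    simp only [map_add, map_mul, eval_C] at h1 h2
    have h2' : eval v y = 0 := by rw [h3] at h2; simpa [hr0] using h2
    have h1' : eval v x = 0 := by rw [h3, h2'] at h1; simpa [hb0] using h1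
    exact hf.inj v h1' h2' h3
  · rw [e']
    have hbl : (C (-1 / b) : Form) * C (-b) = 1 := by
      rw [← C_mul, show -1 / b * -b = 1 by field_simp, C_1]
    have hconic : NF.conic ⟨0, -1 / b, b, e₀⟩ (C (-b) * (x + C n * y + C n' * z))
        (C r * (y + C t * z)) z = x * z + C α * y ^ 2 + C β * y * z + C γ * z ^ 2 := by
      simp only [NF.conic]
      rw [hn, hn', ← hr]
      simp only [map_add, map_mul, map_pow, map_ofNat, map_zero, map_sub]
      linear_combination (x + (C β - 2 * C r ^ 2 * C t) * y + (C γ - C r ^ 2 * C t ^ 2) * z) * z * hbl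
    simp only [NF.form]
    rw [hconic, he₀, ← ht, ← hb, hn, hn']
    simp only [map_add, map_mul, map_pow, map_ofNat, map_zero, map_neg, map_sub]
    ring
  · change -1 / b * b = -1
    field_simp
  · rw [map_mul, map_add, map_mul, hp.2.1, hp.2.2]; simp

/-! ### Reduction to normal form: two `A2` -/

/-- The cuspidal tangent of a point of type `A2`. -/
theorem HasSingType.exists_cuspTangent {F : Form} (hF : F.IsHomogeneous 4) {P : P2}
    (hP : OnCurve F P) (h : HasSingType F P (.A 2)) :
    ∃ l : Form, l.IsHomogeneous 1 ∧ eval P.rep l = 0 ∧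
      (∀ u v, localEq F P.rep u v - localEq l P.rep u v ^ 2 ∈ germIdeal ^ 3) ∧
      ∃ u v, ¬ SquareMod 4 (localEq F P.rep u v) := by
  obtain ⟨u, v, hi, ⟨k, k0, k1, k2, hk⟩, hns⟩ := h.exists_chart_A le_rfl hP
  have hk' := cf_of_sub_mem (w := 1) k0 k1 k2 2 (by simpa using hk)
  have h1 : cf 0 0 (1 : Germ) = 1 := by simpa using cf_C 0 0 1
  obtain ⟨x, y, z, hf, hp, hu, hv, a, ha, -, e⟩ := exists_chart hi hF
  have hc : ∀ i j, i + j < 3 → a i j = if i = 0 ∧ j = 2 then 1 else 0 := by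
    intro i j hij
    rw [ha, cf_eq_of_sub_mem_pow hk' hij, cf_term, h1]
  rw [hc 0 0 (by norm_num), hc 1 0 (by norm_num), hc 0 1 (by norm_num), hc 2 0 (by norm_num),
    hc 1 1 (by norm_num), hc 0 2 (by norm_num)] at e
  norm_num at e
  refine ⟨z, hf.hz, hp.2.2, ?_, u, v, hns⟩
  intro u' v'
  have hx : localEq x P.rep u' v' - 1 ∈ germIdeal := by
    rw [mem_germIdeal_iff, map_sub, cf_zero_localEq, hp.1, h1, sub_self]
  have hy : localEq y P.rep u' v' ∈ germIdeal := localEq_mem_iff.mpr hp.2.1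
  have hz : localEq z P.rep u' v' ∈ germIdeal := localEq_mem_iff.mpr hp.2.2
  rw [e]
  simp only [localEq_add, localEq_mul, localEq_pow, localEq_C]
  set X := localEq x P.rep u' v'
  set Y := localEq y P.rep u' v'
  set Z := localEq z P.rep u' v'
  have m3 : ∀ {f g h : Germ}, f ∈ germIdeal → g ∈ germIdeal → h ∈ germIdeal →
      f * g * h ∈ germIdeal ^ 3 := by
    intro f g h hf hg hh
    rw [pow_succ, pow_two]
    exact Ideal.mul_mem_mul (Ideal.mul_mem_mul hf hg) hh
  have : X ^ 2 * Z ^ 2 + X * (MvPowerSeries.C (a 3 0) * Y ^ 3 + MvPowerSeries.C (a 2 1) * Y ^ 2 * Z +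
      MvPowerSeries.C (a 1 2) * Y * Z ^ 2 + MvPowerSeries.C (a 0 3) * Z ^ 3) +
      (MvPowerSeries.C (a 4 0) * Y ^ 4 + MvPowerSeries.C (a 3 1) * Y ^ 3 * Z +
        MvPowerSeries.C (a 2 2) * Y ^ 2 * Z ^ 2 +
        MvPowerSeries.C (a 1 3) * Y * Z ^ 3 + MvPowerSeries.C (a 0 4) * Z ^ 4) - Z ^ 2 =
      (X + 1) * ((X - 1) * Z * Z) +
      (X * MvPowerSeries.C (a 3 0) + MvPowerSeries.C (a 4 0) * Y + MvPowerSeries.C (a 3 1) * Z) * (Y * Y * Y) +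
      (X * MvPowerSeries.C (a 2 1) + MvPowerSeries.C (a 2 2) * Z) * (Y * Y * Z) +
      (X * MvPowerSeries.C (a 1 2) + MvPowerSeries.C (a 1 3) * Z) * (Y * Z * Z) +
      (X * MvPowerSeries.C (a 0 3) + MvPowerSeries.C (a 0 4) * Z) * (Z * Z * Z) := by ring
  rw [this]
  exact add_mem (add_mem (add_mem (add_mem (Ideal.mul_mem_left _ _ (m3 hx hz hz))
    (Ideal.mul_mem_left _ _ (m3 hy hy hy))) (Ideal.mul_mem_left _ _ (m3 hy hy hz)))
    (Ideal.mul_mem_left _ _ (m3 hy hz hz))) (Ideal.mul_mem_left _ _ (m3 hz hz hz))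

theorem cf_of_cuspTangent {F l : Form} {p u v : Fin 3 → ℂ} (hl : l.IsHomogeneous 1)
    (hp : eval p l = 0) (h : localEq F p u v - localEq l p u v ^ 2 ∈ germIdeal ^ 3) :
    cf 0 0 (localEq F p u v) = 0 ∧ cf 1 0 (localEq F p u v) = 0 ∧ cf 0 1 (localEq F p u v) = 0 ∧
    cf 2 0 (localEq F p u v) = eval u l ^ 2 ∧
    cf 1 1 (localEq F p u v) = 2 * eval u l * eval v l ∧
    cf 0 2 (localEq F p u v) = eval v l ^ 2 := by
  have e : localEq l p u v ^ 2 =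
      MvPowerSeries.C (eval u l ^ 2) * MvPowerSeries.X 0 ^ 2 * MvPowerSeries.X 1 ^ 0 +
      MvPowerSeries.C (2 * eval u l * eval v l) * MvPowerSeries.X 0 ^ 1 * MvPowerSeries.X 1 ^ 1 +
      MvPowerSeries.C (eval v l ^ 2) * MvPowerSeries.X 0 ^ 0 * MvPowerSeries.X 1 ^ 2 := by
    rw [localEq_linear hl, hp]
    simp only [map_zero, map_mul, map_pow, map_ofNat]
    ring
  rw [e] at h
  refine ⟨?_, ?_, ?_, ?_, ?_, ?_⟩ <;>
  · rw [cf_eq_of_sub_mem_pow h (by norm_num)]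
    simp only [map_add, cf_term]
    norm_num

/-- The expansion made at one coordinate point is read again at the second one, so that conditions
at two singular points become conditions on the same coefficients. -/
theorem cf_localEq_swap {p q r : Fin 3 → ℂ} {x y z F : Form} (hf : IsFrame x y z)
    (hp : eval p x = 1 ∧ eval p y = 0 ∧ eval p z = 0)
    (hq : eval q x = 0 ∧ eval q y = 1 ∧ eval q z = 0)
    (hr : eval r x = 0 ∧ eval r y = 0 ∧ eval r z = 1) {a : ℕ → ℕ → ℂ}
    (e : F = C (a 0 0) * x ^ 4 + x ^ 3 * (C (a 1 0) * y + C (a 0 1) * z) +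
      x ^ 2 * (C (a 2 0) * y ^ 2 + C (a 1 1) * y * z + C (a 0 2) * z ^ 2) +
      x * (C (a 3 0) * y ^ 3 + C (a 2 1) * y ^ 2 * z + C (a 1 2) * y * z ^ 2 + C (a 0 3) * z ^ 3) +
      (C (a 4 0) * y ^ 4 + C (a 3 1) * y ^ 3 * z + C (a 2 2) * y ^ 2 * z ^ 2 +
        C (a 1 3) * y * z ^ 3 + C (a 0 4) * z ^ 4)) :
    cf 0 0 (localEq F q p r) = a 4 0 ∧ cf 1 0 (localEq F q p r) = a 3 0 ∧
    cf 0 1 (localEq F q p r) = a 3 1 ∧ cf 1 1 (localEq F q p r) = a 2 1 ∧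
    cf 0 2 (localEq F q p r) = a 2 2 := by
  have lx : localEq x q p r = MvPowerSeries.X 0 := by rw [localEq_linear hf.hx]; simp [hp, hq, hr]
  have ly : localEq y q p r = 1 := by rw [localEq_linear hf.hy]; simp [hp, hq, hr]
  have lz : localEq z q p r = MvPowerSeries.X 1 := by rw [localEq_linear hf.hz]; simp [hp, hq, hr]
  have e' : localEq F q p r =
      MvPowerSeries.C (a 0 0) * MvPowerSeries.X 0 ^ 4 * MvPowerSeries.X 1 ^ 0 +
      MvPowerSeries.C (a 1 0) * MvPowerSeries.X 0 ^ 3 * MvPowerSeries.X 1 ^ 0 +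
      MvPowerSeries.C (a 0 1) * MvPowerSeries.X 0 ^ 3 * MvPowerSeries.X 1 ^ 1 +
      MvPowerSeries.C (a 2 0) * MvPowerSeries.X 0 ^ 2 * MvPowerSeries.X 1 ^ 0 +
      MvPowerSeries.C (a 1 1) * MvPowerSeries.X 0 ^ 2 * MvPowerSeries.X 1 ^ 1 +
      MvPowerSeries.C (a 0 2) * MvPowerSeries.X 0 ^ 2 * MvPowerSeries.X 1 ^ 2 +
      MvPowerSeries.C (a 3 0) * MvPowerSeries.X 0 ^ 1 * MvPowerSeries.X 1 ^ 0 +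
      MvPowerSeries.C (a 2 1) * MvPowerSeries.X 0 ^ 1 * MvPowerSeries.X 1 ^ 1 +
      MvPowerSeries.C (a 1 2) * MvPowerSeries.X 0 ^ 1 * MvPowerSeries.X 1 ^ 2 +
      MvPowerSeries.C (a 0 3) * MvPowerSeries.X 0 ^ 1 * MvPowerSeries.X 1 ^ 3 +
      MvPowerSeries.C (a 4 0) * MvPowerSeries.X 0 ^ 0 * MvPowerSeries.X 1 ^ 0 +
      MvPowerSeries.C (a 3 1) * MvPowerSeries.X 0 ^ 0 * MvPowerSeries.X 1 ^ 1 +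
      MvPowerSeries.C (a 2 2) * MvPowerSeries.X 0 ^ 0 * MvPowerSeries.X 1 ^ 2 +
      MvPowerSeries.C (a 1 3) * MvPowerSeries.X 0 ^ 0 * MvPowerSeries.X 1 ^ 3 +
      MvPowerSeries.C (a 0 4) * MvPowerSeries.X 0 ^ 0 * MvPowerSeries.X 1 ^ 4 := by
    rw [e]
    simp only [localEq_add, localEq_mul, localEq_pow, localEq_C, lx, ly, lz]
    ring
  rw [e']
  simp only [map_add, cf_term]
  norm_num

theorem rep_comb_eq_zero {P Q : P2} (h : P ≠ Q) {α β : ℂ} (h0 : α • P.rep + β • Q.rep = 0) :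
    α = 0 ∧ β = 0 := by
  have hα : α = 0 := by
    by_contra hα
    apply h
    apply eq_of_rep_eq_smul (a := -β / α)
    have : α • P.rep = (-β) • Q.rep := by rw [neg_smul]; exact eq_neg_of_add_eq_zero_left h0
    rw [div_eq_inv_mul, mul_smul, ← this, smul_smul, inv_mul_cancel₀ hα, one_smul]
  refine ⟨hα, ?_⟩
  rw [hα, zero_smul, zero_add, smul_eq_zero] at h0
  exact h0.resolve_right Q.rep_nonzero

theorem linearIndependent_rep {P Q : P2} (h : P ≠ Q) : LinearIndependent ℂ ![P.rep, Q.rep] := by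
  rw [LinearIndependent.pair_iff]
  intro s t hst
  exact rep_comb_eq_zero h hst

theorem exists_linearIndependent_third {p q : Fin 3 → ℂ} (h : LinearIndependent ℂ ![p, q]) :
    ∃ r, LinearIndependent ℂ ![p, q, r] := by
  obtain ⟨r, hr⟩ := exists_linearIndependent_snoc_of_lt_finrank h (by simp)
  refine ⟨r, ?_⟩
  have : (Fin.snoc ![p, q] r : Fin 3 → Fin 3 → ℂ) = ![p, q, r] := by
    ext i j
    fin_cases i <;> rfl
  rw [← this]
  exact hr

/-- The cuspidal tangent at one cusp does not pass through the other. -/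
theorem IsIrredQuartic.cuspTangent_ne_zero {F : Form} (hF : IsIrredQuartic F) {P Q : P2}
    (hPQ : P ≠ Q) {l m : Form} (hl : l.IsHomogeneous 1) (hlP : eval P.rep l = 0)
    (hP : ∀ u v, localEq F P.rep u v - localEq l P.rep u v ^ 2 ∈ germIdeal ^ 3)
    (hm : m.IsHomogeneous 1) (hmQ : eval Q.rep m = 0)
    (hQ : ∀ u v, localEq F Q.rep u v - localEq m Q.rep u v ^ 2 ∈ germIdeal ^ 3) :
    eval Q.rep l ≠ 0 := by
  intro h0
  obtain ⟨r, hr'⟩ := exists_linearIndependent_third (linearIndependent_rep hPQ)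
  obtain ⟨x, y, z, hf, hp, hq, hr, a, ha, -, e⟩ := exists_chart hr' hF.1
  obtain ⟨p0, p1, -, p2, -, -⟩ := cf_of_cuspTangent hl hlP (hP Q.rep r)
  rw [← ha] at p0 p1 p2
  obtain ⟨q0, q1, -, -, -, -⟩ := cf_of_cuspTangent hm hmQ (hQ P.rep r)
  obtain ⟨s0, s1, -, -, -⟩ := cf_localEq_swap hf hp hq hr e
  rw [s0] at q0
  rw [s1] at q1
  -- A cuspidal tangent through the other cusp would be the line z = 0 joining them. The two cusps
  -- kill every monomial in x, y alone, so z would divide F.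
  refine hF.not_dvd hf.hz ⟨C (a 0 1) * x ^ 3 + x ^ 2 * (C (a 1 1) * y + C (a 0 2) * z) +
      x * (C (a 2 1) * y ^ 2 + C (a 1 2) * y * z +
      C (a 0 3) * z ^ 2) + C (a 3 1) * y ^ 3 + C (a 2 2) * y ^ 2 * z +
      C (a 1 3) * y * z ^ 2 + C (a 0 4) * z ^ 3, ?_⟩
  rw [e, p0, p1, p2, q0, q1, h0]
  simp
  ring

theorem exists_ne_zero_of_two_linear {l m : Form} (hl : l.IsHomogeneous 1)
    (hm : m.IsHomogeneous 1) : ∃ r : Fin 3 → ℂ, r ≠ 0 ∧ eval r l = 0 ∧ eval r m = 0 := by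
  let f : (Fin 3 → ℂ) →ₗ[ℂ] (Fin 2 → ℂ) :=
    { toFun := fun v => ![eval v l, eval v m]
      map_add' := by
        intro v w
        ext i; fin_cases i <;> simp [eval_linear_add, hl, hm]
      map_smul' := by
        intro c v
        ext i; fin_cases i <;> simp [eval_linear_smul, hl, hm] }
  have := LinearMap.ker_ne_bot_of_finrank_lt (f := f) (by simp)
  obtain ⟨r, hr, h0⟩ := (Submodule.ne_bot_iff _).mp this
  refine ⟨r, h0, ?_, ?_⟩
  · exact congrFun (LinearMap.mem_ker.mp hr) 0
  · exact congrFun (LinearMap.mem_ker.mp hr) 1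

/-- Without the term in x·z³ the germ is quadratic in y with unit leading coefficient, linear term
in z²·y and constant term in z⁴; completing the square leaves an error of order 4. A cusp is not a
square modulo the fourth power, so that term must be present. -/
theorem squareMod_of_tacnodal {x y z : Form} {p u v : Fin 3 → ℂ} (hx : eval p x ≠ 0)
    (hy : eval p y = 0) (hz : eval p z = 0) {a b d e : ℂ} (ha : a ≠ 0) :
    SquareMod 4 (localEq (C a * x ^ 2 * y ^ 2 + C b * x * y * z ^ 2 + C d * y * z ^ 3 +
      C e * z ^ 4) p u v) := by
  have hx' : IsUnit (localEq x p u v) := isUnit_localEq_iff.mpr hx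
  have hy' := (localEq_mem_iff (u := u) (v := v)).mpr hy
  have hz' := (localEq_mem_iff (u := u) (v := v)).mpr hz
  simp only [localEq_add, localEq_mul, localEq_pow, localEq_C]
  set X := localEq x p u v
  set Y := localEq y p u v
  set Z := localEq z p u v
  have hA : IsUnit (MvPowerSeries.C a * X ^ 2) :=
    ((isUnit_iff_ne_zero.mpr ha).map (MvPowerSeries.C (σ := Fin 2) (R := ℂ))).mul (hx'.pow 2)
  have hy2 : (MvPowerSeries.C b * X * Z ^ 2 + MvPowerSeries.C d * Z ^ 3) ^ 2 ∈ germIdeal ^ 4 := by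
    have : (MvPowerSeries.C b * X * Z ^ 2 + MvPowerSeries.C d * Z ^ 3) ^ 2 =
      (MvPowerSeries.C b * X + MvPowerSeries.C d * Z) ^ 2 * Z ^ 4 := by ring
    rw [this]
    exact Ideal.mul_mem_left _ _ (Ideal.pow_mem_pow hz' 4)
  obtain ⟨r, hr⟩ := squareMod_of_completed (x := Y) hA hy2
  refine ⟨r, ?_⟩
  have := add_mem hr (Ideal.mul_mem_left _ (MvPowerSeries.C e) (Ideal.pow_mem_pow hz' 4))
  convert this using 1
  ring

/-- An irreducible quartic with two cusps, in coordinates given by the cuspidal tangents. -/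
theorem IsIrredQuartic.exists_frame_cusps {F : Form} (hF : IsIrredQuartic F) {P Q : P2}
    (hPQ : P ≠ Q) (hP : OnCurve F P) (hQ : OnCurve F Q) (tP : HasSingType F P (.A 2))
    (tQ : HasSingType F Q (.A 2)) : ∃ x y z : Form, IsFrame x y z ∧
      (eval P.rep y = 0 ∧ eval P.rep z = 0) ∧ (eval Q.rep x = 0 ∧ eval Q.rep z = 0) ∧
      ∃ a b c d e : ℂ, a ≠ 0 ∧ c ≠ 0 ∧ d ≠ 0 ∧ F = C a * x ^ 2 * y ^ 2 + C b * x * y * z ^ 2 +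
        C c * x * z ^ 3 + C d * y * z ^ 3 + C e * z ^ 4 := by
  obtain ⟨l, hl, hlP, jP, u₁, v₁, n₁⟩ := tP.exists_cuspTangent hF.1 hP
  obtain ⟨m, hm, hmQ, jQ, u₂, v₂, n₂⟩ := tQ.exists_cuspTangent hF.1 hQ
  have hlQ := hF.cuspTangent_ne_zero hPQ hl hlP jP hm hmQ jQ
  have hmP := hF.cuspTangent_ne_zero hPQ.symm hm hmQ jQ hl hlP jP
  -- The third vertex of the coordinate triangle is the point where the two cuspidal tangents meet;
  -- this removes the mixed terms at both cusps.
  obtain ⟨r, hr0, hrl, hrm⟩ := exists_ne_zero_of_two_linear hl hm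
  have hi : LinearIndependent ℂ ![P.rep, Q.rep, r] := by
    rw [Fintype.linearIndependent_iff]
    intro g hg
    simp only [Fin.sum_univ_three, Matrix.cons_val] at hg
    have ev : ∀ {f : Form}, f.IsHomogeneous 1 →
        g 0 * eval P.rep f + g 1 * eval Q.rep f + g 2 * eval r f = 0 := by
      intro f hf
      have := congrArg (fun v => eval v f) hg
      simp only [eval_linear_add hf, eval_linear_smul hf] at this
      rw [this, eval_linear hf]; simp
    have g1 : g 1 = 0 := by
      have := ev hl
      rw [hlP, hrl] at this
      simpa [hlQ] using this
    have g0 : g 0 = 0 := by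
      have := ev hm
      rw [hmQ, hrm] at this
      simpa [hmP] using this
    have g2 : g 2 = 0 := by
      rw [g0, g1] at hg
      simpa [hr0] using hg
    intro i
    fin_cases i <;> assumption
  obtain ⟨x, y, z, hf, hp, hq, hr, a, ha, -, e⟩ := exists_chart hi hF.1
  obtain ⟨p0, p1, p2, p3, p4, p5⟩ := cf_of_cuspTangent hl hlP (jP Q.rep r)
  rw [← ha] at p0 p1 p2 p3 p4 p5
  obtain ⟨q0, q1, q2, q3, q4, q5⟩ := cf_of_cuspTangent hm hmQ (jQ P.rep r)
  obtain ⟨s0, s1, s2, s3, s4⟩ := cf_localEq_swap hf hp hq hr e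
  rw [s0] at q0
  rw [s1] at q1
  rw [s2] at q2
  rw [s3, hrm, mul_zero] at q4
  rw [s4, hrm] at q5
  rw [hrl, mul_zero] at p4
  rw [hrl] at p5
  have e' : F = C (a 2 0) * x ^ 2 * y ^ 2 + C (a 1 2) * x * y * z ^ 2 +
        C (a 0 3) * x * z ^ 3 + C (a 1 3) * y * z ^ 3 + C (a 0 4) * z ^ 4 := by
    rw [e, p0, p1, p2, p4, p5, q0, q1, q2, q4, q5]
    simp
    ring
  have h20 : a 2 0 ≠ 0 := by rw [p3]; exact pow_ne_zero 2 hlQ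
  refine ⟨x, y, z, hf, hp.2, ⟨hq.1, hq.2.2⟩, a 2 0, a 1 2, a 0 3, a 1 3, a 0 4, h20, ?_, ?_, e'⟩
  · intro h0
    apply n₁
    have := squareMod_of_tacnodal (x := x) (u := u₁) (v := v₁) (b := a 1 2) (d := a 1 3)
      (e := a 0 4) (by rw [hp.1]; exact one_ne_zero) hp.2.1 hp.2.2 h20
    convert this using 2
    rw [e', h0]; simp
  · intro h0
    apply n₂
    have := squareMod_of_tacnodal (x := y) (y := x) (u := u₂) (v := v₂) (b := a 1 2) (d := a 0 3)
      (e := a 0 4) (by rw [hq.2.1]; exact one_ne_zero) hq.1 hq.2.2 h20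
    convert this using 2
    rw [e', h0]; simp; ring

theorem IsIrredQuartic.exists_nf_cusps {F : Form} (hF : IsIrredQuartic F) {P Q : P2}
    (hPQ : P ≠ Q) (hP : OnCurve F P) (hQ : OnCurve F Q) (tP : HasSingType F P (.A 2))
    (tQ : HasSingType F Q (.A 2)) : ∃ (D : NF) (s w z : Form), D.Is F s w z ∧ D.k ≠ 0 ∧ D.l = 0 ∧
      eval P.rep z = 0 ∧ eval Q.rep z = 0 ∧
      ∀ N, OnCurve F N → eval N.rep z = 0 → N = P ∨ N = Q := by
  obtain ⟨x, y, z, hf, hp, hq, a, b, c, d, e, ha, hc, hd, hFe⟩ :=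
    hF.exists_frame_cusps hPQ hP hQ tP tQ
  obtain ⟨r, hr⟩ := IsAlgClosed.exists_pow_nat_eq a (n := 2) (by norm_num)
  have hr0 : r ≠ 0 := by rintro rfl; simp at hr; exact ha hr.symm
  -- With s = cx + dy and w = η(cx - dy) one has w² - η²s² = -4cdη²·xy. The choice of η makes this
  -- r·xy with r² = a, so q² is the term a·x²y² and k = -η².
  obtain ⟨η, hη⟩ := IsAlgClosed.exists_pow_nat_eq (-1 / (4 * (c / r) * d)) (n := 2) (by norm_num)
  have hη' : -4 * c * d * η ^ 2 = r := by rw [hη]; field_simp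
  have hη0 : η ≠ 0 := by rintro rfl; simp at hη'; exact hr0 hη'.symm
  have hxP : eval P.rep x ≠ 0 := fun h => P.rep_nonzero (hf.inj _ h hp.1 hp.2)
  have hyQ : eval Q.rep y ≠ 0 := fun h => Q.rep_nonzero (hf.inj _ hq.1 h hq.2)
  refine ⟨⟨-η ^ 2, 0, b / r, e⟩, C c * x + C d * y, C η * (C c * x - C d * y), z,
    ⟨⟨?_, ?_, hf.hz, ?_⟩, ?_⟩, ?_, rfl, hp.2, hq.2, ?_⟩
  · exact (hf.hx.C_mul _).add (hf.hy.C_mul _)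
  · exact ((hf.hx.C_mul _).sub (hf.hy.C_mul _)).C_mul _
  · intro v h1 h2 h3
    simp only [map_add, map_mul, map_sub, eval_C] at h1 h2
    have h2' : c * eval v x - d * eval v y = 0 := (mul_eq_zero.mp h2).resolve_left hη0
    have h4 : eval v x = 0 := by
      have : c * eval v x = 0 := by linear_combination (h1 + h2') / 2
      exact (mul_eq_zero.mp this).resolve_left hc
    have h5 : eval v y = 0 := by
      have : d * eval v y = 0 := by linear_combination (h1 - h2') / 2
      exact (mul_eq_zero.mp this).resolve_left hd
    exact hf.inj v h4 h5 h3
  · have hconic : NF.conic ⟨-η ^ 2, 0, b / r, e⟩ (C c * x + C d * y) (C η * (C c * x - C d * y)) z =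
        C r * x * y := by
      rw [← hη']
      simp only [NF.conic, map_mul, map_neg, map_pow, map_ofNat, map_zero]
      ring
    have hb : (C b : Form) = C (b / r) * C r := by rw [← C_mul, div_mul_cancel₀ _ hr0]
    rw [NF.form, hconic, hFe, hb, ← hr, map_pow]
    ring
  · exact neg_ne_zero.mpr (pow_ne_zero 2 hη0)
  · intro N hN hz
    have h0 : a * eval N.rep x ^ 2 * eval N.rep y ^ 2 = 0 := by
      have : eval N.rep F = 0 := hN
      rw [hFe] at this
      simpa [hz] using this
    have h1 : eval N.rep x = 0 ∨ eval N.rep y = 0 := by simpa [ha] using h0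
    rcases h1 with h | h
    · right
      apply eq_of_rep_eq_smul (a := eval N.rep y / eval Q.rep y)
      apply hf.ext_vec
      · rw [eval_linear_smul hf.hx, hq.1, h, mul_zero]
      · rw [eval_linear_smul hf.hy]; field_simp
      · rw [eval_linear_smul hf.hz, hq.2, hz, mul_zero]
    · left
      apply eq_of_rep_eq_smul (a := eval N.rep x / eval P.rep x)
      apply hf.ext_vec
      · rw [eval_linear_smul hf.hx]; field_simp
      · rw [eval_linear_smul hf.hy, hp.1, h, mul_zero]
      · rw [eval_linear_smul hf.hz, hp.2, hz, mul_zero]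

/-! ### From a configuration to its points. -/

open SingType

theorem exists_mem_erase_of_map_eq_cons {α β : Type*} [DecidableEq α] {s : Finset α} {f : α → β}
    {b : β} {t : Multiset β} (h : s.val.map f = b ::ₘ t) :
    ∃ a ∈ s, f a = b ∧ (s.erase a).val.map f = t := by
  obtain ⟨a, ha, hb, ht⟩ := (Multiset.map_eq_cons f s.val t b).mpr h
  exact ⟨a, ha, hb, by rw [Finset.erase_val]; exact ht⟩

theorem HasConfig.exists_single {F : Form} {T : SingType} (h : HasConfig F {T}) :
    ∃ P, HasSingType F P T ∧ ∀ Q, IsSingularPt F Q ↔ Q = P := by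
  classical
  obtain ⟨s, τ, hs, hτ, hm⟩ := h
  obtain ⟨P, hP, rfl, he⟩ := exists_mem_erase_of_map_eq_cons (b := T) (t := 0) hm
  refine ⟨P, hτ P hP, fun Q => ?_⟩
  have : s.erase P = ∅ := by
    rw [← Finset.val_eq_zero]; simpa using he
  rw [← hs]
  constructor
  · intro hQ
    by_contra hne
    have := Finset.mem_erase.mpr ⟨hne, hQ⟩
    simp_all
  · rintro rfl; exact hP

theorem HasConfig.exists_pair {F : Form} {T T' : SingType} (h : HasConfig F {T, T'}) :
    ∃ P Q, P ≠ Q ∧ HasSingType F P T ∧ HasSingType F Q T' ∧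
      ∀ N, IsSingularPt F N ↔ N = P ∨ N = Q := by
  classical
  obtain ⟨s, τ, hs, hτ, hm⟩ := h
  obtain ⟨P, hP, rfl, he⟩ := exists_mem_erase_of_map_eq_cons (b := T) (t := {T'}) hm
  obtain ⟨Q, hQ, rfl, he'⟩ := exists_mem_erase_of_map_eq_cons (b := T') (t := 0) he
  have h0 : (s.erase P).erase Q = ∅ := by
    rw [← Finset.val_eq_zero]; simpa using he'
  rw [Finset.mem_erase] at hQ
  refine ⟨P, Q, hQ.1.symm, hτ P hP, hτ Q hQ.2, fun N => ?_⟩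
  rw [← hs]
  constructor
  · intro hN
    by_contra! hne
    have := Finset.mem_erase.mpr ⟨hne.2, Finset.mem_erase.mpr ⟨hne.1, hN⟩⟩
    rw [h0] at this
    simp at this
  · rintro (rfl | rfl)
    · exact hP
    · exact hQ.2

theorem HasConfig.exists_triple {F : Form} {T T' T'' : SingType} (h : HasConfig F {T, T', T''}) :
    ∃ P Q R, P ≠ Q ∧ P ≠ R ∧ Q ≠ R ∧ HasSingType F P T ∧ HasSingType F Q T' ∧
      HasSingType F R T'' ∧ ∀ N, IsSingularPt F N ↔ N = P ∨ N = Q ∨ N = R := by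
  classical
  obtain ⟨s, τ, hs, hτ, hm⟩ := h
  obtain ⟨P, hP, rfl, he⟩ := exists_mem_erase_of_map_eq_cons (b := T) (t := {T', T''}) hm
  obtain ⟨Q, hQ, rfl, he'⟩ := exists_mem_erase_of_map_eq_cons (b := T') (t := {T''}) he
  obtain ⟨R, hR, rfl, he''⟩ := exists_mem_erase_of_map_eq_cons (b := T'') (t := 0) he'
  have h0 : ((s.erase P).erase Q).erase R = ∅ := by
    rw [← Finset.val_eq_zero]; simpa using he''
  simp only [Finset.mem_erase] at hQ hR
  refine ⟨P, Q, R, hQ.1.symm, hR.2.1.symm, hR.1.symm, hτ P hP, hτ Q hQ.2, hτ R hR.2.2,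
    fun N => ?_⟩
  rw [← hs]
  constructor
  · intro hN
    by_contra! hne
    have := Finset.mem_erase.mpr ⟨hne.2.2, Finset.mem_erase.mpr ⟨hne.2.1,
      Finset.mem_erase.mpr ⟨hne.1, hN⟩⟩⟩
    rw [h0] at this
    simp at this
  · rintro (rfl | rfl | rfl)
    · exact hP
    · exact hQ.2
    · exact hR.2.2

/-! ### Quartics whose flexes lie over a single value of u. -/

namespace NF.Is

variable {D : NF} {F s w z : Form} (h : D.Is F s w z) {Z : Finset ℂ}
include h

theorem flexes_of_card_one (hZ : IsFlexSet D Z) (hc : Z.card = 1) :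
    (flexes F).Finite ∧ ∑ᶠ P ∈ flexes F, flexOrder F P = 2 ∧
      (OrdinaryFlexes F →
        (flexes F).ncard = 2 ∧ (torusPairs F).ncard = 1 ∧ nonTorusPairs F = ∅) := by
  refine ⟨h.finite_flexes hZ, by rw [h.sum_flexOrder hZ, hc], fun ho => ?_⟩
  have hr : ∀ u ∈ Z, D.root u ≠ 0 := fun u hu => h.root_ne_zero_of_ordinary ho hZ hu
  obtain ⟨u₀, rfl⟩ := Finset.card_eq_one.mp hc
  obtain ⟨h1, h2⟩ := h.ncard_torusPairs hZ hr (by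
    intro u hu u' hu' _ _ _ _ _ _
    rw [Finset.mem_singleton] at hu hu'
    rw [hu, hu'])
  refine ⟨by rw [h.ncard_flexes hZ hr, hc], by rw [h1, hc], ?_⟩
  rw [hc] at h2
  have hf : (nonTorusPairs F).Finite := by
    obtain ⟨T, hT, -⟩ := pairs_eq (h.finite_flexes hZ)
    exact T.finite_toSet.subset (hT ▸ Set.subset_union_right)
  exact (Set.ncard_eq_zero hf).mp (by rw [h2]; rfl)

/-- Two distinct flexes over the only available u must be conjugate with ω ≠ 0. So the existence of
the two tangents already yields exactly two flexes and torus type, without assuming that flexes are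
ordinary. -/
theorem isTorusType_of_card_one (hZ : IsFlexSet D Z) (hc : Z.card = 1) {l l' : Form}
    (hl : AreFlexTangents F l l') : (flexes F).ncard = 2 ∧ IsTorusType (F * l * l') := by
  obtain ⟨P, hP, Q, hQ, hne, ⟨a, ha⟩, ⟨a', ha'⟩⟩ := hl
  obtain ⟨u₀, rfl⟩ := Finset.card_eq_one.mp hc
  obtain ⟨u, hu, ω, hg, rfl⟩ := h.exists_of_mem_flexes hZ hP
  obtain ⟨u', hu', ω', hg', rfl⟩ := h.exists_of_mem_flexes hZ hQ
  rw [Finset.mem_singleton] at hu hu'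
  obtain rfl : u' = u := hu'.trans hu.symm
  subst hu
  have hω' : ω' = -ω := by
    rcases sq_eq_sq_iff_eq_or_eq_neg.mp (hg.trans hg'.symm) with h1 | h1
    · exact absurd (by rw [h1]) hne
    · rw [h1, neg_neg]
  subst hω'
  have hω : ω ≠ 0 := by
    rintro rfl
    exact hne (by rw [neg_zero])
  have hr : ∀ v ∈ ({u'} : Finset ℂ), D.root v ≠ 0 := by
    intro v hv
    rw [Finset.mem_singleton] at hv
    subst hv
    intro h0
    rw [root_eq_zero_iff] at h0
    rw [h0] at hg
    exact hω (by simpa using hg)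
  refine ⟨by rw [h.ncard_flexes hZ hr, hc], ?_⟩
  obtain ⟨c, hc0, f₂, f₃, h₂, h₃, e⟩ :=
    h.isTorusType_conj hg ((hZ u').mp (Finset.mem_singleton_self u')).1 hω
  obtain ⟨b, hb0, hb⟩ := MvPolynomial.isUnit_iff_eq_C_of_isReduced.mp a.isUnit
  obtain ⟨b', hb0', hb'⟩ := MvPolynomial.isUnit_iff_eq_C_of_isReduced.mp a'.isUnit
  refine ⟨c * b * b', mul_ne_zero (mul_ne_zero hc0 hb0.ne_zero) hb0'.ne_zero, f₂, f₃, h₂, h₃, ?_⟩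
  rw [← e, tangentSextic, ← ha, ← ha', hb, hb']
  simp only [map_mul]
  ring

theorem not_singular (hs : ∀ N, IsSingularPt F N → eval N.rep z = 0) (u : ℂ) :
    ¬ (D.g u = 0 ∧ D.A u = 0) := by
  rintro ⟨hg, hA⟩
  have h0 : (0 : ℂ) ^ 2 = D.g u := by rw [hg]; ring
  have := hs _ ((h.isSingularPt_pt_iff h0).mpr ⟨rfl, hA⟩)
  obtain ⟨a, ha, -, -, hz⟩ := h.pt_rep u 0
  exact ha (hz.symm.trans this)

end NF.Is

/-! ### Flexes of the quartics -/

namespace IsIrredQuartic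
variable {F : Form} (hF : IsIrredQuartic F)
include hF

theorem flexes_E6 (hc : HasConfig F {E6}) : ∃ (D : NF) (s w z : Form) (_ : D.Is F s w z)
    (Z : Finset ℂ), NF.Is.IsFlexSet D Z ∧ Z.card = 1 := by
  obtain ⟨P, hP, -⟩ := hc.exists_single
  obtain ⟨D, s, w, z, h, hk, hl⟩ := hF.exists_nf_E6 hP
  obtain ⟨Z, hZ, h1⟩ := NF.exists_isFlexSet_one hk hl
  exact ⟨D, s, w, z, h, Z, hZ, h1⟩

theorem flexes_A5 (hc : HasConfig F {A 5}) :
    (flexes F).Finite ∧ ∑ᶠ P ∈ flexes F, flexOrder F P = 6 ∧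
      2 ≤ (torusPairs F).ncard ∧
      (OrdinaryFlexes F →
        (flexes F).ncard = 6 ∧ (torusPairs F).ncard = 3 ∧ (nonTorusPairs F).ncard = 12) := by
  obtain ⟨P, hP, hs⟩ := hc.exists_single
  obtain ⟨D, s, w, z, h, hk, hl, hz, -⟩ := hF.exists_nf_A5 ((hs P).mpr rfl).1 hP
  have hns := h.not_singular (fun N hN => by rw [(hs N).mp hN]; exact hz)
  obtain ⟨Z, hZ, h3⟩ := NF.exists_isFlexSet_three hk hl hns
  refine ⟨h.finite_flexes hZ, by rw [h.sum_flexOrder hZ, h3],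
    h.two_le_ncard_torusPairs hZ h3.ge, fun ho => ?_⟩
  have hr : ∀ u ∈ Z, D.root u ≠ 0 := fun u hu => h.root_ne_zero_of_ordinary ho hZ hu
  obtain ⟨h1, h2⟩ := h.ncard_torusPairs hZ hr (h.eq_of_isTorusType
    (Or.inr ⟨hk, fun h0 => by rw [h0] at hl; simp at hl⟩) hns hF.2.ne_zero hZ)
  refine ⟨by rw [h.ncard_flexes hZ hr, h3], by rw [h1, h3], by rw [h2, h3]; rfl⟩

theorem flexes_two_A2 (hc : HasConfig F (2 • {A 2})) :
    (flexes F).Finite ∧ ∑ᶠ P ∈ flexes F, flexOrder F P = 8 ∧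
      (torusPairs F).Nonempty ∧ (nonTorusPairs F).Nonempty ∧
      (OrdinaryFlexes F → (flexes F).ncard = 8) := by
  rw [two_nsmul] at hc
  obtain ⟨P, Q, hPQ, hP, hQ, hs⟩ := HasConfig.exists_pair (T := A 2) (T' := A 2) hc
  obtain ⟨D, s, w, z, h, hk, hl, hzP, hzQ, -⟩ := hF.exists_nf_cusps hPQ
    ((hs P).mpr (Or.inl rfl)).1 ((hs Q).mpr (Or.inr rfl)).1 hP hQ
  have hns := h.not_singular (fun N hN => by
    rcases (hs N).mp hN with rfl | rfl <;> assumption)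
  obtain ⟨Z, hZ, h4⟩ := NF.exists_isFlexSet_four hk hl hns
  refine ⟨h.finite_flexes hZ, by rw [h.sum_flexOrder hZ, h4], ?_, ?_, fun ho => ?_⟩
  · have := h.two_le_ncard_torusPairs hZ (by omega)
    exact Set.nonempty_of_ncard_ne_zero (by omega)
  -- Any two flexes over different values of u form a pair of non-torus type, whether or not they
  -- are ordinary.
  · obtain ⟨u, hu, u', hu', hne⟩ := Finset.one_lt_card.mp (by omega : 1 < Z.card)
    have hne' : h.pt u (D.root u) ≠ h.pt u' (D.root u') := fun he =>
      hne (h.pt_inj (D.root_sq u) (D.root_sq u') he).1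
    exact ⟨_, _, h.pt_mem_flexes hZ hu (D.root_sq u), _, h.pt_mem_flexes hZ hu' (D.root_sq u'),
      hne', rfl, fun ht => hne (h.eq_of_isTorusType (Or.inl ⟨hk, hl⟩) hns hF.2.ne_zero hZ
        u hu u' hu' _ _ (D.root_sq u) (D.root_sq u') hne' ht)⟩
  · rw [h.ncard_flexes hZ fun u hu => h.root_ne_zero_of_ordinary ho hZ hu, h4]

end IsIrredQuartic

/-- At a node, the tangent cone is not a double line. -/
theorem NF.Is.node_nondegenerate {D : NF} {F s w z : Form} (h : D.Is F s w z) (hl : D.l = 0)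
    {u₁ : ℂ} (hg : D.g u₁ = 0) (hA : D.A u₁ = 0) (ht : HasSingType F (h.pt u₁ 0) (SingType.A 1)) :
    D.c u₁ ^ 2 ≠ 2 * D.S u₁ := by
  intro hd
  obtain ⟨u, v, -, -, hns, -⟩ := ht.exists_A le_rfl
  apply hns
  have hc1 : D.c u₁ ≠ 0 := by rintro h; unfold A at hA; rw [h] at hA; simp at hA
  have hA' : 1 + 2 * D.k * D.c u₁ * D.S u₁ = 0 := by
    unfold A at hA; rw [hl] at hA; linear_combination hA
  have hg' : u₁ = D.k * D.S u₁ ^ 2 := by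
    unfold g at hg; rw [hl] at hg; linear_combination hg
  obtain ⟨a, ha, h1, h2, h3⟩ := h.pt_rep u₁ 0
  set p := (h.pt u₁ 0).rep
  obtain ⟨r, hr⟩ := IsAlgClosed.exists_pow_nat_eq (D.c u₁) (n := 2) (by norm_num)
  have hw : localEq w p u v ∈ germIdeal := by
    rw [localEq_mem_iff, h2, mul_zero]
  have hs : localEq (s - C (D.S u₁) * z) p u v ∈ germIdeal := by
    rw [localEq_mem_iff, map_sub, map_mul, h1, h3, eval_C]; ring
  set σ := s - C (D.S u₁) * z with hσ
  set T := w ^ 2 + C D.k * σ ^ 2 with hT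
  -- If c² = 2S, then near the node F is (r·z·w)² + T·(4kS·z·σ + T) with r² = c, where T has order
  -- at least 2 and its cofactor order at least 1. So F is a square modulo the third power, unlike
  -- an A₁ germ.
  have hFe : F = (C r * z * w) ^ 2 + T * (C (4 * D.k * D.S u₁) * z * σ + T) := by
    apply MvPolynomial.funext
    intro p
    rw [h.eval_eq, eval_conic, hl]
    simp only [hT, hσ, map_mul, map_add, map_sub, map_pow, eval_C]
    have hS : D.S u₁ = -(u₁ ^ 2 + D.b * u₁ + D.e) := rfl
    have hc : D.c u₁ = 2 * u₁ + D.b := rfl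
    generalize eval p s = s
    generalize eval p w = w
    generalize eval p z = z
    generalize D.S u₁ = S at *
    generalize D.c u₁ = c at *
    have h4 : 4 * D.k ^ 2 * S ^ 2 + c * D.k = 0 := by
      have : c * (4 * D.k ^ 2 * S ^ 2 + c * D.k) = 0 := by
        linear_combination 2 * D.k * S * hA' + D.k * hd
      exact (mul_eq_zero.mp this).resolve_left hc1
    have hq : w ^ 2 + D.k * s ^ 2 + 0 * s * z =
        (w ^ 2 + D.k * (s - S * z) ^ 2 + 2 * D.k * S * (s - S * z) * z) + u₁ * z ^ 2 := by
      linear_combination -z ^ 2 * hg'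
    rw [hq]
    have hrw : ∀ q : ℂ, (q + u₁ * z ^ 2) ^ 2 + D.b * (q + u₁ * z ^ 2) * z ^ 2 + D.e * z ^ 4 +
        s * z ^ 3 = q ^ 2 + c * q * z ^ 2 + (s - S * z) * z ^ 3 := by
      intro q; rw [hS, hc]; ring
    rw [hrw]
    linear_combination (s - S * z) ^ 2 * z ^ 2 * h4 + (s - S * z) * z ^ 3 * hA' -
      w ^ 2 * z ^ 2 * hr
  have hTm : localEq T p u v ∈ germIdeal ^ 2 := by
    simp only [hT, localEq_add, localEq_mul, localEq_pow]
    exact add_mem (Ideal.pow_mem_pow hw 2) (Ideal.mul_mem_left _ _ (Ideal.pow_mem_pow hs 2))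
  refine ⟨localEq (C r * z * w) p u v, ?_⟩
  rw [hFe, localEq_add, localEq_pow, add_sub_cancel_left, localEq_mul, pow_succ]
  refine Ideal.mul_mem_mul hTm ?_
  rw [localEq_add, localEq_mul]
  exact add_mem (Ideal.mul_mem_left _ _ hs) (Ideal.pow_le_self two_ne_zero hTm)

theorem IsIrredQuartic.flexes_two_A2_A1 {F : Form} (hF : IsIrredQuartic F)
    (hc : HasConfig F (2 • {A 2} + {A 1})) : ∃ (D : NF) (s w z : Form) (_ : D.Is F s w z)
    (Z : Finset ℂ), NF.Is.IsFlexSet D Z ∧ Z.card = 1 := by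
  rw [two_nsmul, add_assoc] at hc
  obtain ⟨P, Q, N, hPQ, hPN, hQN, hP, hQ, hN, hs⟩ :=
    HasConfig.exists_triple (T := A 2) (T' := A 2) (T'' := A 1) hc
  obtain ⟨D, s, w, z, h, hk, hl, hzP, hzQ, hz⟩ := hF.exists_nf_cusps hPQ
    ((hs P).mpr (Or.inl rfl)).1 ((hs Q).mpr (Or.inr (Or.inl rfl))).1 hP hQ
  have sN : IsSingularPt F N := (hs N).mpr (Or.inr (Or.inr rfl))
  -- The only points of the quartic on z = 0 are the two cusps, so the node is affine and
  -- corresponds to a double root of g.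
  have hzN : eval N.rep z ≠ 0 := by
    intro h0
    rcases hz N sN.1 h0 with rfl | rfl
    · exact hPN rfl
    · exact hQN rfl
  obtain ⟨u₁, ω, hg, rfl, -⟩ := h.exists_coords sN.1 hzN
  obtain ⟨rfl, hA⟩ := (h.isSingularPt_pt_iff hg).mp sN
  have hg0 : D.g u₁ = 0 := by rw [← hg]; ring
  have huniq : ∀ u, D.g u = 0 → D.A u = 0 → u = u₁ := by
    intro u hu hAu
    have h0 : (0 : ℂ) ^ 2 = D.g u := by rw [hu]; ring
    have hsing := (h.isSingularPt_pt_iff h0).mpr ⟨rfl, hAu⟩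
    obtain ⟨a, ha, -, -, hza⟩ := h.pt_rep u 0
    rcases (hs _).mp hsing with he | he | he
    · rw [he, hzP] at hza; exact absurd hza.symm ha
    · rw [he, hzQ] at hza; exact absurd hza.symm ha
    · exact (h.pt_inj h0 hg he).1
  obtain ⟨Z, hZ, h1⟩ := NF.exists_isFlexSet_node hk hl hg0 hA huniq
    (h.node_nondegenerate hl hg0 hA hN)
  exact ⟨D, s, w, z, h, Z, hZ, h1⟩

/-! ### Linear forms and lines -/

theorem linear_eq_C_mul {p u v : Fin 3 → ℂ} {x y z l : Form} (hf : IsFrame x y z)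
    (hp : eval p x = 1 ∧ eval p y = 0 ∧ eval p z = 0)
    (hu : eval u x = 0 ∧ eval u y = 1 ∧ eval u z = 0)
    (hv : eval v x = 0 ∧ eval v y = 0 ∧ eval v z = 1) (hl : l.IsHomogeneous 1) :
    l = C (eval p l) * x + C (eval u l) * y + C (eval v l) * z := by
  apply MvPolynomial.funext
  intro w
  have hw : w = (eval w x) • p + (eval w y) • u + (eval w z) • v := by
    apply hf.ext_vec <;> simp [eval_linear_add, eval_linear_smul, hf.hx, hf.hy, hf.hz, hp, hu, hv]
  conv_lhs => rw [hw]
  simp only [eval_linear_add hl, eval_linear_smul hl, map_add, map_mul, eval_C]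
  ring

theorem linear_eq_zero_of_basis {p u v : Fin 3 → ℂ} (h : LinearIndependent ℂ ![p, u, v]) {l : Form}
    (hl : l.IsHomogeneous 1) (h1 : eval p l = 0) (h2 : eval u l = 0) (h3 : eval v l = 0) :
    l = 0 := by
  obtain ⟨x, y, z, hf, hp, hu, hv⟩ := exists_frame_of_linearIndependent h
  rw [linear_eq_C_mul hf hp hu hv hl, h1, h2, h3]
  simp

theorem exists_comb_of_line {l : Form} (hl : l.IsHomogeneous 1) (h0 : l ≠ 0) {p u : Fin 3 → ℂ}
    (hi : LinearIndependent ℂ ![p, u]) (hp : eval p l = 0) (hu : eval u l = 0) {w : Fin 3 → ℂ}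
    (hw : eval w l = 0) : ∃ a b : ℂ, w = a • p + b • u := by
  obtain ⟨v, hv⟩ := exists_linearIndependent_third hi
  obtain ⟨x, y, z, hf, hp', hu', hv'⟩ := exists_frame_of_linearIndependent hv
  have e := linear_eq_C_mul hf hp' hu' hv' hl
  rw [hp, hu] at e
  have hlv : eval v l ≠ 0 := fun h => h0 (linear_eq_zero_of_basis hv hl hp hu h)
  have hz : eval w z = 0 := by
    rw [e] at hw
    simpa [hlv] using hw
  refine ⟨eval w x, eval w y, ?_⟩
  apply hf.ext_vec <;>
    simp [eval_linear_add, eval_linear_smul, hf.hx, hf.hy, hf.hz, hp', hu', hz]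

theorem exists_line_direction {l : Form} (hl : l.IsHomogeneous 1) {p : Fin 3 → ℂ} (h0 : p ≠ 0) :
    ∃ u, LinearIndependent ℂ ![p, u] ∧ eval u l = 0 := by
  obtain ⟨i, hi⟩ := Function.ne_iff.mp h0
  obtain ⟨u, hu0, hu, hui⟩ := exists_ne_zero_of_two_linear hl (isHomogeneous_X ℂ i)
  refine ⟨u, ?_, hu⟩
  rw [LinearIndependent.pair_iff]
  intro s t hst
  have h1 := congrFun hst i
  rw [eval_X] at hui
  have hs : s = 0 := by
    simpa [hui, show p i ≠ 0 from hi] using h1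
  refine ⟨hs, ?_⟩
  rw [hs] at hst
  simpa [hu0] using hst

theorem lineMult_eq_of_line {F l : Form} (hF : F.IsHomogeneous 4) (hl : l.IsHomogeneous 1)
    (h0 : l ≠ 0) {P : P2} {u : Fin 3 → ℂ} (hi : LinearIndependent ℂ ![P.rep, u])
    (hp : eval P.rep l = 0) (hu : eval u l = 0) :
    lineMult F l P = emultiplicity (Polynomial.X : Polynomial ℂ) (restrictLine F P.rep u) :=
  lineMult_eq hF hu fun _ hw => exists_comb_of_line hl h0 hi hp hu hw

/-- The dictionary between the two descriptions: coefficients along an axis of the chart are those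
of the restriction to the corresponding line. -/
theorem cf_localEq_left (F : Form) (p u v : Fin 3 → ℂ) :
    ∀ i, cf i 0 (localEq F p u v) = (restrictLine F p u).coeff i := by
  induction F using MvPolynomial.induction_on with
  | C a =>
    intro i
    rw [localEq_C, cf_C, restrictLine_C, Polynomial.coeff_C]; simp
  | add f g hf hg => intro i; rw [localEq_add, map_add, hf, hg, restrictLine_add, Polynomial.coeff_add]
  | mul_X f j hf =>
    intro i
    rw [localEq_mul, cf_mul, restrictLine_mul, Polynomial.coeff_mul]
    refine Finset.sum_congr rfl fun q _ => ?_
    simp only [Finset.HasAntidiagonal.antidiagonal_zero, Finset.sum_singleton, hf]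
    congr 1
    rw [localEq_linear (isHomogeneous_X _ _), restrictLine_linear (isHomogeneous_X _ _)]
    simp only [map_add, cf_C_mul, cf_C, cf_X0, cf_X1, Polynomial.coeff_add, Polynomial.coeff_C,
      Polynomial.coeff_C_mul, Polynomial.coeff_X]
    simp [eq_comm]

theorem cf_localEq_right (F : Form) (p u v : Fin 3 → ℂ) :
    ∀ i, cf 0 i (localEq F p u v) = (restrictLine F p v).coeff i := by
  induction F using MvPolynomial.induction_on with
  | C a =>
    intro i
    rw [localEq_C, cf_C, restrictLine_C, Polynomial.coeff_C]; simp
  | add f g hf hg => intro i; rw [localEq_add, map_add, hf, hg, restrictLine_add, Polynomial.coeff_add]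
  | mul_X f j hf =>
    intro i
    rw [localEq_mul, cf_zero_mul, restrictLine_mul, Polynomial.coeff_mul]
    refine Finset.sum_congr rfl fun q _ => ?_
    rw [hf]
    congr 1
    rw [localEq_linear (isHomogeneous_X _ _), restrictLine_linear (isHomogeneous_X _ _)]
    simp only [map_add, cf_C_mul, cf_C, cf_X0, cf_X1, Polynomial.coeff_add, Polynomial.coeff_C,
      Polynomial.coeff_C_mul, Polynomial.coeff_X]
    simp [eq_comm]

theorem coeff_zero_restrictLine (F : Form) (p u : Fin 3 → ℂ) :
    (restrictLine F p u).coeff 0 = eval p F := by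
  rw [← cf_localEq_left F p u 0, cf_zero_localEq]

theorem coeff_one_restrictLine (F : Form) (P : P2) (u : Fin 3 → ℂ) :
    (restrictLine F P.rep u).coeff 1 = eval u (tangentForm F P) := by
  induction F using MvPolynomial.induction_on with
  | C a => rw [restrictLine_C, tangentForm_C, Polynomial.coeff_C]; simp
  | add f g hf hg => rw [restrictLine_add, Polynomial.coeff_add, hf, hg, tangentForm_add, map_add]
  | mul_X f i hf =>
    rw [restrictLine_mul, Polynomial.coeff_mul, tangentForm_mul,
      tangentForm_linear (isHomogeneous_X _ _), restrictLine_linear (isHomogeneous_X _ _)]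
    simp only [Finset.Nat.antidiagonal_succ, Finset.HasAntidiagonal.antidiagonal_zero, Finset.map_singleton,
      Finset.sum_cons, Finset.sum_singleton]
    simp [hf, coeff_zero_restrictLine]
    ring

/-- The terms of low order of a quartic along a line. -/
theorem exists_decomp_of_line {F l : Form} (hF : F.IsHomogeneous 4) (hl : l.IsHomogeneous 1)
    (h0 : l ≠ 0) {p u : Fin 3 → ℂ} (hi : LinearIndependent ℂ ![p, u])
    (hp : eval p l = 0) (hu : eval u l = 0) :
    ∃ x y G : Form, eval p y = 0 ∧ F = C ((restrictLine F p u).coeff 0) * x ^ 4 +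
      C ((restrictLine F p u).coeff 1) * x ^ 3 * y +
      C ((restrictLine F p u).coeff 2) * x ^ 2 * y ^ 2 +
      C ((restrictLine F p u).coeff 3) * x * y ^ 3 +
      C ((restrictLine F p u).coeff 4) * y ^ 4 + l * G := by
  obtain ⟨v, hv⟩ := exists_linearIndependent_third hi
  obtain ⟨x, y, z, hf, hp', hu', hv', a, ha, -, e⟩ := exists_chart hv hF
  have el := linear_eq_C_mul hf hp' hu' hv' hl
  have hlv : eval v l ≠ 0 := fun h => h0 (linear_eq_zero_of_basis hv hl hp hu h)
  rw [hp, hu] at el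
  have ez : z = l * C (eval v l)⁻¹ := by
    have hinv : (C (eval v l) : Form) * C (eval v l)⁻¹ = 1 := by
      rw [← C_mul, mul_inv_cancel₀ hlv, C_1]
    have : l = C (eval v l) * z := by simpa using el
    linear_combination -C (eval v l)⁻¹ * this - z * hinv
  refine ⟨x, y, C (eval v l)⁻¹ * (C (a 0 1) * x ^ 3 + x ^ 2 * (C (a 1 1) * y + C (a 0 2) * z) +
      x * (C (a 2 1) * y ^ 2 + C (a 1 2) * y * z +
      C (a 0 3) * z ^ 2) + C (a 3 1) * y ^ 3 + C (a 2 2) * y ^ 2 * z +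
      C (a 1 3) * y * z ^ 2 + C (a 0 4) * z ^ 3), hp'.2.1, ?_⟩
  simp only [← cf_localEq_left F p u v, ← ha]
  rw [← mul_assoc, ← ez]
  refine e.trans ?_
  ring

/-! ### Singularities of the sextic on one line -/

/-- A line gives a smooth germ, and a formal coordinate change keeps it smooth; `E6_ne_mul` says
that no smooth germ divides x³ + y⁴. -/
theorem not_hasSingType_E6_of_line {l G : Form} (hl : l.IsHomogeneous 1) {P : P2}
    (hP : eval P.rep l = 0) : ¬ HasSingType (l * G) P E6 := by
  rintro ⟨u, v, hi, φ, w, e⟩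
  have hne : localEq l P.rep u v ∉ germIdeal ^ 2 := by
    intro hm
    have h1 := cf_eq_zero_of_mem_pow hm (i := 1) (j := 0) (by norm_num)
    have h2 := cf_eq_zero_of_mem_pow hm (i := 0) (j := 1) (by norm_num)
    rw [localEq_linear hl] at h1 h2
    simp [cf_C, cf_C_mul, cf_X0, cf_X1] at h1 h2
    have h0 := linear_eq_zero_of_basis hi hl hP h1 h2
    rw [h0, zero_mul, show localEq 0 P.rep u v = 0 by simp [localEq], map_zero] at e
    have := E6_not_mem_pow_four
    rw [← unit_mul_mem_pow w.isUnit, ← e] at this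
    exact this (zero_mem _)
  have hm : φ (localEq l P.rep u v) ∈ germIdeal := equiv_mem (localEq_mem_iff.mpr hP)
  rw [← equiv_mem_pow φ] at hne
  have hcf : cf 1 0 (φ (localEq l P.rep u v)) ≠ 0 ∨ cf 0 1 (φ (localEq l P.rep u v)) ≠ 0 := by
    by_contra! h
    exact hne (mem_sq_of_cf (mem_germIdeal_iff.mp hm) h.1 h.2)
  refine E6_ne_mul hm hcf (g := φ (localEq G P.rep u v) * (w⁻¹ : Germˣ)) ?_
  rw [localEq_mul, map_mul] at e
  rw [← mul_assoc, e, mul_comm, Units.inv_mul_cancel_left]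

theorem not_hasSingType_A2_of_mul {l G : Form} {P : P2}
    (hP : eval P.rep l = 0) (hG : eval P.rep G = 0) : ¬ HasSingType (l * G) P (A 2) := by
  rintro ⟨u, v, hi, φ, w, e⟩
  have hm : φ (localEq l P.rep u v) ∈ germIdeal := equiv_mem (localEq_mem_iff.mpr hP)
  have hg : φ (localEq G P.rep u v) ∈ germIdeal := equiv_mem (localEq_mem_iff.mpr hG)
  refine A2_ne_mul hm (Ideal.mul_mem_right (w⁻¹ : Germˣ).val _ hg) ?_
  rw [localEq_mul, map_mul] at e
  rw [← mul_assoc, e, mul_comm, Units.inv_mul_cancel_left]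

theorem HasSingType.of_mul_unit {F G : Form} {P : P2} {T : SingType} (hG : eval P.rep G ≠ 0)
    (h : HasSingType (F * G) P T) : HasSingType F P T := by
  obtain ⟨u, v, hi, φ, w, e⟩ := h
  have hu : IsUnit (φ (localEq G P.rep u v)) := (isUnit_localEq_iff.mpr hG).map φ
  refine ⟨u, v, hi, φ, w * hu.unit⁻¹, ?_⟩
  rw [localEq_mul, map_mul] at e
  rw [Units.val_mul, mul_right_comm, ← e, mul_assoc]
  have : φ (localEq G P.rep u v) * ((hu.unit⁻¹ : Germˣ) : Germ) = 1 := hu.mul_val_inv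
  rw [this, mul_one]

/-- A product of three forms through a point has no singularity of type `A n` there. -/
theorem HasSingType.not_mem_cube {F : Form} {P : P2} {n : ℕ} (hn : 1 ≤ n)
    (h : HasSingType F P (A n)) : ∃ u v, localEq F P.rep u v ∉ germIdeal ^ 3 := by
  obtain ⟨u, v, -, -, -, h3⟩ := h.exists_A hn
  exact ⟨u, v, h3⟩

section
variable {F l : Form} (hF : F.IsHomogeneous 4) (hl : l.IsHomogeneous 1) (h0 : l ≠ 0) {P : P2}
  (hP : eval P.rep l = 0) (hFP : eval P.rep F = 0)
include hF hl h0 hP hFP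

/-- If the contact were at least 2, then F = y²H + lG, and F·l would agree with G(P)·l² modulo the
third power. This is a square, which A₁ forbids. -/
theorem lineMult_of_A1 (ht : HasSingType (F * l) P (A 1)) : lineMult F l P = 1 := by
  obtain ⟨a, b, -, -, hns, -⟩ := ht.exists_A le_rfl
  obtain ⟨u, hi, hu⟩ := exists_line_direction hl P.rep_nonzero
  rw [lineMult_eq_of_line hF hl h0 hi hP hu]
  have h0' := coeff_zero_restrictLine F P.rep u
  rw [hFP] at h0'
  refine emultiplicity_X_of_coeff (m := 1) (fun d hd => ?_) fun h1 => hns ?_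
  · interval_cases d; exact h0'
  · obtain ⟨x, y, G, hy, e⟩ := exists_decomp_of_line hF hl h0 hi hP hu
    rw [h0', h1] at e
    set c₂ := (restrictLine F P.rep u).coeff 2
    set c₃ := (restrictLine F P.rep u).coeff 3
    set c₄ := (restrictLine F P.rep u).coeff 4
    have e' : F = y ^ 2 * (C c₂ * x ^ 2 + C c₃ * x * y + C c₄ * y ^ 2) + l * G := by
      rw [e]; simp; ring
    have hym : localEq y P.rep a b ∈ germIdeal := localEq_mem_iff.mpr hy
    have hlm : localEq l P.rep a b ∈ germIdeal := localEq_mem_iff.mpr hP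
    obtain ⟨r, hr⟩ := IsAlgClosed.exists_pow_nat_eq (eval P.rep G) (n := 2) (by norm_num)
    have hG : localEq G P.rep a b - MvPowerSeries.C (eval P.rep G) ∈ germIdeal := by
      rw [mem_germIdeal_iff, map_sub, cf_zero_localEq, cf_C]; simp
    refine ⟨MvPowerSeries.C r * localEq l P.rep a b, ?_⟩
    rw [← hr] at hG
    rw [e', localEq_mul, localEq_add, localEq_mul, localEq_mul l, localEq_pow]
    set H := localEq (C c₂ * x ^ 2 + C c₃ * x * y + C c₄ * y ^ 2) P.rep a b
    have : (localEq y P.rep a b ^ 2 * H + localEq l P.rep a b * localEq G P.rep a b) *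
        localEq l P.rep a b - (MvPowerSeries.C r * localEq l P.rep a b) ^ 2 =
        H * (localEq y P.rep a b ^ 2 * localEq l P.rep a b) +
        localEq l P.rep a b ^ 2 * (localEq G P.rep a b - MvPowerSeries.C (r ^ 2)) := by
      rw [map_pow]; ring
    rw [this, show 1 + 2 = 2 + 1 from rfl, pow_succ]
    refine add_mem (Ideal.mul_mem_left _ _ (Ideal.mul_mem_mul (Ideal.pow_mem_pow hym 2) hlm))
      (Ideal.mul_mem_mul (Ideal.pow_mem_pow hlm 2) hG)

omit hF hl h0 in
theorem tangentForm_ne_zero_of_A {n : ℕ} (hn : 1 ≤ n) (ht : HasSingType (F * l) P (A n)) :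
    tangentForm F P ≠ 0 := by
  intro h
  obtain ⟨u, v, h3⟩ := ht.not_mem_cube hn
  apply h3
  rw [localEq_mul, pow_succ]
  refine Ideal.mul_mem_mul (mem_sq_of_cf ?_ ?_ ?_) (localEq_mem_iff.mpr hP)
  · rw [cf_zero_localEq, hFP]
  · rw [cf_localEq_left, coeff_one_restrictLine, h, map_zero]
  · rw [cf_localEq_right, coeff_one_restrictLine, h, map_zero]

omit h0 hFP in
-- In a chart where l is the second coordinate y, the germ y·f is a square h² modulo the sixth
-- power. The coefficients of xⁱ in h² vanish for i ≤ 5, so h has no terms 1, x, x². The coefficient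
-- of xⁱy in h² is that of xⁱ in f, and for i ≤ 2 it involves only the vanishing coefficients.
theorem X_pow_three_dvd_of_A5 (ht : HasSingType (F * l) P (A 5)) :
    ∃ u, LinearIndependent ℂ ![P.rep, u] ∧ eval u l = 0 ∧
      (Polynomial.X : Polynomial ℂ) ^ 3 ∣ restrictLine F P.rep u := by
  obtain ⟨u, v, hi, hs, -, h3⟩ := ht.exists_A (by norm_num)
  have hcf : cf 1 0 (localEq l P.rep u v) ≠ 0 ∨ cf 0 1 (localEq l P.rep u v) ≠ 0 := by
    by_contra! h
    have h1 := h.1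
    have h2 := h.2
    rw [localEq_linear hl] at h1 h2
    simp [cf_C, cf_C_mul, cf_X0, cf_X1] at h1 h2
    have h0 := linear_eq_zero_of_basis hi hl hP h1 h2
    apply h3
    rw [h0, mul_zero, show localEq 0 P.rep u v = 0 by simp [localEq]]
    exact zero_mem _
  obtain ⟨a, b, c, d, hdet, e1, e2⟩ := exists_linSubst_adapted hcf
  have hs' := hs.map (θ := (linSubst a b c d).toRingHom) (fun f hf => algHom_mem _ hf)
  change SquareMod _ (linSubst a b c d _) at hs'
  rw [localEq_linSubst] at e1 e2 hs'
  have hi' := linearIndependent_change hi hdet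
  set u' := a • u + b • v
  set v' := c • u + d • v
  rw [localEq_linear hl] at e1 e2
  simp [cf_C, cf_C_mul, cf_X0, cf_X1] at e1 e2
  have el : localEq l P.rep u' v' = MvPowerSeries.X 1 := by
    rw [localEq_linear hl, hP, e1, e2]; simp
  have hi2 : LinearIndependent ℂ ![P.rep, u'] := by
    rw [LinearIndependent.pair_iff]
    intro s t hst
    rw [Fintype.linearIndependent_iff] at hi'
    have := hi' ![s, t, 0] (by simp [Fin.sum_univ_three, hst])
    exact ⟨this 0, this 1⟩
  refine ⟨u', hi2, e1, ?_⟩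
  rw [localEq_mul, el] at hs'
  obtain ⟨h, hh⟩ := hs'
  set f := localEq F P.rep u' v' with hf
  have k0 : ∀ i, i < 6 → cf i 0 (h ^ 2) = 0 := by
    intro i hi
    rw [← cf_eq_of_sub_mem_pow hh (by omega), cf_mul]
    simp [cf_X1]
  have k1 : ∀ i, i < 5 → cf i 1 (h ^ 2) = cf i 0 f := by
    intro i hi
    rw [← cf_eq_of_sub_mem_pow hh (by omega), cf_mul,
      Finset.sum_eq_single (i, 0)]
    · simp [cf_X1, Finset.Nat.antidiagonal_succ]
    · rintro ⟨q1, q2⟩ hq hne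
      simp only [Finset.HasAntidiagonal.mem_antidiagonal] at hq
      have : q2 ≠ 0 := by rintro rfl; exact hne (by simp at hq; rw [hq])
      simp [cf_X1, this]
    · simp
  have h00 : cf 0 0 h = 0 := by
    have := k0 0 (by norm_num)
    rw [pow_two, cf_mul] at this
    simpa using this
  have h10 : cf 1 0 h = 0 := by
    have := k0 2 (by norm_num)
    rw [pow_two, cf_mul] at this
    simpa [Finset.Nat.antidiagonal_succ, h00] using this
  have h20 : cf 2 0 h = 0 := by
    have := k0 4 (by norm_num)
    rw [pow_two, cf_mul] at this
    simpa [Finset.Nat.antidiagonal_succ, h00, h10] using this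
  rw [Polynomial.X_pow_dvd_iff]
  intro i hi3
  rw [← cf_localEq_left F P.rep u' v', ← hf, ← k1 i (by omega), pow_two, cf_mul]
  interval_cases i <;> simp [Finset.Nat.antidiagonal_succ, h00, h10, h20]

/-- The contact is at least 3 by the previous lemma. If it exceeded 3, then F = c₄y⁴ + lG and F·l =
l²G + l·c₄y⁴. Here G is a unit, as otherwise F·l would lie in the cube of the maximal ideal, and
completing the square would make F·l a square modulo the seventh power. -/
theorem lineMult_of_A5 (ht : HasSingType (F * l) P (A 5)) : lineMult F l P = 3 := by
  obtain ⟨u, hi, hu, hd⟩ := X_pow_three_dvd_of_A5 hF hl hP ht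
  obtain ⟨a, b, -, -, hns, h3⟩ := ht.exists_A (by norm_num)
  rw [lineMult_eq_of_line hF hl h0 hi hP hu]
  rw [Polynomial.X_pow_dvd_iff] at hd
  refine emultiplicity_X_of_coeff (m := 3) hd fun h4 => hns ?_
  obtain ⟨x, y, G, hy, e⟩ := exists_decomp_of_line hF hl h0 hi hP hu
  rw [hd 0 (by norm_num), hd 1 (by norm_num), hd 2 (by norm_num), h4] at e
  set c₄ := (restrictLine F P.rep u).coeff 4
  have e' : F = C c₄ * y ^ 4 + l * G := by
    rw [e]; simp
  have hym : localEq y P.rep a b ∈ germIdeal := localEq_mem_iff.mpr hy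
  have hlm : localEq l P.rep a b ∈ germIdeal := localEq_mem_iff.mpr hP
  have hl2 : localEq (F * l) P.rep a b = localEq l P.rep a b ^ 2 * localEq G P.rep a b +
      localEq l P.rep a b * (MvPowerSeries.C c₄ * localEq y P.rep a b ^ 4) := by
    rw [e']
    simp only [localEq_add, localEq_mul, localEq_pow, localEq_C]
    ring
  have hy8 : (MvPowerSeries.C c₄ * localEq y P.rep a b ^ 4) ^ 2 ∈ germIdeal ^ (5 + 2) := by
    rw [mul_pow, ← pow_mul]
    exact Ideal.mul_mem_left _ _ (Ideal.pow_le_pow_right (by norm_num) (Ideal.pow_mem_pow hym 8))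
  rw [hl2]
  refine squareMod_of_completed ?_ hy8
  by_contra hG
  apply h3
  rw [hl2]
  refine add_mem ?_ ?_
  · rw [pow_succ]
    exact Ideal.mul_mem_mul (Ideal.pow_mem_pow hlm 2) ((IsLocalRing.mem_maximalIdeal _).mpr hG)
  · refine Ideal.mul_mem_left _ _ (Ideal.mul_mem_left _ _ ?_)
    exact Ideal.pow_le_pow_right (by norm_num) (Ideal.pow_mem_pow hym 4)

end

/-- The types that occur in the configurations of the sextics. -/
def IsListed (T : SingType) : Prop := T = A 1 ∨ T = A 2 ∨ T = A 5 ∨ T = E6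

theorem not_hasSingType_of_sq_dvd {m G : Form} (hm : m.IsHomogeneous 1) {P : P2}
    (hP : eval P.rep m = 0) {T : SingType} (hT : IsListed T) : ¬ HasSingType (m ^ 2 * G) P T := by
  have hA : ∀ n, 1 ≤ n → ¬ HasSingType (m ^ 2 * G) P (A n) := by
    intro n hn ht
    obtain ⟨u, v, -, -, hns, h3⟩ := ht.exists_A hn
    rw [localEq_mul, localEq_pow] at hns h3
    have hmm : localEq m P.rep u v ∈ germIdeal := localEq_mem_iff.mpr hP
    by_cases hG : eval P.rep G = 0
    · apply h3
      rw [pow_succ]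
      exact Ideal.mul_mem_mul (Ideal.pow_mem_pow hmm 2) (localEq_mem_iff.mpr hG)
    · apply hns
      rw [mul_comm, squareMod_unit_mul_iff (isUnit_localEq_iff.mpr hG)]
      exact ⟨localEq m P.rep u v, by rw [sub_self]; exact zero_mem _⟩
  rcases hT with rfl | rfl | rfl | rfl
  · exact hA 1 le_rfl
  · exact hA 2 (by norm_num)
  · exact hA 5 (by norm_num)
  · rw [pow_two, mul_assoc]
    exact not_hasSingType_E6_of_line hm hP

theorem tangentForm_sextic (F : Form) {l l' : Form} (hl : l.IsHomogeneous 1)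
    (hl' : l'.IsHomogeneous 1) (P : P2) : tangentForm (F * l * l') P =
      C (eval P.rep F * eval P.rep l) * l' + C (eval P.rep l') *
        (C (eval P.rep F) * l + C (eval P.rep l) * tangentForm F P) := by
  rw [tangentForm_mul, tangentForm_mul, tangentForm_linear hl, tangentForm_linear hl', map_mul]

theorem exists_pt_of_ne_zero {r : Fin 3 → ℂ} (h : r ≠ 0) : ∃ (P : P2) (c : ℂ), c ≠ 0 ∧
    P.rep = c • r := by
  obtain ⟨c, hc⟩ := Projectivization.exists_smul_eq_mk_rep ℂ r h
  exact ⟨Projectivization.mk ℂ r h, c, c.ne_zero, hc.symm⟩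

/-- The singular points of a sextic that consists of an irreducible quartic and two lines, with
their types. -/
structure SexticData (F l l' : Form) (s : Finset P2) (τ : P2 → SingType) : Prop where
  hF : IsIrredQuartic F
  hl : l.IsHomogeneous 1
  hl' : l'.IsHomogeneous 1
  hs : ∀ P, P ∈ s ↔ IsSingularPt (F * l * l') P
  hτ : ∀ P ∈ s, HasSingType (F * l * l') P (τ P)
  hT : ∀ P ∈ s, IsListed (τ P)

/-! ### Local structure of the sextic at its singular points. -/

namespace SexticData

variable {F l l' : Form} {s : Finset P2} {τ : P2 → SingType} (h : SexticData F l l' s τ)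
include h

theorem symm : SexticData F l' l s τ := by
  have e : F * l' * l = F * l * l' := by ring
  exact ⟨h.hF, h.hl', h.hl, by rw [e]; exact h.hs, by rw [e]; exact h.hτ, h.hT⟩

theorem mem_iff (P : P2) : P ∈ s ↔ eval P.rep (F * l * l') = 0 ∧
    C (eval P.rep F * eval P.rep l) * l' + C (eval P.rep l') *
        (C (eval P.rep F) * l + C (eval P.rep l) * tangentForm F P) = 0 := by
  rw [h.hs, isSingularPt_iff, tangentForm_sextic F h.hl h.hl']; rfl

theorem mem_of_lines {P : P2} (h1 : eval P.rep l = 0) (h2 : eval P.rep l' = 0) : P ∈ s := by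
  rw [h.mem_iff]; simp [h1, h2]

theorem mem_of_line {P : P2} (h1 : eval P.rep l = 0) (h2 : eval P.rep F = 0) : P ∈ s := by
  rw [h.mem_iff]; simp [h1, h2]

/-- Every point of a double line would be a singular point of the sextic, of a type that
`not_hasSingType_of_sq_dvd` excludes. This yields that neither line form is zero and that the lines
are distinct. -/
theorem false_of_sq {m G : Form} (hm : m.IsHomogeneous 1) (he : F * l * l' = m ^ 2 * G) : False := by
  obtain ⟨r, hr, h0, -⟩ := exists_ne_zero_of_two_linear hm hm
  obtain ⟨P, c, hc, hP⟩ := exists_pt_of_ne_zero hr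
  have hPm : eval P.rep m = 0 := by rw [hP, eval_linear_smul hm, h0, mul_zero]
  have hPs : P ∈ s := by
    rw [h.hs, isSingularPt_iff, he]
    refine ⟨?_, ?_⟩
    · unfold OnCurve; rw [map_mul, map_pow, hPm]; ring
    · rw [tangentForm_mul, pow_two, tangentForm_mul, map_mul, hPm]; simp
  have := h.hτ P hPs
  rw [he] at this
  exact not_hasSingType_of_sq_dvd hm hPm (h.hT P hPs) this

theorem comb_eq_zero {a b : ℂ} (he : C a * l + C b * l' = 0) : a = 0 ∧ b = 0 := by
  by_contra hne
  by_cases hb : b = 0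
  · have ha : a ≠ 0 := fun ha => hne ⟨ha, hb⟩
    have hl0 : l = 0 := by
      rw [hb] at he
      simpa [ha] using he
    exact h.false_of_sq h.hl' (G := 0) (by rw [hl0]; ring)
  · have hl' : l' = C (-a / b) * l := by
      have h1 : (C b : Form) * C (-a / b) = -C a := by
        rw [← C_mul, mul_div_cancel₀ _ hb, C_neg]
      have hb' : (C b : Form) ≠ 0 := by simpa using hb
      apply mul_left_cancel₀ hb'
      linear_combination he - l * h1
    exact h.false_of_sq h.hl (G := F * C (-a / b)) (by rw [hl']; ring)

theorem l_ne_zero : l ≠ 0 := by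
  intro h0
  have := (h.comb_eq_zero (a := 1) (b := 0) (by rw [h0]; simp)).1
  simp at this

theorem not_det_eq {p u v : Fin 3 → ℂ} (hi : LinearIndependent ℂ ![p, u, v])
    (h1 : eval p l = 0) (h2 : eval p l' = 0) :
    eval u l * eval v l' ≠ eval v l * eval u l' := by
  intro hd
  have key : ∀ a b : ℂ, eval u (C a * l + C b * l') = 0 → eval v (C a * l + C b * l') = 0 →
      a = 0 ∧ b = 0 := by
    intro a b hu hv
    apply h.comb_eq_zero
    refine linear_eq_zero_of_basis hi ((h.hl.C_mul _).add (h.hl'.C_mul _)) ?_ hu hv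
    simp [h1, h2]
  have hu : eval u l = 0 := by
    have := (key (eval u l') (-eval u l) (by simp; ring)
      (by simp; linear_combination -hd)).2
    simpa using this
  have hv : eval v l = 0 := by
    have := (key (eval v l') (-eval v l) (by simp; linear_combination hd) (by simp; ring)).2
    simpa using this
  exact h.l_ne_zero (linear_eq_zero_of_basis hi h.hl h1 hu hv)

theorem eq_of_lines {P Q : P2} (h1 : eval P.rep l = 0) (h2 : eval P.rep l' = 0)
    (h3 : eval Q.rep l = 0) (h4 : eval Q.rep l' = 0) : P = Q := by
  by_contra hne
  obtain ⟨v, hv⟩ := exists_linearIndependent_third (linearIndependent_rep hne)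
  exact h.not_det_eq hv h1 h2 (by rw [h3, h4]; ring)

/-- The point of intersection of the two lines is a node of the sextic. -/
theorem type_of_lines {P : P2} (h1 : eval P.rep l = 0) (h2 : eval P.rep l' = 0) :
    τ P = A 1 ∧ eval P.rep F ≠ 0 := by
  have hPs := h.mem_of_lines h1 h2
  have ht := h.hτ P hPs
  have e : F * l * l' = l * (F * l') := by ring
  have hE : ¬ HasSingType (F * l * l') P E6 := by
    rw [e]; exact not_hasSingType_E6_of_line h.hl h1
  have hA2 : ¬ HasSingType (F * l * l') P (A 2) := by
    rw [e]; exact not_hasSingType_A2_of_mul h1 (by simp [h2])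
  have hFP : ∀ n, 1 ≤ n → HasSingType (F * l * l') P (A n) → eval P.rep F ≠ 0 := by
    intro n hn hty h0
    obtain ⟨u, v, h3⟩ := hty.not_mem_cube hn
    apply h3
    rw [localEq_mul, localEq_mul, pow_succ, pow_two]
    exact Ideal.mul_mem_mul (Ideal.mul_mem_mul (localEq_mem_iff.mpr h0) (localEq_mem_iff.mpr h1))
      (localEq_mem_iff.mpr h2)
  rcases h.hT P hPs with hc | hc | hc | hc <;> rw [hc] at ht
  · exact ⟨hc, hFP 1 le_rfl ht⟩
  · exact absurd ht hA2
  · exfalso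
    have h0 := hFP 5 (by norm_num) ht
    obtain ⟨u, v, hi, hs, -, -⟩ := ht.exists_A (by norm_num)
    rw [show F * l * l' = F * (l * l') by ring, localEq_mul,
      squareMod_unit_mul_iff (isUnit_localEq_iff.mpr h0), localEq_mul] at hs
    -- An A₅ here, off the quartic, would make l·l' a square up to order 6. Its quadratic part would
    -- then have discriminant zero, and the two lines would coincide.
    obtain ⟨k, hk⟩ := hs
    have el : localEq l P.rep u v * localEq l' P.rep u v =
        MvPowerSeries.C (eval u l * eval u l') * MvPowerSeries.X 0 ^ 2 * MvPowerSeries.X 1 ^ 0 +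
        MvPowerSeries.C (eval u l * eval v l' + eval v l * eval u l') * MvPowerSeries.X 0 ^ 1 *
          MvPowerSeries.X 1 ^ 1 +
        MvPowerSeries.C (eval v l * eval v l') * MvPowerSeries.X 0 ^ 0 * MvPowerSeries.X 1 ^ 2 := by
      rw [localEq_linear h.hl, localEq_linear h.hl', h1, h2]
      simp only [map_zero, map_mul, map_add]
      ring
    rw [el] at hk
    have c00 := cf_eq_of_sub_mem_pow hk (i := 0) (j := 0) (by norm_num)
    have c20 := cf_eq_of_sub_mem_pow hk (i := 2) (j := 0) (by norm_num)
    have c11 := cf_eq_of_sub_mem_pow hk (i := 1) (j := 1) (by norm_num)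
    have c02 := cf_eq_of_sub_mem_pow hk (i := 0) (j := 2) (by norm_num)
    rw [map_add, map_add, cf_term, cf_term, cf_term, pow_two, cf_mul] at c00 c20 c11 c02
    have k0 : cf 0 0 k = 0 := by simpa using c00.symm
    simp [Finset.Nat.antidiagonal_succ, k0] at c20 c11 c02
    refine h.not_det_eq hi h1 h2 ?_
    have : (eval u l * eval v l' - eval v l * eval u l') ^ 2 = 0 := by
      have e1 : (eval u l * eval v l' - eval v l * eval u l') ^ 2 =
        (eval u l * eval v l' + eval v l * eval u l') ^ 2 -
          4 * (eval u l * eval u l') * (eval v l * eval v l') := by ring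
      rw [e1, c20, c11, c02]; ring
    exact sub_eq_zero.mp (by simpa using this)
  · exact absurd ht hE

/-- The singular points of the sextic on one line only. -/
theorem type_of_line {P : P2} (hPs : P ∈ s) (h1 : eval P.rep l = 0) (h2 : eval P.rep l' ≠ 0) :
    eval P.rep F = 0 ∧ tangentForm F P ≠ 0 ∧
      (τ P = A 1 ∧ lineMult F l P = 1 ∨ τ P = A 5 ∧ lineMult F l P = 3) := by
  have hF0 : eval P.rep F = 0 := by
    have := ((h.mem_iff P).mp hPs).2
    rw [h1] at this
    by_contra hF0
    have h3 : (C (eval P.rep l' * eval P.rep F) : Form) * l = 0 := by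
      rw [← this]; simp [mul_assoc]
    simp [h2, hF0, h.l_ne_zero] at h3
  have ht := (h.hτ P hPs).of_mul_unit h2
  have hA : ∀ n, 1 ≤ n → τ P = A n → tangentForm F P ≠ 0 := by
    intro n hn hc
    rw [hc] at ht
    exact tangentForm_ne_zero_of_A h1 hF0 hn ht
  refine ⟨hF0, ?_⟩
  rcases h.hT P hPs with hc | hc | hc | hc
  · refine ⟨hA 1 le_rfl hc, Or.inl ⟨hc, ?_⟩⟩
    rw [hc] at ht
    exact lineMult_of_A1 h.hF.1 h.hl h.l_ne_zero h1 hF0 ht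
  · rw [hc] at ht
    exact absurd ht (not_hasSingType_A2_of_mul hF0 h1)
  · refine ⟨hA 5 (by norm_num) hc, Or.inr ⟨hc, ?_⟩⟩
    rw [hc] at ht
    exact lineMult_of_A5 h.hF.1 h.hl h.l_ne_zero h1 hF0 ht
  · rw [hc, mul_comm] at ht
    exact absurd ht (not_hasSingType_E6_of_line h.hl h1)

/-- Away from the lines the sextic looks like the quartic. -/
theorem type_off_lines {P : P2} (h1 : eval P.rep l ≠ 0) (h2 : eval P.rep l' ≠ 0) :
    (P ∈ s ↔ IsSingularPt F P) ∧ (P ∈ s → HasSingType F P (τ P)) := by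
  constructor
  · rw [h.mem_iff, isSingularPt_iff]
    constructor
    · rintro ⟨h3, h4⟩
      have hF0 : eval P.rep F = 0 := by simpa [h1, h2] using h3
      refine ⟨hF0, ?_⟩
      rw [hF0] at h4
      simpa [h1, h2] using h4
    · rintro ⟨h3, h4⟩
      have hF0 : eval P.rep F = 0 := h3
      simp [hF0, h4]
  · intro hP
    exact ((h.hτ P hP).of_mul_unit h2).of_mul_unit h1

end SexticData

/-! ### How the quartic meets one of the lines. -/

theorem exists_of_count_one_or_three {α : Type*} [DecidableEq α] {M : Multiset α}
    (hM : M.card = 4) (h : ∀ t ∈ M, M.count t = 1 ∨ M.count t = 3) :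
    (M.toFinset.card = 4 ∧ ∀ t ∈ M, M.count t = 1) ∨
      ∃ t₀ t₁, t₀ ≠ t₁ ∧ M.count t₀ = 3 ∧ M.count t₁ = 1 ∧ ∀ t ∈ M, t = t₀ ∨ t = t₁ := by
  have hsum : ∑ t ∈ M.toFinset, M.count t = 4 := by rw [Multiset.toFinset_sum_count_eq, hM]
  by_cases h3 : ∃ t₀ ∈ M, M.count t₀ = 3
  · right
    obtain ⟨t₀, ht₀, h3⟩ := h3
    rw [← Finset.add_sum_erase _ _ (Multiset.mem_toFinset.mpr ht₀), h3] at hsum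
    have hs1 : ∑ t ∈ M.toFinset.erase t₀, M.count t = 1 := by omega
    have hpos : ∀ t ∈ M.toFinset.erase t₀, 1 ≤ M.count t := by
      intro t ht
      have := Multiset.mem_toFinset.mp (Finset.mem_of_mem_erase ht)
      exact Multiset.one_le_count_iff_mem.mpr this
    have hcard : (M.toFinset.erase t₀).card ≤ 1 := by
      rw [← hs1, Finset.card_eq_sum_ones]; exact Finset.sum_le_sum hpos
    have hne : (M.toFinset.erase t₀).Nonempty := by
      rw [Finset.nonempty_iff_ne_empty]
      intro h0; rw [h0] at hs1; simp at hs1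
    obtain ⟨t₁, ht₁⟩ := Finset.card_eq_one.mp (le_antisymm hcard hne.card_pos)
    have hm : t₁ ∈ M.toFinset.erase t₀ := by rw [ht₁]; simp
    rw [ht₁, Finset.sum_singleton] at hs1
    refine ⟨t₀, t₁, (Finset.ne_of_mem_erase hm).symm, h3, hs1, fun t ht => ?_⟩
    by_cases he : t = t₀
    · exact Or.inl he
    · right
      have := Finset.mem_erase.mpr ⟨he, Multiset.mem_toFinset.mpr ht⟩
      rw [ht₁] at this
      simpa using this
  · left
    push Not at h3
    have h1 : ∀ t ∈ M, M.count t = 1 := fun t ht => (h t ht).resolve_right (h3 t ht)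
    refine ⟨?_, h1⟩
    rw [← hsum, Finset.card_eq_sum_ones]
    exact Finset.sum_congr rfl fun t ht => (h1 t (Multiset.mem_toFinset.mp ht)).symm

theorem restrictLine_smul {n : ℕ} {F : Form} (hF : F.IsHomogeneous n) (c : ℂ) (p v : Fin 3 → ℂ) :
    restrictLine F (c • p) (c • v) = Polynomial.C (c ^ n) * restrictLine F p v := by
  apply Polynomial.funext
  intro t
  rw [eval_restrictLine, Polynomial.eval_mul, Polynomial.eval_C, eval_restrictLine,
    ← eval_homogeneous_smul hF]
  congr 2
  module

theorem restrictLine_shift (F : Form) (p v : Fin 3 → ℂ) (t : ℂ) :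
    restrictLine F (p + t • v) v =
      (restrictLine F p v).comp (Polynomial.X + Polynomial.C t) := by
  apply Polynomial.funext
  intro x
  rw [eval_restrictLine, Polynomial.eval_comp, eval_restrictLine]
  congr 2
  simp only [Polynomial.eval_add, Polynomial.eval_X, Polynomial.eval_C]
  module

theorem natDegree_restrictLine {F : Form} (hF : F.IsHomogeneous 4) {p v : Fin 3 → ℂ}
    (hi : LinearIndependent ℂ ![p, v]) (hv : eval v F ≠ 0) : (restrictLine F p v).natDegree = 4 := by
  obtain ⟨r, hr⟩ := exists_linearIndependent_third hi
  obtain ⟨x, y, z, hf, hp', hv', -, a, ha, ha0, e⟩ := exists_chart hr hF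
  have hc : ∀ i, (restrictLine F p v).coeff i = a i 0 := by
    intro i; rw [ha, cf_localEq_left]
  apply le_antisymm
  · rw [Polynomial.natDegree_le_iff_coeff_eq_zero]
    intro n hn
    rw [hc, ha0 n 0 (by omega)]
  · apply Polynomial.le_natDegree_of_ne_zero
    rw [hc]
    rw [e] at hv
    simpa [hv'] using hv

theorem rootMultiplicity_eq_of_emultiplicity {f : Polynomial ℂ} {n : ℕ} (hf : f ≠ 0)
    (h : emultiplicity (Polynomial.X : Polynomial ℂ) f = n) : f.rootMultiplicity 0 = n := by
  rw [Polynomial.rootMultiplicity_eq_multiplicity, if_neg hf, map_zero, sub_zero]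
  exact multiplicity_eq_of_emultiplicity_eq_some h

/-- A line with multiplicity at least two at a smooth point is the tangent. -/
theorem associated_tangentForm {F l : Form} (hF : F.IsHomogeneous 4) (hl : l.IsHomogeneous 1)
    (h0 : l ≠ 0) {P : P2} (hP : eval P.rep l = 0) (ht : tangentForm F P ≠ 0)
    (hm : 2 ≤ lineMult F l P) : Associated l (tangentForm F P) := by
  obtain ⟨u, hi, hu⟩ := exists_line_direction hl P.rep_nonzero
  rw [lineMult_eq_of_line hF hl h0 hi hP hu] at hm
  have hd : (Polynomial.X : Polynomial ℂ) ^ 2 ∣ restrictLine F P.rep u :=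
    pow_dvd_of_le_emultiplicity hm
  have key : ∀ a b : ℂ, eval (a • P.rep + b • u) (tangentForm F P) = 0 := by
    intro a b
    rw [← coeff_one_restrictLine]
    exact Polynomial.X_pow_dvd_iff.mp (X_pow_dvd_restrictLine hF hd a b) 1 (by norm_num)
  have k1 : eval P.rep (tangentForm F P) = 0 := by simpa using key 1 0
  have k2 : eval u (tangentForm F P) = 0 := by simpa using key 0 1
  obtain ⟨v, hv⟩ := exists_linearIndependent_third hi
  obtain ⟨x, y, z, hf, hp', hu', hv'⟩ := exists_frame_of_linearIndependent hv
  have e1 := linear_eq_C_mul hf hp' hu' hv' hl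
  have e2 := linear_eq_C_mul hf hp' hu' hv' (tangentForm_isHomogeneous F P)
  rw [hP, hu] at e1
  rw [k1, k2] at e2
  have n1 : eval v l ≠ 0 := fun h => h0 (linear_eq_zero_of_basis hv hl hP hu h)
  have n2 : eval v (tangentForm F P) ≠ 0 := fun h =>
    ht (linear_eq_zero_of_basis hv (tangentForm_isHomogeneous F P) k1 k2 h)
  have hun : IsUnit (C (eval v (tangentForm F P) / eval v l) : Form) :=
    (isUnit_iff_ne_zero.mpr (div_ne_zero n2 n1)).map C
  refine ⟨hun.unit, ?_⟩
  have e3 : (C (eval v (tangentForm F P)) : Form) =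
      C (eval v l) * C (eval v (tangentForm F P) / eval v l) := by
    rw [← C_mul, mul_div_cancel₀ _ n1]
  rw [map_zero, zero_mul, zero_mul, zero_add, zero_add] at e1 e2
  rw [IsUnit.unit_spec]
  linear_combination C (eval v (tangentForm F P) / eval v l) * e1 - e2 - z * e3

theorem lineMult_congr {F l m : Form} (h : Associated l m) (P : P2) :
    lineMult F l P = lineMult F m P := by
  obtain ⟨a, rfl⟩ := h
  have key : ∀ v, eval v (l * (a : Form)) = 0 ↔ eval v l = 0 := by
    intro v
    rw [map_mul, mul_eq_zero, or_iff_left]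
    exact (a.isUnit.map (eval v)).ne_zero
  unfold lineMult
  apply le_antisymm
  · exact le_iInf fun v => iInf_le_of_le ⟨v.1, (key _).mp v.2⟩ le_rfl
  · exact le_iInf fun v => iInf_le_of_le ⟨v.1, (key _).mpr v.2⟩ le_rfl

namespace SexticData

variable {F l l' : Form} {s : Finset P2} {τ : P2 → SingType} (h : SexticData F l l' s τ)
include h

/-- The intersection of the quartic with one of the lines. -/
theorem exists_on_line (hcount : ∀ T ⊆ s, (∀ P ∈ T, τ P = A 1) → T.card ≤ 4) :
    ∃ P Q, P ≠ Q ∧ P ∈ s ∧ Q ∈ s ∧ eval P.rep l = 0 ∧ eval Q.rep l = 0 ∧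
      eval P.rep F = 0 ∧ eval Q.rep F = 0 ∧ τ P = A 5 ∧ τ Q = A 1 ∧
      ∀ N : P2, eval N.rep l = 0 → eval N.rep F = 0 → N = P ∨ N = Q := by
  classical
  obtain ⟨r₀, hr₀, h1, h2⟩ := exists_ne_zero_of_two_linear h.hl h.hl'
  obtain ⟨R, c₀, -, hRr⟩ := exists_pt_of_ne_zero hr₀
  have hRl : eval R.rep l = 0 := by rw [hRr, eval_linear_smul h.hl, h1, mul_zero]
  have hRl' : eval R.rep l' = 0 := by rw [hRr, eval_linear_smul h.hl', h2, mul_zero]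
  obtain ⟨hRτ, hRF⟩ := h.type_of_lines hRl hRl'
  obtain ⟨u, hi, hu⟩ := exists_line_direction h.hl R.rep_nonzero
  -- The line is parametrized as u + tR, with the common point R of the two lines at infinity. As R
  -- is off the quartic, the restricted polynomial has degree exactly 4 and its roots account for
  -- the whole intersection.
  have hi' : LinearIndependent ℂ ![u, R.rep] := by
    rw [LinearIndependent.pair_iff] at hi ⊢
    intro a b hab
    exact (hi b a (by rw [← hab]; module)).symm
  set ρ := restrictLine F u R.rep with hρ
  have hdeg : ρ.natDegree = 4 := natDegree_restrictLine h.hF.1 hi' hRF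
  have hρ0 : ρ ≠ 0 := by intro h0; rw [h0] at hdeg; simp at hdeg
  have hcard : ρ.roots.card = 4 := by
    rw [← hdeg]; exact Polynomial.splits_iff_card_roots.mp (IsAlgClosed.splits ρ)
  have hv0 : ∀ t : ℂ, u + t • R.rep ≠ 0 := by
    intro t h0
    have := ((LinearIndependent.pair_iff.mp hi') 1 t (by rw [one_smul]; exact h0)).1
    exact one_ne_zero this
  choose pt c hc hpt using fun t => exists_pt_of_ne_zero (hv0 t)
  have pl : ∀ t, eval (pt t).rep l = 0 := by
    intro t
    rw [hpt, eval_linear_smul h.hl, eval_linear_add h.hl, eval_linear_smul h.hl, hu, hRl]; ring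
  have pF : ∀ t, eval (pt t).rep F = c t ^ 4 * ρ.eval t := by
    intro t
    rw [hpt, eval_homogeneous_smul h.hF.1, hρ, eval_restrictLine]
  have pF0 : ∀ t, t ∈ ρ.roots ↔ eval (pt t).rep F = 0 := by
    intro t
    rw [pF, Polynomial.mem_roots hρ0, Polynomial.IsRoot, mul_eq_zero,
      or_iff_right (pow_ne_zero 4 (hc t))]
  have pinj : Function.Injective pt := by
    intro t t' he
    have e1 := hpt t
    rw [he, hpt t'] at e1
    have := (LinearIndependent.pair_iff.mp hi') (c t' - c t) (c t' * t' - c t * t) (by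
      have : c t' • (u + t' • R.rep) - c t • (u + t • R.rep) = 0 := by rw [e1, sub_self]
      rw [← this]; module)
    have hcc : c t' = c t := by linear_combination this.1
    rw [hcc] at this
    have h3 : c t * (t' - t) = 0 := by linear_combination this.2
    exact (sub_eq_zero.mp ((mul_eq_zero.mp h3).resolve_left (hc t))).symm
  have pmem : ∀ t ∈ ρ.roots, pt t ∈ s := fun t ht => h.mem_of_line (pl t) ((pF0 t).mp ht)
  have pl' : ∀ t ∈ ρ.roots, eval (pt t).rep l' ≠ 0 := by
    intro t ht h0
    exact (h.type_of_lines (pl t) h0).2 ((pF0 t).mp ht)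
  have hmult : ∀ t, ∀ n : ℕ, lineMult F l (pt t) = n → ρ.roots.count t = n := by
    intro t n hn
    have hdir : LinearIndependent ℂ ![(pt t).rep, c t • R.rep] := by
      rw [LinearIndependent.pair_iff]
      intro a b hab
      have := (LinearIndependent.pair_iff.mp hi') (a * c t) (a * c t * t + b * c t) (by
        rw [← hab, hpt]; module)
      have ha : a = 0 := (mul_eq_zero.mp this.1).resolve_right (hc t)
      refine ⟨ha, ?_⟩
      have h2 := this.2
      rw [ha] at h2
      simpa [hc t] using h2
    rw [lineMult_eq_of_line h.hF.1 h.hl h.l_ne_zero hdir (pl t)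
      (by rw [eval_linear_smul h.hl, hRl, mul_zero]), hpt, restrictLine_smul h.hF.1,
      restrictLine_shift, ← hρ] at hn
    have hc4 : c t ^ 4 ≠ 0 := pow_ne_zero 4 (hc t)
    have hcomp : ρ.comp (Polynomial.X + Polynomial.C t) ≠ 0 := by
      intro h0
      have := congrArg Polynomial.natDegree h0
      rw [Polynomial.natDegree_comp, hdeg, Polynomial.natDegree_X_add_C] at this
      simp at this
    have h3 := rootMultiplicity_eq_of_emultiplicity
      (mul_ne_zero (Polynomial.C_ne_zero.mpr hc4) hcomp) hn
    rw [Polynomial.count_roots, Polynomial.rootMultiplicity_eq_rootMultiplicity, ← h3,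
      Polynomial.rootMultiplicity_mul (mul_ne_zero (Polynomial.C_ne_zero.mpr hc4) hcomp),
      Polynomial.rootMultiplicity_C, zero_add]
  have htype : ∀ t ∈ ρ.roots, (τ (pt t) = A 1 ∧ ρ.roots.count t = 1) ∨
      (τ (pt t) = A 5 ∧ ρ.roots.count t = 3) := by
    intro t ht
    rcases (h.type_of_line (pmem t ht) (pl t) (pl' t ht)).2.2 with h3 | h3
    · exact Or.inl ⟨h3.1, hmult t 1 h3.2⟩
    · exact Or.inr ⟨h3.1, hmult t 3 h3.2⟩
  rcases exists_of_count_one_or_three hcard fun t ht => (htype t ht).imp And.right And.right with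
    ⟨h4, hone⟩ | ⟨t₀, t₁, hne, h3, h1', hall⟩
  -- Four simple intersections are four points of type A₁, and R is a fifth; the sextic has at most
  -- four.
  · exfalso
    have hRn : R ∉ ρ.roots.toFinset.image pt := by
      rw [Finset.mem_image]
      rintro ⟨t, ht, rfl⟩
      exact hRF ((pF0 t).mp (Multiset.mem_toFinset.mp ht))
    have := hcount (insert R (ρ.roots.toFinset.image pt)) (by
      intro P hP
      rcases Finset.mem_insert.mp hP with rfl | hP
      · exact h.mem_of_lines hRl hRl'
      · obtain ⟨t, ht, rfl⟩ := Finset.mem_image.mp hP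
        exact pmem t (Multiset.mem_toFinset.mp ht)) (by
      intro P hP
      rcases Finset.mem_insert.mp hP with rfl | hP
      · exact hRτ
      · obtain ⟨t, ht, rfl⟩ := Finset.mem_image.mp hP
        have ht' := Multiset.mem_toFinset.mp ht
        rcases htype t ht' with h5 | h5
        · exact h5.1
        · have := hone t ht'; omega)
    rw [Finset.card_insert_of_notMem hRn, Finset.card_image_of_injective _ pinj, h4] at this
    omega
  · have m0 : t₀ ∈ ρ.roots := Multiset.count_pos.mp (by omega)
    have m1 : t₁ ∈ ρ.roots := Multiset.count_pos.mp (by omega)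
    refine ⟨pt t₀, pt t₁, fun he => hne (pinj he), pmem _ m0, pmem _ m1, pl _, pl _,
      (pF0 _).mp m0, (pF0 _).mp m1, ?_, ?_, ?_⟩
    · rcases htype t₀ m0 with h5 | h5
      · omega
      · exact h5.1
    · rcases htype t₁ m1 with h5 | h5
      · exact h5.1
      · omega
    · intro N hN hNF
      obtain ⟨a, b, hab⟩ := exists_comb_of_line h.hl h.l_ne_zero hi' hu hRl hN
      have ha : a ≠ 0 := by
        rintro rfl
        rw [zero_smul, zero_add] at hab
        have := eq_of_rep_eq_smul hab
        rw [this] at hNF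
        exact hRF hNF
      have hNt : N = pt (b / a) := by
        -- The point N represented by a·u + b·R has parameter t = b/a, and `c` is the scalar
        -- relating u + tR to the chosen representative.
        apply eq_of_rep_eq_smul (a := a / c (b / a))
        rw [hpt, hab, smul_smul, div_mul_cancel₀ _ (hc _), smul_add, smul_smul,
          mul_div_cancel₀ _ ha]
      rw [hNt] at hNF
      have := hall _ ((pF0 _).mpr hNF)
      rw [hNt]
      exact this.imp (congrArg pt) (congrArg pt)

theorem flex_of_A5 {P : P2} (hPs : P ∈ s) (h1 : eval P.rep l = 0) (hF0 : eval P.rep F = 0)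
    (hτ : τ P = A 5) : P ∈ flexes F ∧ Associated l (tangentForm F P) := by
  have h2 : eval P.rep l' ≠ 0 := fun h0 => (h.type_of_lines h1 h0).2 hF0
  obtain ⟨-, ht, h3⟩ := h.type_of_line hPs h1 h2
  have h3' : lineMult F l P = 3 := by
    rcases h3 with h3 | h3
    · rw [hτ] at h3; simp at h3
    · exact h3.2
  have ha := associated_tangentForm h.hF.1 h.hl h.l_ne_zero h1 ht (by rw [h3']; norm_num)
  refine ⟨⟨isSmoothPt_iff.mpr ⟨hF0, ht⟩, ?_⟩, ha⟩
  rw [tangentMult, ← lineMult_congr ha, h3']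
  norm_num

end SexticData

/-- The quartic in a sextic with two further linear components. -/
theorem hasConfig_of_sextic {F l l' : Form} (hF : IsIrredQuartic F) (hl : l.IsHomogeneous 1)
    (hl' : l'.IsHomogeneous 1) {S S' : Multiset SingType}
    (hS : S = A 1 ::ₘ A 5 ::ₘ A 1 ::ₘ A 5 ::ₘ A 1 ::ₘ S') (hT : ∀ T ∈ S', IsListed T)
    (hcount : ∀ n, Multiset.replicate n (A 1) ≤ S → n ≤ 4)
    (hC : HasConfig (F * l * l') S) : HasConfig F S' ∧ AreFlexTangents F l l' := by
  classical
  obtain ⟨s, τ, hs, hτ, hm⟩ := hC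
  have h : SexticData F l l' s τ := by
    refine ⟨hF, hl, hl', hs, hτ, fun P hP => ?_⟩
    have : τ P ∈ S := by rw [← hm]; exact Multiset.mem_map_of_mem τ hP
    rw [hS] at this
    simp only [Multiset.mem_cons] at this
    rcases this with h | h | h | h | h | h
    · exact Or.inl h
    · exact Or.inr (Or.inr (Or.inl h))
    · exact Or.inl h
    · exact Or.inr (Or.inr (Or.inl h))
    · exact Or.inl h
    · exact hT _ h
  have hc : ∀ T ⊆ s, (∀ P ∈ T, τ P = A 1) → T.card ≤ 4 := by
    intro T hTs hT1
    apply hcount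
    rw [← hm]
    have : Multiset.replicate T.card (A 1) = T.val.map τ := by
      symm
      rw [Multiset.eq_replicate]
      refine ⟨by simp, ?_⟩
      intro b hb
      obtain ⟨P, hP, rfl⟩ := Multiset.mem_map.mp hb
      exact hT1 P hP
    rw [this]
    exact Multiset.map_le_map (Finset.val_le_iff.mpr hTs)
  obtain ⟨r₀, hr₀, h1, h2⟩ := exists_ne_zero_of_two_linear hl hl'
  obtain ⟨R, c₀, -, hRr⟩ := exists_pt_of_ne_zero hr₀
  have hRl : eval R.rep l = 0 := by rw [hRr, eval_linear_smul hl, h1, mul_zero]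
  have hRl' : eval R.rep l' = 0 := by rw [hRr, eval_linear_smul hl', h2, mul_zero]
  obtain ⟨hRτ, hRF⟩ := h.type_of_lines hRl hRl'
  obtain ⟨P, Q, hPQ, hPs, hQs, hPl, hQl, hPF, hQF, tP, tQ, hall⟩ := h.exists_on_line hc
  obtain ⟨P', Q', hPQ', hPs', hQs', hPl', hQl', hPF', hQF', tP', tQ', hall'⟩ :=
    h.symm.exists_on_line hc
  have off : ∀ N : P2, eval N.rep l = 0 → eval N.rep F = 0 → eval N.rep l' ≠ 0 :=
    fun N hN hNF h0 => (h.type_of_lines hN h0).2 hNF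
  have hRs : R ∈ s := h.mem_of_lines hRl hRl'
  have n1 : P ≠ R := by rintro rfl; exact hRF hPF
  have n2 : Q ≠ R := by rintro rfl; exact hRF hQF
  have n3 : P' ≠ R := by rintro rfl; exact hRF hPF'
  have n4 : Q' ≠ R := by rintro rfl; exact hRF hQF'
  have n5 : P' ≠ P := by rintro rfl; exact off _ hPl hPF hPl'
  have n6 : P' ≠ Q := by rintro rfl; exact off _ hQl hQF hPl'
  have n7 : Q' ≠ P := by rintro rfl; exact off _ hPl hPF hQl'
  have n8 : Q' ≠ Q := by rintro rfl; exact off _ hQl hQF hQl'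
  -- The order R, P, Q, P', Q' matches A₁, A₅, A₁, A₅, A₁ in `hS`, so that these types cancel one by
  -- one and leave S'.
  have hval : s.val = R ::ₘ P ::ₘ Q ::ₘ P' ::ₘ Q' ::ₘ
      (((((s.erase R).erase P).erase Q).erase P').erase Q').val := by
    simp only [Finset.erase_val]
    rw [Multiset.cons_erase, Multiset.cons_erase, Multiset.cons_erase, Multiset.cons_erase,
      Multiset.cons_erase] <;>
    simp only [← Finset.erase_val, Finset.mem_val, Finset.mem_erase]
    · exact hRs
    · exact ⟨n1, hPs⟩
    · exact ⟨hPQ.symm, n2, hQs⟩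
    · exact ⟨n6, n5, n3, hPs'⟩
    · exact ⟨hPQ'.symm, n8, n7, n4, hQs'⟩
  constructor
  · refine ⟨((((s.erase R).erase P).erase Q).erase P').erase Q', τ, ?_, ?_, ?_⟩
    · intro N
      simp only [Finset.mem_erase]
      constructor
      · rintro ⟨m1, m2, m3, m4, m5, hN⟩
        -- The five removed points are all the singular points of the sextic on the two lines, so
        -- the remaining ones lie off both, where the sextic is the quartic up to a unit.
        have k1 : eval N.rep l ≠ 0 := by
          intro h0
          by_cases h0' : eval N.rep l' = 0
          · exact m5 (h.eq_of_lines h0 h0' hRl hRl')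
          · rcases hall N h0 (h.type_of_line hN h0 h0').1 with h5 | h5
            · exact m4 h5
            · exact m3 h5
        have k2 : eval N.rep l' ≠ 0 := by
          intro h0
          rcases hall' N h0 (h.symm.type_of_line hN h0 k1).1 with h5 | h5
          · exact m2 h5
          · exact m1 h5
        exact (h.type_off_lines k1 k2).1.mp hN
      · intro hN
        have hNF : eval N.rep F = 0 := hN.1
        have hNt := (isSingularPt_iff.mp hN).2
        have k1 : eval N.rep l ≠ 0 := fun h0 =>
          (h.type_of_line (h.mem_of_line h0 hNF) h0 (off N h0 hNF)).2.1 hNt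
        have k2 : eval N.rep l' ≠ 0 := fun h0 =>
          (h.symm.type_of_line (h.symm.mem_of_line h0 hNF) h0 k1).2.1 hNt
        refine ⟨?_, ?_, ?_, ?_, ?_, (h.type_off_lines k1 k2).1.mpr hN⟩
        · rintro rfl; exact k2 hQl'
        · rintro rfl; exact k2 hPl'
        · rintro rfl; exact k1 hQl
        · rintro rfl; exact k1 hPl
        · rintro rfl; exact k1 hRl
    · intro N hN
      simp only [Finset.mem_erase] at hN
      obtain ⟨m1, m2, m3, m4, m5, hN⟩ := hN
      have k1 : eval N.rep l ≠ 0 := by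
        intro h0
        by_cases h0' : eval N.rep l' = 0
        · exact m5 (h.eq_of_lines h0 h0' hRl hRl')
        · rcases hall N h0 (h.type_of_line hN h0 h0').1 with h5 | h5
          · exact m4 h5
          · exact m3 h5
      have k2 : eval N.rep l' ≠ 0 := by
        intro h0
        rcases hall' N h0 (h.symm.type_of_line hN h0 k1).1 with h5 | h5
        · exact m2 h5
        · exact m1 h5
      exact (h.type_off_lines k1 k2).2 hN
    · rw [hval, hS] at hm
      simp only [Multiset.map_cons, hRτ, tP, tQ, tP', tQ'] at hm
      simpa only [Multiset.cons_inj_right] using hm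
  · obtain ⟨f1, a1⟩ := h.flex_of_A5 hPs hPl hPF tP
    obtain ⟨f2, a2⟩ := h.symm.flex_of_A5 hPs' hPl' hPF' tP'
    exact ⟨P, f1, P', f2, n5.symm, a1, a2⟩

/-- Three A₁ are always present, so at most one in S' keeps the total within the bound of four that
excludes a line with four simple intersections. -/
theorem hasConfig_of_sextic_config {F l l' : Form} (hF : IsIrredQuartic F)
    (hl : l.IsHomogeneous 1) (hl' : l'.IsHomogeneous 1) {S' : Multiset SingType}
    (hT : ∀ T ∈ S', IsListed T) (hcount : ∀ n, Multiset.replicate n (A 1) ≤ S' → n ≤ 1)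
    (hC : HasConfig (F * l * l') (2 • {A 5} + 3 • {A 1} + S')) :
    HasConfig F S' ∧ AreFlexTangents F l l' := by
  classical
  refine hasConfig_of_sextic hF hl hl' (S' := S') ?_ hT ?_ hC
  · simp only [← Multiset.singleton_add]
    abel
  · intro n hn
    rw [← Multiset.le_count_iff_replicate_le] at hn
    have h1 := hcount (S'.count (A 1)) (Multiset.le_count_iff_replicate_le.mp le_rfl)
    simp [Multiset.count_singleton] at hn
    omega

end PlaneCurve

end

/-! ### The theorem. -/

open PlaneCurve PlaneCurve.SingType
theorem theorem4 :
    -- (a) sextics `B₄ + B₁ + B₁'` with `[3A₅, 3A₁]`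
    (∀ F l l' : Form, IsIrredQuartic F → l.IsHomogeneous 1 → l'.IsHomogeneous 1 →
      HasConfig (F * l * l') (3 • {A 5} + 3 • {A 1}) →
        HasConfig F {A 5} ∧ AreFlexTangents F l l') ∧
    -- (a) quartics with one `A₅`
    (∀ F : Form, IsIrredQuartic F → HasConfig F {A 5} →
      (flexes F).Finite ∧ ∑ᶠ P ∈ flexes F, flexOrder F P = 6 ∧
      2 ≤ (torusPairs F).ncard ∧
      (OrdinaryFlexes F →
        (flexes F).ncard = 6 ∧ (torusPairs F).ncard = 3 ∧ (nonTorusPairs F).ncard = 12)) ∧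
    -- (b) sextics `B₄ + B₁ + B₁'` with `[2A₅, 2A₂, 3A₁]`
    (∀ F l l' : Form, IsIrredQuartic F → l.IsHomogeneous 1 → l'.IsHomogeneous 1 →
      HasConfig (F * l * l') (2 • {A 5} + 2 • {A 2} + 3 • {A 1}) →
        HasConfig F (2 • {A 2}) ∧ AreFlexTangents F l l') ∧
    -- (b) quartics with `2A₂`
    (∀ F : Form, IsIrredQuartic F → HasConfig F (2 • {A 2}) →
      (flexes F).Finite ∧ ∑ᶠ P ∈ flexes F, flexOrder F P = 8 ∧
      (torusPairs F).Nonempty ∧ (nonTorusPairs F).Nonempty ∧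
      (OrdinaryFlexes F → (flexes F).ncard = 8)) ∧
    -- (b) sextics `B₄ + B₁ + B₁'` with `[2A₅, 2A₂, 4A₁]`
    (∀ F l l' : Form, IsIrredQuartic F → l.IsHomogeneous 1 → l'.IsHomogeneous 1 →
      HasConfig (F * l * l') (2 • {A 5} + 2 • {A 2} + 4 • {A 1}) →
        HasConfig F (2 • {A 2} + {A 1}) ∧ AreFlexTangents F l l' ∧
        (flexes F).ncard = 2 ∧ IsTorusType (F * l * l')) ∧
    -- (b) quartics with `2A₂ + A₁`
    (∀ F : Form, IsIrredQuartic F → HasConfig F (2 • {A 2} + {A 1}) →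
      (flexes F).Finite ∧ ∑ᶠ P ∈ flexes F, flexOrder F P = 2 ∧
      (OrdinaryFlexes F →
        (flexes F).ncard = 2 ∧ (torusPairs F).ncard = 1 ∧ nonTorusPairs F = ∅)) ∧
    -- (c) sextics `B₄ + B₁ + B₁'` with `[E₆, 2A₅, 3A₁]`
    (∀ F l l' : Form, IsIrredQuartic F → l.IsHomogeneous 1 → l'.IsHomogeneous 1 →
      HasConfig (F * l * l') ({E6} + 2 • {A 5} + 3 • {A 1}) →
        HasConfig F {E6} ∧ AreFlexTangents F l l' ∧
        (flexes F).ncard = 2 ∧ IsTorusType (F * l * l')) ∧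
    -- (c) quartics with `E₆`
    (∀ F : Form, IsIrredQuartic F → HasConfig F {E6} →
      (flexes F).Finite ∧ ∑ᶠ P ∈ flexes F, flexOrder F P = 2 ∧
      (OrdinaryFlexes F →
        (flexes F).ncard = 2 ∧ (torusPairs F).ncard = 1 ∧ nonTorusPairs F = ∅)) := by
  classical
  have listed : ∀ {T : SingType}, IsListed T → ∀ T' ∈ ({T} : Multiset SingType), IsListed T' := by
    intro T hT T' h'
    rw [Multiset.mem_singleton] at h'
    rwa [h']
  have l1 : IsListed (A 1) := Or.inl rfl
  have l2 : IsListed (A 2) := Or.inr (Or.inl rfl)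
  have l5 : IsListed (A 5) := Or.inr (Or.inr (Or.inl rfl))
  have l6 : IsListed E6 := Or.inr (Or.inr (Or.inr rfl))
  have l22 : ∀ T' ∈ (2 • {A 2} : Multiset SingType), IsListed T' := by
    intro T' h'
    rw [two_nsmul, Multiset.mem_add] at h'
    exact h'.elim (listed l2 T') (listed l2 T')
  refine ⟨?_, fun F hF hc => hF.flexes_A5 hc, ?_, fun F hF hc => hF.flexes_two_A2 hc, ?_, ?_, ?_, ?_⟩
  · intro F l l' hF hl hl' hC
    refine hasConfig_of_sextic_config hF hl hl' (listed l5) (fun n hn => ?_) ?_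
    · rw [← Multiset.le_count_iff_replicate_le] at hn
      simp [Multiset.count_singleton] at hn
      omega
    · convert hC using 1
      abel
  · intro F l l' hF hl hl' hC
    refine hasConfig_of_sextic_config hF hl hl' l22 (fun n hn => ?_) ?_
    · rw [← Multiset.le_count_iff_replicate_le] at hn
      simp [Multiset.count_singleton] at hn
      omega
    · convert hC using 1
      abel
  · intro F l l' hF hl hl' hC
    obtain ⟨h1, h2⟩ := hasConfig_of_sextic_config hF hl hl' (S' := 2 • {A 2} + {A 1})
      (fun T hT => (Multiset.mem_add.mp hT).elim (l22 T) (listed l1 T)) (fun n hn => by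
        rw [← Multiset.le_count_iff_replicate_le] at hn
        simpa [Multiset.count_singleton] using hn) (by
        convert hC using 1
        abel)
    obtain ⟨D, s, w, z, h, Z, hZ, hc⟩ := hF.flexes_two_A2_A1 h1
    exact ⟨h1, h2, h.isTorusType_of_card_one hZ hc h2⟩
  · intro F hF hc
    obtain ⟨D, s, w, z, h, Z, hZ, hc⟩ := hF.flexes_two_A2_A1 hc
    exact h.flexes_of_card_one hZ hc
  · intro F l l' hF hl hl' hC
    obtain ⟨h1, h2⟩ := hasConfig_of_sextic_config hF hl hl' (S' := {E6})
      (listed l6) (fun n hn => by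
        rw [← Multiset.le_count_iff_replicate_le] at hn
        simp [Multiset.count_singleton] at hn
        omega) (by
        convert hC using 1
        abel)
    obtain ⟨D, s, w, z, h, Z, hZ, hc⟩ := hF.flexes_E6 h1
    exact ⟨h1, h2, h.isTorusType_of_card_one hZ hc h2⟩
  · intro F hF hc
    obtain ⟨D, s, w, z, h, Z, hZ, hc⟩ := hF.flexes_E6 hc
    exact h.flexes_of_card_one hZ hc
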